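/- **Setting.** Let $k\ge 0$ and let $\Lambda$ be a probability distribution on functions $f:\{\pm1\}^k\to[-1,1]$. Write $\widehat f(T)=2^{-k}\sum_{\sigma}f(\sigma)\prod_{i\in T}\sigma_i$ for $T\subseteq[k]$, $\|f^{=j}\|^2=\sum_{|T|=j}\widehat f(T)^2$, $\mathbb E_\Lambda[f]=\mathbb E_{f\sim\Lambda}[\widehat f(\varnothing)]$ and $\xi(s)=\sum_{j=1}^k\mathbb E_{f\sim\Lambda}\big[\|f^{=j}\|^2\big]\,s^j$. *CSP instances.* An instance of clause density $a\ge0$ on $n$ variables consists of $\lfloor an\rfloor$ i.i.d. constraints $e$; each draws $f\sim\Lambda$, i.i.d. uniform indices $i_1,\dots,i_k\in[n]$ and i.i.d. uniform signs $\varepsilon_1,\dots,\varepsilon_k\in\{\pm1\}$, all independent, and has value $f_e(\sigma)=f(\varepsilon_1\sigma_{i_1},\dots,\varepsilon_k\sigma_{i_k})$ at $\sigma\in\{\pm1\}^n$. *Spin glasses.* For a polynomial $\zeta(s)=\sum_{p=1}^k c_p^2s^p$ with $c_p\ge 0$, a spin glass with mixture polynomial $\zeta$ is $\sum_{p=1}^k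 c_p\,n^{-(p-1)/2}\sum_{i_1,\dots,i_p\in[n]}J^{(p)}[i_1,\dots,i_p]\,\sigma_{i_1}\cdots\sigma_{i_p}$ with i.i.d. standard Gaussian $J^{(p)}[i_1,\dots,i_p]$. *Coupled models.* Let $\ell\ge1$, $\ell'\ge 0$, $A\in\{0,1\}^{\ell\times\ell'}$ and $b\in\mathbb R_{\ge0}^{\ell'}$ with $(Ab)_i=1$ for all $i\in[\ell]$, and let $\alpha>0$. The $(A,b)$-coupled CSP model has grand Hamiltonian $\mathcal H(\mathbf x)=\sum_{i=1}^{\ell}\sum_{j=1}^{\ell'}A_{ij}\mathcal H'_j(\mathbf x_i)$ for $\mathbf x\in(\{\pm1\}^n)^\ell$, where $\mathcal H'_j(\sigma)=\frac1\alpha\sum_e f_e(\sigma)$, the sum being over the constraints of the $j$-th of $\ell'$ independent instances, which has clause density $b_j\alpha$. The $(A,b)$-coupled spin glass model has grand Hamiltonian $\mathcal G(\mathbf x)=\sum_{i=1}^{\ell}\sum_{j=1}^{\ell'}A_{ij}\mathcal G'_j(\mathbf x_i)$, where $\mathcal G'_1,\dots,\mathcal G'_{\ell'}$ are independent spin glasses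 with mixture polynomials $b_1\xi,\dots,b_{\ell'}\xi$. For each $n$ the two models are defined on a common probability space, with an arbitrary joint law. *Overlaps.* The overlap vector of $\mathbf x\in(\{\pm1\}^n)^\ell$, $n\ge 1$, is $Q(\mathbf x)=\big(\frac1n\sum_{j=1}^n\prod_{i\in I}(\mathbf x_i)_j\big)_{I\subseteq[\ell]}$. Let $\mathcal R^{(\ell)}\subseteq\mathbb R^{2^{[\ell]}}$ be the closure of the set of all overlap vectors, over all $n\ge1$, and for $S\subseteq\mathcal R^{(\ell)}$ let $U_n(S)=\{\mathbf x\in(\{\pm1\}^n)^\ell:Q(\mathbf x)\in S\}$. **Statement.** For every $\ell\ge1$ there is a constant $C>0$, depending only on $\ell$, such that the following holds for all $k,\ell',\Lambda,A,b$ as above, all relatively open $S\subseteq\mathcal R^{(\ell)}$ and all $\alpha\ge C$. The maxima below are integrable, and there are real numbers $e_n$ with $|e_n|\le C\alpha^{-2/3}$ for all $n$ and a deterministic sequence $r_n\to0$ such that, for every $n \ge 1$ with $U_n(S)\neq\varnothing$, $$\mathbb E\max_{\mathbf x\in U_n(S)}\frac1{\ell n}\mathcal H(\mathbf x)=\mathbb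 E_\Lambda[f]+\frac1{\sqrt\alpha}\,\mathbb E\max_{\mathbf x\in U_n(S)}\frac1{\ell n}\mathcal G(\mathbf x)+e_n+r_n .$$ Moreover, with the same $e_n$, there are random variables $R_n$ and a deterministic sequence $\delta_n\to0$ with $\Pr[|R_n|>\delta_n]\to0$ as $n\to\infty$ such that, for every $n \ge 1$ with $U_n(S)\neq\varnothing$, $$\max_{\mathbf x\in U_n(S)}\frac1{\ell n}\mathcal H(\mathbf x)=\mathbb E_\Lambda[f]+\frac1{\sqrt\alpha}\max_{\mathbf x\in U_n(S)}\frac1{\ell n}\mathcal G(\mathbf x)+e_n+R_n .$$ -/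

import Mathlib

open MeasureTheory ProbabilityTheory Filter Topology Matrix

noncomputable section

namespace MaxCSP

/-! ### Assignments -/

/-- Every set of signs is measurable. -/
instance : MeasurableSingletonClass ℤˣ where
  measurableSet_singleton u :=
    ⟨{(u : ℤ)}, measurableSet_singleton _, by ext v; simp [Units.ext_iff]⟩

/-- Assignments `σ ∈ {±1}ⁿ`; the alphabet `{±1}` is the group of units of `ℤ`. -/
abbrev Cube (n : ℕ) : Type := Fin n → ℤˣ

/-- The real number `±1` represented by a sign. -/
abbrev spin (u : ℤˣ) : ℝ := ((u : ℤ) : ℝ)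

/-- Predicates `f : {±1}ᵏ → ℝ` (with the product Borel σ-algebra). -/
abbrev Predicate (k : ℕ) : Type := Cube k → ℝ

/-! ### Fourier analysis on the hypercube -/

/-- The Fourier coefficient `f̂(T) = E_σ [f(σ) ∏_{i ∈ T} σ_i]`, with `σ` uniform on `{±1}ᵏ`. -/
def fourierCoefficient {k : ℕ} (f : Predicate k) (T : Finset (Fin k)) : ℝ :=
  (∑ σ : Cube k, f σ * ∏ i ∈ T, spin (σ i)) / 2 ^ k

/-- The Fourier weight `‖f^{=j}‖² = ∑_{|T| = j} f̂(T)²`. -/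
def fourierWeight {k : ℕ} (f : Predicate k) (j : ℕ) : ℝ :=
  ∑ T ∈ Finset.powersetCard j Finset.univ, fourierCoefficient f T ^ 2

/-- `E_{f ∼ Λ}[f]`, the mean over `f ∼ Λ` of the average value `f̂(∅)` of `f`. -/
def meanValue {k : ℕ} (Λ : Measure (Predicate k)) : ℝ :=
  ∫ f, fourierCoefficient f ∅ ∂Λ

/-- The mixture polynomial associated with `Λ`:
`ξ(s) = E_{f ∼ Λ}[Stab_s(f) - f̂(∅)²] = ∑_{j=1}^k E_{f ∼ Λ}[‖f^{=j}‖²] s^j`. -/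
def mixture {k : ℕ} (Λ : Measure (Predicate k)) : Polynomial ℝ :=
  ∑ j ∈ Finset.Icc 1 k, Polynomial.C (∫ f, fourierWeight f j ∂Λ) * Polynomial.X ^ j

/-! ### Random constraint satisfaction problems -/

/-- A constraint on `n` variables: a predicate `f`, indices `i₁, …, i_k ∈ [n]`, and
signs `ε₁, …, ε_k`. -/
abbrev Clause (k n : ℕ) : Type := Predicate k × (Fin k → Fin n) × Cube k

/-- The value `f(ε₁ σ_{i₁}, …, ε_k σ_{i_k})` of a constraint at `σ`. -/
def Clause.value {k n : ℕ} (e : Clause k n) (σ : Cube n) : ℝ :=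
  e.1 fun a => e.2.2 a * σ (e.2.1 a)

/-- The law of a random constraint: `f ∼ Λ`, and, independently of it and of each other,
`k` i.i.d. uniform indices (a uniform element of `[n]ᵏ`) and `k` i.i.d. uniform signs
(a uniform element of `{±1}ᵏ`). -/
def clauseLaw {k : ℕ} (Λ : Measure (Predicate k)) (n : ℕ) : Measure (Clause k n) :=
  Λ.prod ((uniformOn (Set.univ : Set (Fin k → Fin n))).prod
    (uniformOn (Set.univ : Set (Cube k))))

/-- The number of constraints of an instance of clause density `a` on `n` variables: `a n`,
rounded down to an integer. -/
def numClauses (a : ℝ) (n : ℕ) : ℕ := ⌊a * n⌋₊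

/-- The constraints of an instance of clause density `a` on `n` variables. -/
abbrev CSPInstance (k : ℕ) (a : ℝ) (n : ℕ) : Type := Fin (numClauses a n) → Clause k n

/-- The law of an instance of clause density `a`: i.i.d. random constraints. -/
def cspLaw {k : ℕ} (Λ : Measure (Predicate k)) (a : ℝ) (n : ℕ) :
    Measure (CSPInstance k a n) :=
  Measure.pi fun _ => clauseLaw Λ n

/-- `σ ↦ (1/α) ∑_e f_e(σ_e)`. The normalization `α` is a separate argument: in a coupled
model the hidden instances have various clause densities but the common normalization `α`
of the observed model. -/
def cspHamiltonian {k n : ℕ} {a : ℝ} (α : ℝ) (I : CSPInstance k a n) (σ : Cube n) : ℝ :=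
  (1 / α) * ∑ e, (I e).value σ

/-! ### Mixed spin glasses -/

/-- Disorder coefficients `J⁽ᵖ⁾[i₁, …, i_p]` for `1 ≤ p ≤ k` and `i₁, …, i_p ∈ [n]`.
The index `p : Fin k` stands for the order `p + 1`. -/
abbrev Disorder (k n : ℕ) : Type := (Σ p : Fin k, Fin (p.val + 1) → Fin n) → ℝ

/-- Gaussian disorder: all coefficients are i.i.d. standard Gaussian. -/
def disorderLaw (k n : ℕ) : Measure (Disorder k n) :=
  Measure.pi fun _ => gaussianReal 0 1

/-- The spin glass Hamiltonian with mixture polynomial `ξ(s) = ∑_{p=1}^k c_p² s^p`,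
`∑_{p=1}^k c_p n^{-(p-1)/2} ∑_{i₁, …, i_p} J⁽ᵖ⁾[i₁, …, i_p] σ_{i₁} ⋯ σ_{i_p}`.
(The order is `p + 1` in the code.) -/
def sgHamiltonian {k n : ℕ} (ξ : Polynomial ℝ) (J : Disorder k n) (σ : Cube n) : ℝ :=
  ∑ p : Fin k, √(ξ.coeff (p.val + 1)) / (n : ℝ) ^ ((p.val : ℝ) / 2) *
    ∑ i : Fin (p.val + 1) → Fin n, J ⟨p, i⟩ * ∏ a, spin (σ (i a))

/-! ### Overlaps -/

/-- The overlap vector of `x = (x₁, …, x_ℓ)`: its `I`-th entry, for `I ⊆ [ℓ]`, is the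
`I`-overlap `(1/n) ∑_{j=1}^n ∏_{i ∈ I} (x_i)_j`. -/
def overlapVector {ℓ n : ℕ} (x : Fin ℓ → Cube n) : Finset (Fin ℓ) → ℝ :=
  fun I => (∑ j, ∏ i ∈ I, spin (x i j)) / n

/-- The overlap polytope: the closure of the set of all overlap vectors of `ℓ`-tuples, in all
dimensions `n ≥ 1`. -/
def overlapPolytope (ℓ : ℕ) : Set (Finset (Fin ℓ) → ℝ) :=
  closure {q | ∃ n : ℕ, 0 < n ∧ ∃ x : Fin ℓ → Cube n, overlapVector x = q}

/-- `U_n(S)`: the tuples in dimension `n` whose overlap vector lies in `S`. -/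
def overlapPreimage {ℓ : ℕ} (S : Set (overlapPolytope ℓ)) (n : ℕ) : Set (Fin ℓ → Cube n) :=
  {x | ∃ q ∈ S, overlapVector x = q}

/-! ### Coupled models -/

/-- Admissible coupling data: `A` is a `0`-`1` matrix, `b ≥ 0` and `A b = (1, …, 1)`. -/
structure IsCoupling {ℓ ℓ' : ℕ} (A : Matrix (Fin ℓ) (Fin ℓ') ℝ) (b : Fin ℓ' → ℝ) : Prop where
  zero_one : ∀ i j, A i j = 0 ∨ A i j = 1
  nonneg : ∀ j, 0 ≤ b j
  mulVec_eq_one : ∀ i, (A *ᵥ b) i = 1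

/-- The grand Hamiltonian `x ↦ ∑_i H_i(x_i)`, where `(H_1, …, H_ℓ)ᵀ = A (H'_1, …, H'_ℓ')ᵀ`. -/
def grandHamiltonian {ℓ ℓ' n : ℕ} (A : Matrix (Fin ℓ) (Fin ℓ') ℝ)
    (H' : Fin ℓ' → Cube n → ℝ) (x : Fin ℓ → Cube n) : ℝ :=
  ∑ i, (A *ᵥ fun j => H' j (x i)) i

/-- The hidden instances of a coupled CSP model: independent instances `I j`, the `j`-th one of
clause density `b_j α`. -/
structure IsHiddenCSP {k ℓ' n : ℕ} (Λ : Measure (Predicate k)) (α : ℝ) (b : Fin ℓ' → ℝ)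
    {Ω : Type*} [MeasurableSpace Ω] (P : Measure Ω)
    (I : (j : Fin ℓ') → Ω → CSPInstance k (b j * α) n) : Prop where
  law : ∀ j, HasLaw (I j) (cspLaw Λ (b j * α) n) P
  indep : iIndepFun I P

/-- The grand Hamiltonian of the `(A, b)`-coupled CSP model with hidden instances `I`. -/
def cspGrand {k ℓ ℓ' n : ℕ} (α : ℝ) (A : Matrix (Fin ℓ) (Fin ℓ') ℝ) (b : Fin ℓ' → ℝ)
    (I : (j : Fin ℓ') → CSPInstance k (b j * α) n) : (Fin ℓ → Cube n) → ℝ :=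
  grandHamiltonian A fun j => cspHamiltonian α (I j)

/-- The hidden disorders of a coupled spin glass model: independent Gaussian disorders. -/
structure IsHiddenDisorder {k ℓ' n : ℕ} {Ω : Type*} [MeasurableSpace Ω] (P : Measure Ω)
    (J : Fin ℓ' → Ω → Disorder k n) : Prop where
  law : ∀ j, HasLaw (J j) (disorderLaw k n) P
  indep : iIndepFun J P

/-- The grand Hamiltonian of the `(A, b)`-coupled spin glass model with hidden disorders `J`: the
`j`-th hidden spin glass has mixture polynomial `b_j ξ`, that is, it is `√b_j` times a spin glass
with mixture polynomial `ξ`. -/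
def sgGrand {k ℓ ℓ' n : ℕ} (ξ : Polynomial ℝ) (A : Matrix (Fin ℓ) (Fin ℓ') ℝ) (b : Fin ℓ' → ℝ)
    (J : Fin ℓ' → Disorder k n) : (Fin ℓ → Cube n) → ℝ :=
  grandHamiltonian A fun j => sgHamiltonian (Polynomial.C (b j) * ξ) (J j)

/-- `max_{x ∈ U_n(S)} (1/(ℓ n)) H(x)`. (The supremum is over a finite set, hence it is a maximum
as soon as `U_n(S)` is nonempty.) -/
def normalizedMax {ℓ n : ℕ} (S : Set (overlapPolytope ℓ)) (H : (Fin ℓ → Cube n) → ℝ) : ℝ :=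
  ⨆ x : overlapPreimage S n, H x / (ℓ * n)

end MaxCSP

end

noncomputable section

/-! Write ξ for the mixture polynomial of Λ. The proof is a Lindeberg exchange on the smooth maximum
`(1/β) log ∑ exp (β h)`, followed by a variance bound.

After its mean given the predicate is subtracted, a random constraint is a small centered random
field on the configurations. Averaging over the signs makes its covariance diagonal in the Fourier
basis, and averaging over the indices turns each character of level `j` into the `j`-th power of an
overlap. Hence the covariance at two assignments is ξ of their overlap
(`integral_centeredValue_mul`). A spin glass with mixture ξ has the same covariance up to the factor
`n` (`sum_sgMatrix_mul`), so one constraint scaled by `1/α` has exactly the covariance of a Gaussian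
field of variance parameter `1/(n α²)`.

The smooth maximum is expanded to second order in a small added field. Only the mean and covariance
enter the main terms, and the remainder is of order `β²` times third moments, that is `β² (ℓ/α)³`
(`IsSubexponential.abs_integral_logSumExp_sub_le`). The estimate is uniform in the field already
present, so constraints can be exchanged one at a time and the errors add (`IsClose.conv`). In each
hidden instance the Gaussian pieces add up to variance `b_j/α`, apart from a fraction of one piece
lost to rounding; this explains the factor `1/√α`.

Passing between the maximum and the smooth maximum costs at most `1/β` after normalisation, because
there are at most `2^(ℓ n)` configurations. The exchange costs a constant times `ℓ³ β²/α²`. The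
choice `β = α^(2/3)` makes both errors of order `α^(-2/3)` (`error_terms_eq`); rounding contributes
`O(1/n)` for fixed data. The dependence on the coupling disappears from the leading error because
`∑_j (∑_i A_ij) b_j = ℓ`.

The second claim follows from the first. By Efron–Stein, each normalised maximum has variance
`O(1/n)`, so by Chebyshev it is close to its mean. Only the two marginal laws enter, so the joint
law of the models is irrelevant. -/

namespace MaxCSP

/-! ### Third-order expansion of the logarithm of a partition function -/

section Tilt

variable {ι : Type*} [Fintype ι]

/-- The third cumulant of a probability vector is controlled by its third absolute moment. -/
lemma abs_third_cumulant_le {p y : ι → ℝ} (hp : ∀ x, 0 ≤ p x) (hp1 : ∑ x, p x = 1) :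
    |∑ x, p x * y x ^ 3 - 3 * (∑ x, p x * y x) * (∑ x, p x * y x ^ 2)
      + 2 * (∑ x, p x * y x) ^ 3| ≤ 8 * ∑ x, p x * |y x| ^ 3 := by
  set m := ∑ x, p x * y x with hm
  -- The third cumulant is the third central moment.
  have key : ∑ x, p x * y x ^ 3 - 3 * m * (∑ x, p x * y x ^ 2) + 2 * m ^ 3
      = ∑ x, p x * (y x - m) ^ 3 := by
    have : ∀ x, p x * (y x - m) ^ 3 = p x * y x ^ 3 - 3 * m * (p x * y x ^ 2)
        + 3 * m ^ 2 * (p x * y x) - m ^ 3 * p x := fun x => by ring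
    simp_rw [this, Finset.sum_sub_distrib, Finset.sum_add_distrib, Finset.sum_sub_distrib,
      ← Finset.mul_sum, hp1, ← hm]
    ring
  have hm3 : |m| ^ 3 ≤ ∑ x, p x * |y x| ^ 3 := by
    have h1 : |m| ≤ ∑ x, p x * |y x| := by
      refine (Finset.abs_sum_le_sum_abs _ _).trans_eq (Finset.sum_congr rfl fun x _ => ?_)
      rw [abs_mul, abs_of_nonneg (hp x)]
    exact (pow_le_pow_left₀ (abs_nonneg _) h1 3).trans
      (Real.pow_arith_mean_le_arith_mean_pow _ _ _ (fun x _ => hp x) hp1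
        (fun x _ => abs_nonneg _) 3)
  rw [key]
  calc |∑ x, p x * (y x - m) ^ 3| ≤ ∑ x, |p x * (y x - m) ^ 3| := Finset.abs_sum_le_sum_abs _ _
    _ ≤ ∑ x, (4 * (p x * |y x| ^ 3) + 4 * |m| ^ 3 * p x) := by
        refine Finset.sum_le_sum fun x _ => ?_
        rw [abs_mul, abs_of_nonneg (hp x), abs_pow]
        have h1 : |y x - m| ^ 3 ≤ (|y x| + |m|) ^ 3 :=
          pow_le_pow_left₀ (abs_nonneg _) (abs_sub _ _) 3
        -- Convexity of the cube: the difference of the two sides is `3 (a + m) (a - m)²` with `a`,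
        -- `m` the absolute values. The two terms then contribute `4` each to the constant `8`.
        have h2 : (|y x| + |m|) ^ 3 ≤ 4 * |y x| ^ 3 + 4 * |m| ^ 3 := by
          nlinarith [mul_nonneg (add_nonneg (abs_nonneg (y x)) (abs_nonneg m))
            (sq_nonneg (|y x| - |m|))]
        nlinarith [mul_le_mul_of_nonneg_left (h1.trans h2) (hp x)]
    _ = 4 * ∑ x, p x * |y x| ^ 3 + 4 * |m| ^ 3 := by
        rw [Finset.sum_add_distrib, ← Finset.mul_sum, ← Finset.mul_sum, hp1, mul_one]
    _ ≤ 8 * ∑ x, p x * |y x| ^ 3 := by linarith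

/-- The moments `∑ w y^k e^{ty}` of an exponentially tilted weight. -/
def tiltedMoment (w y : ι → ℝ) (k : ℕ) (t : ℝ) : ℝ := ∑ x, w x * y x ^ k * Real.exp (t * y x)

lemma hasDerivAt_tiltedMoment (w y : ι → ℝ) (k : ℕ) (t : ℝ) :
    HasDerivAt (tiltedMoment w y k) (tiltedMoment w y (k + 1) t) t := by
  unfold tiltedMoment
  refine HasDerivAt.fun_sum fun x _ => ?_
  have h := (((hasDerivAt_id t).mul_const (y x)).exp).const_mul (w x * y x ^ k)
  refine h.congr_deriv ?_
  simp only [id]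
  ring

lemma tiltedMoment_zero_pos {w y : ι → ℝ} (hw : ∀ x, 0 ≤ w x) (hw1 : ∑ x, w x = 1) (t : ℝ) :
    0 < tiltedMoment w y 0 t := by
  have hne : ∃ x ∈ Finset.univ, 0 < w x := by
    by_contra! h
    have : ∑ x, w x ≤ 0 := Finset.sum_nonpos h
    linarith
  refine Finset.sum_pos' (fun x _ => ?_) ?_
  · have := hw x; positivity
  · obtain ⟨x, hx, h⟩ := hne
    exact ⟨x, hx, by positivity⟩

/-- A tilted expectation is at most a product of two untilted ones. -/
lemma sum_tilted_div_le {w y : ι → ℝ} (hw : ∀ x, 0 ≤ w x) (hw1 : ∑ x, w x = 1) {t : ℝ}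
    (ht : t ∈ Set.Icc (0 : ℝ) 1) :
    (∑ x, w x * |y x| ^ 3 * Real.exp (t * y x)) / tiltedMoment w y 0 t
      ≤ (∑ x, w x * (|y x| ^ 3 * Real.exp |y x|)) * ∑ x, w x * Real.exp |y x| := by
  have hZ := tiltedMoment_zero_pos (y := y) hw hw1 t
  have hexp : ∀ x, Real.exp (t * y x) ≤ Real.exp |y x| := fun x => by
    refine Real.exp_le_exp.2 ((le_abs_self _).trans ?_)
    rw [abs_mul, abs_of_nonneg ht.1]
    exact mul_le_of_le_one_left (abs_nonneg _) ht.2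
  have hexp' : ∀ x, Real.exp (-(t * y x)) ≤ Real.exp |y x| := fun x => by
    refine Real.exp_le_exp.2 ((neg_le_abs _).trans ?_)
    rw [abs_mul, abs_of_nonneg ht.1]
    exact mul_le_of_le_one_left (abs_nonneg _) ht.2
  -- Cauchy–Schwarz for the weights `w e^{ty}` and `w e^{-ty}`, whose product is `w²`: it bounds the
  -- normaliser from below, so dividing by it costs at most a factor `∑ w e^{|y|}`.
  have hcs : 1 ≤ tiltedMoment w y 0 t * ∑ x, w x * Real.exp |y x| := by
    have h := Finset.sum_sq_le_sum_mul_sum_of_sq_le_mul Finset.univ (r := w)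
      (f := fun x => w x * y x ^ 0 * Real.exp (t * y x))
      (g := fun x => w x * Real.exp (-(t * y x)))
      (fun x _ => by have := hw x; positivity) (fun x _ => by have := hw x; positivity)
      (fun x _ => le_of_eq (by rw [Real.exp_neg]; field_simp))
    rw [hw1, one_pow] at h
    refine h.trans (mul_le_mul_of_nonneg_left ?_ hZ.le)
    exact Finset.sum_le_sum fun x _ => mul_le_mul_of_nonneg_left (hexp' x) (hw x)
  rw [div_le_iff₀ hZ]
  have h3 : ∑ x, w x * |y x| ^ 3 * Real.exp (t * y x)
      ≤ ∑ x, w x * (|y x| ^ 3 * Real.exp |y x|) := by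
    refine Finset.sum_le_sum fun x _ => ?_
    rw [mul_assoc]
    exact mul_le_mul_of_nonneg_left (mul_le_mul_of_nonneg_left (hexp x) (by positivity)) (hw x)
  have h4 : 0 ≤ ∑ x, w x * (|y x| ^ 3 * Real.exp |y x|) :=
    Finset.sum_nonneg fun x _ => by have := hw x; positivity
  calc _ ≤ (∑ x, w x * (|y x| ^ 3 * Real.exp |y x|)) * 1 := by rw [mul_one]; exact h3
    _ ≤ (∑ x, w x * (|y x| ^ 3 * Real.exp |y x|)) *
        (tiltedMoment w y 0 t * ∑ x, w x * Real.exp |y x|) := mul_le_mul_of_nonneg_left hcs h4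
    _ = _ := by ring

/-- A crude form of Taylor's theorem of order two. -/
lemma taylor_two_of_bound {f f₁ f₂ f₃ : ℝ → ℝ} {B : ℝ}
    (h₁ : ∀ t, HasDerivAt f (f₁ t) t) (h₂ : ∀ t, HasDerivAt f₁ (f₂ t) t)
    (h₃ : ∀ t, HasDerivAt f₂ (f₃ t) t) (hB : ∀ t ∈ Set.Icc (0 : ℝ) 1, |f₃ t| ≤ B) :
    |f 1 - f 0 - f₁ 0 - f₂ 0 / 2| ≤ B := by
  -- The mean value inequality is used three times, each time after subtracting the Taylor
  -- polynomial found so far. The factor `1/6` of the sharp remainder is given up.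
  have mv : ∀ {g g' : ℝ → ℝ}, (∀ t, HasDerivAt g (g' t) t) →
      (∀ t ∈ Set.Icc (0 : ℝ) 1, |g' t| ≤ B) → ∀ t ∈ Set.Icc (0 : ℝ) 1, |g t - g 0| ≤ B := by
    intro g g' hg hb t ht
    have hB0 : 0 ≤ B := (abs_nonneg _).trans (hb 0 ⟨le_rfl, zero_le_one⟩)
    have h := (convex_Icc (0 : ℝ) 1).norm_image_sub_le_of_norm_hasDerivWithin_le
      (f := g) (f' := g') (C := B) (x := 0) (y := t) (fun x _ => (hg x).hasDerivWithinAt)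
      (fun x hx => hb x hx) ⟨le_rfl, zero_le_one⟩ ht
    rw [Real.norm_eq_abs, Real.norm_eq_abs, sub_zero, abs_of_nonneg ht.1] at h
    exact h.trans (mul_le_of_le_one_right hB0 ht.2)
  have a₂ := mv h₃ hB
  have d₁ : ∀ t, HasDerivAt (fun t => f₁ t - f₂ 0 * t) (f₂ t - f₂ 0) t := fun t => by
    exact ((h₂ t).sub ((hasDerivAt_id t).const_mul (f₂ 0))).congr_deriv (by simp)
  have a₁ := mv d₁ a₂
  have d₀ : ∀ t, HasDerivAt (fun t => f t - f₁ 0 * t - f₂ 0 * t ^ 2 / 2)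
      (f₁ t - f₂ 0 * t - (f₁ 0 - f₂ 0 * 0)) t := fun t => by
    have := ((h₁ t).sub ((hasDerivAt_id t).const_mul (f₁ 0))).sub
      (((hasDerivAt_pow 2 t).const_mul (f₂ 0)).div_const 2)
    refine this.congr_deriv ?_
    simp
    ring
  have a₀ := mv d₀ a₁ 1 ⟨zero_le_one, le_rfl⟩
  refine le_of_eq_of_le ?_ a₀
  congr 1
  ring

/-- Second-order expansion of `log ⟨e^y⟩` around `y = 0`. -/
lemma abs_log_sum_exp_sub_le {w y : ι → ℝ} (hw : ∀ x, 0 ≤ w x) (hw1 : ∑ x, w x = 1) :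
    |Real.log (∑ x, w x * Real.exp (y x)) - ∑ x, w x * y x
        - (∑ x, w x * y x ^ 2 - (∑ x, w x * y x) ^ 2) / 2|
      ≤ 8 * ((∑ x, w x * (|y x| ^ 3 * Real.exp |y x|)) * ∑ x, w x * Real.exp |y x|) := by
  set N := tiltedMoment w y with hN
  have hpos : ∀ t, 0 < N 0 t := fun t => tiltedMoment_zero_pos hw hw1 t
  have hd : ∀ k t, HasDerivAt (N k) (N (k + 1) t) t := hasDerivAt_tiltedMoment w y
  have h₁ : ∀ t, HasDerivAt (fun t => Real.log (N 0 t)) (N 1 t / N 0 t) t := fun t =>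
    (hd 0 t).log (hpos t).ne'
  have hq : ∀ k t, HasDerivAt (fun t => N k t / N 0 t)
      (N (k + 1) t / N 0 t - N k t / N 0 t * (N 1 t / N 0 t)) t := fun k t => by
    refine ((hd k t).div (hd 0 t) (hpos t).ne').congr_deriv ?_
    have := (hpos t).ne'
    field_simp
  have h₂ := hq 1
  -- The derivatives of `log N₀` are the cumulants of `y` under the tilted weights: mean, variance,
  -- and now the third cumulant, to which `abs_third_cumulant_le` applies.
  have h₃ : ∀ t, HasDerivAt (fun t => N 2 t / N 0 t - N 1 t / N 0 t * (N 1 t / N 0 t))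
      (N 3 t / N 0 t - 3 * (N 1 t / N 0 t) * (N 2 t / N 0 t) + 2 * (N 1 t / N 0 t) ^ 3) t :=
    fun t => by
      refine ((hq 2 t).sub ((hq 1 t).mul (hq 1 t))).congr_deriv ?_
      ring
  have hzero : ∀ k, N k 0 = ∑ x, w x * y x ^ k := fun k => by simp [hN, tiltedMoment]
  have h00 : N 0 0 = 1 := by rw [hzero]; simpa using hw1
  have h01 : N 0 1 = ∑ x, w x * Real.exp (y x) := by simp [hN, tiltedMoment]
  have := taylor_two_of_bound h₁ h₂ h₃
    (B := 8 * ((∑ x, w x * (|y x| ^ 3 * Real.exp |y x|)) * ∑ x, w x * Real.exp |y x|)) ?_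
  · rw [h01, h00, hzero, hzero] at this
    simpa [sq] using this
  · intro t ht
    have hZ := hpos t
    have hp : ∀ k, N k t / N 0 t = ∑ x, (w x * Real.exp (t * y x) / N 0 t) * y x ^ k := fun k => by
      rw [hN, tiltedMoment, Finset.sum_div]
      refine Finset.sum_congr rfl fun x _ => ?_
      ring
    have hc := abs_third_cumulant_le (p := fun x => w x * Real.exp (t * y x) / N 0 t) (y := y)
      (fun x => by have := hw x; positivity)
      (by have := hp 0; rw [div_self hZ.ne'] at this; simpa using this.symm)
    have h1 := hp 1
    simp only [pow_one] at h1
    rw [← h1, ← hp 2, ← hp 3] at hc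
    refine hc.trans (mul_le_mul_of_nonneg_left ?_ (by norm_num))
    refine le_trans (le_of_eq ?_) (sum_tilted_div_le hw hw1 ht)
    rw [Finset.sum_div]
    refine Finset.sum_congr rfl fun x _ => ?_
    ring

end Tilt

/-! ### The log-partition function as a smooth maximum -/

section LogSumExp

variable {ι : Type*} [Fintype ι]

/-- The smooth maximum `(1/β) log ∑ e^{β h}`. -/
def logSumExp (β : ℝ) (h : ι → ℝ) : ℝ := 1 / β * Real.log (∑ x, Real.exp (β * h x))

/-- The Gibbs weights `e^{β h} / ∑ e^{β h}`. -/
def gibbsWeight (β : ℝ) (h : ι → ℝ) (x : ι) : ℝ :=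
  Real.exp (β * h x) / ∑ y, Real.exp (β * h y)

lemma abs_apply_le_norm (u : ι → ℝ) (x : ι) : |u x| ≤ ‖u‖ := norm_le_pi_norm u x

variable [Nonempty ι]

lemma sum_exp_pos (h : ι → ℝ) : 0 < ∑ x, Real.exp (h x) :=
  Finset.sum_pos (fun _ _ => Real.exp_pos _) Finset.univ_nonempty

lemma gibbsWeight_nonneg (β : ℝ) (h : ι → ℝ) (x : ι) : 0 ≤ gibbsWeight β h x :=
  div_nonneg (Real.exp_pos _).le (sum_exp_pos _).le

lemma sum_gibbsWeight (β : ℝ) (h : ι → ℝ) : ∑ x, gibbsWeight β h x = 1 := by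
  unfold gibbsWeight
  rw [← Finset.sum_div, div_self (sum_exp_pos _).ne']

/-- Dividing the perturbed partition function by the original one leaves a Gibbs average of
`e^{βu}`, so every expansion is around a probability vector. -/
lemma logSumExp_add_sub (β : ℝ) (h u : ι → ℝ) :
    logSumExp β (h + u) - logSumExp β h
      = 1 / β * Real.log (∑ x, gibbsWeight β h x * Real.exp (β * u x)) := by
  unfold logSumExp gibbsWeight
  rw [← mul_sub, ← Real.log_div (sum_exp_pos _).ne' (sum_exp_pos _).ne', Finset.sum_div]
  congr 2
  refine Finset.sum_congr rfl fun x _ => ?_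
  rw [Pi.add_apply, mul_add, Real.exp_add]
  ring

/-- The Gibbs average of `e^{βu}` lies between `e^{-β‖u‖}` and `e^{β‖u‖}`. This bound makes the
smooth maximum of a field with integrable norm integrable. -/
lemma abs_logSumExp_add_sub_le {β : ℝ} (hβ : 0 < β) (h u : ι → ℝ) :
    |logSumExp β (h + u) - logSumExp β h| ≤ ‖u‖ := by
  have hw := gibbsWeight_nonneg β h
  have hw1 := sum_gibbsWeight β h
  set Z := ∑ x, gibbsWeight β h x * Real.exp (β * u x) with hZ
  have hu : ∀ x, -(β * ‖u‖) ≤ β * u x ∧ β * u x ≤ β * ‖u‖ := fun x => by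
    have := abs_le.1 (abs_apply_le_norm u x)
    constructor <;> nlinarith
  have hlo : Real.exp (-(β * ‖u‖)) ≤ Z := by
    rw [← one_mul (Real.exp _), ← hw1, Finset.sum_mul]
    exact Finset.sum_le_sum fun x _ =>
      mul_le_mul_of_nonneg_left (Real.exp_le_exp.2 (hu x).1) (hw x)
  have hhi : Z ≤ Real.exp (β * ‖u‖) := by
    rw [← one_mul (Real.exp _), ← hw1, Finset.sum_mul]
    exact Finset.sum_le_sum fun x _ =>
      mul_le_mul_of_nonneg_left (Real.exp_le_exp.2 (hu x).2) (hw x)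
  have hZ0 : 0 < Z := (Real.exp_pos _).trans_le hlo
  have h1 : -(β * ‖u‖) ≤ Real.log Z := (Real.le_log_iff_exp_le hZ0).2 hlo
  have h2 : Real.log Z ≤ β * ‖u‖ := (Real.log_le_iff_le_exp hZ0).2 hhi
  rw [logSumExp_add_sub, ← hZ, abs_mul, abs_of_pos (by positivity : 0 < 1 / β), one_div,
    inv_mul_le_iff₀ hβ]
  exact abs_le.2 ⟨h1, h2⟩

lemma iSup_le_logSumExp {β : ℝ} (hβ : 0 < β) (h : ι → ℝ) : ⨆ x, h x ≤ logSumExp β h := by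
  refine ciSup_le fun x => ?_
  unfold logSumExp
  rw [one_div, ← div_eq_inv_mul, le_div_iff₀ hβ, Real.le_log_iff_exp_le (sum_exp_pos _),
    mul_comm (h x)]
  exact Finset.single_le_sum (f := fun y => Real.exp (β * h y)) (fun _ _ => (Real.exp_pos _).le)
    (Finset.mem_univ x)

/-- Each summand is at most the largest one. With `2^(ℓ n)` configurations the loss is linear in
`n`, the first of the two errors to be balanced by the choice of `β`. -/
lemma logSumExp_le_iSup_add {β : ℝ} (hβ : 0 < β) (h : ι → ℝ) :
    logSumExp β h ≤ (⨆ x, h x) + Real.log (Fintype.card ι) / β := by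
  have hc : (0 : ℝ) < Fintype.card ι := by exact_mod_cast Fintype.card_pos
  unfold logSumExp
  rw [one_div, ← div_eq_inv_mul, div_le_iff₀ hβ, add_mul, div_mul_cancel₀ _ hβ.ne',
    Real.log_le_iff_le_exp (sum_exp_pos _), Real.exp_add, Real.exp_log hc, mul_comm,
    ← nsmul_eq_mul, ← Finset.card_univ]
  refine Finset.sum_le_card_nsmul _ _ _ fun x _ => ?_
  rw [Real.exp_le_exp, mul_comm]
  exact mul_le_mul_of_nonneg_right (le_ciSup (Set.finite_range h).bddAbove x) hβ.le

/-- The cube is absorbed by `e^{lam a/3}`, with constant `6 · 3³ = 162`. As `β ≤ lam/3`, the three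
exponents together are at most `lam` times the larger of `a` and `b`. -/
lemma pow_three_mul_exp_le {β lam a b : ℝ} (hβ : 0 < β) (hlam : 3 * β ≤ lam) (ha : 0 ≤ a)
    (hb : 0 ≤ b) :
    a ^ 3 * Real.exp (β * a) * Real.exp (β * b)
      ≤ 162 / lam ^ 3 * (Real.exp (lam * a) + Real.exp (lam * b)) := by
  have hl : 0 < lam := by linarith
  have h1 : a ^ 3 ≤ 162 / lam ^ 3 * Real.exp (lam * a / 3) := by
    have := Real.pow_div_factorial_le_exp (lam * a / 3) (by positivity) 3
    have h6 : ((3).factorial : ℝ) = 6 := by norm_num [Nat.factorial]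
    rw [h6] at this
    rw [div_mul_eq_mul_div, le_div_iff₀ (by positivity)]
    nlinarith
  have h2 : Real.exp (lam * a / 3) * (Real.exp (β * a) * Real.exp (β * b))
      ≤ Real.exp (lam * a) + Real.exp (lam * b) := by
    rw [← Real.exp_add, ← Real.exp_add]
    rcases le_total a b with hab | hab
    · have : Real.exp (lam * a / 3 + (β * a + β * b)) ≤ Real.exp (lam * b) := by
        refine Real.exp_le_exp.2 ?_
        nlinarith [mul_le_mul_of_nonneg_right hlam ha, mul_le_mul_of_nonneg_right hlam hb]
      linarith [Real.exp_pos (lam * a)]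
    · have : Real.exp (lam * a / 3 + (β * a + β * b)) ≤ Real.exp (lam * a) := by
        refine Real.exp_le_exp.2 ?_
        nlinarith [mul_le_mul_of_nonneg_right hlam ha, mul_le_mul_of_nonneg_right hlam hb]
      linarith [Real.exp_pos (lam * b)]
  calc _ = a ^ 3 * (Real.exp (β * a) * Real.exp (β * b)) := by ring
    _ ≤ 162 / lam ^ 3 * Real.exp (lam * a / 3) * (Real.exp (β * a) * Real.exp (β * b)) :=
        mul_le_mul_of_nonneg_right h1 (by positivity)
    _ = 162 / lam ^ 3 * (Real.exp (lam * a / 3) * (Real.exp (β * a) * Real.exp (β * b))) := by ring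
    _ ≤ _ := mul_le_mul_of_nonneg_left h2 (by positivity)

/-- Second-order expansion of the smooth maximum, with remainder in terms of exponential
moments. -/
lemma abs_logSumExp_expansion_le {β lam : ℝ} (hβ : 0 < β) (hlam : 3 * β ≤ lam) (h u : ι → ℝ) :
    |logSumExp β (h + u) - logSumExp β h - ∑ x, gibbsWeight β h x * u x
        - β / 2 * (∑ x, gibbsWeight β h x * (u x * u x)
          - ∑ x, ∑ y, gibbsWeight β h x * gibbsWeight β h y * (u x * u y))|
      ≤ 2592 * β ^ 2 / lam ^ 3 * ∑ x, gibbsWeight β h x * Real.exp (lam * |u x|) := by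
  have hl : 0 < lam := by linarith
  have hw := gibbsWeight_nonneg β h
  have hw1 := sum_gibbsWeight β h
  have key := abs_log_sum_exp_sub_le (y := fun x => β * u x) hw hw1
  rw [logSumExp_add_sub]
  generalize gibbsWeight β h = w at *
  set L := Real.log (∑ x, w x * Real.exp (β * u x))
  have e1 : ∑ x, w x * (β * u x) = β * ∑ x, w x * u x := by
    rw [Finset.mul_sum]; exact Finset.sum_congr rfl fun x _ => by ring
  have e2 : ∑ x, w x * (β * u x) ^ 2 = β ^ 2 * ∑ x, w x * (u x * u x) := by
    rw [Finset.mul_sum]; exact Finset.sum_congr rfl fun x _ => by ring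
  -- The squared Gibbs mean is kept as a double sum so that integrating over `u` turns it into
  -- covariances.
  have e3 : ∑ x, ∑ y, w x * w y * (u x * u y) = (∑ x, w x * u x) ^ 2 := by
    rw [sq, Finset.sum_mul_sum]
    exact Finset.sum_congr rfl fun x _ => Finset.sum_congr rfl fun y _ => by ring
  rw [e1, e2] at key
  rw [e3]
  have e4 : 1 / β * L - ∑ x, w x * u x
      - β / 2 * (∑ x, w x * (u x * u x) - (∑ x, w x * u x) ^ 2)
      = 1 / β * (L - β * ∑ x, w x * u x
        - (β ^ 2 * ∑ x, w x * (u x * u x) - (β * ∑ x, w x * u x) ^ 2) / 2) := by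
    field_simp
  rw [e4, abs_mul, abs_of_pos (by positivity : 0 < 1 / β), one_div, inv_mul_le_iff₀ hβ]
  refine key.trans ?_
  have e5 : (∑ x, w x * (|β * u x| ^ 3 * Real.exp |β * u x|)) * ∑ x, w x * Real.exp |β * u x|
      ≤ β ^ 3 * (162 / lam ^ 3) * (2 * ∑ x, w x * Real.exp (lam * |u x|)) := by
    rw [Finset.sum_mul_sum]
    calc _ ≤ ∑ x, ∑ y, β ^ 3 * (162 / lam ^ 3) *
          (w y * (w x * Real.exp (lam * |u x|)) + w x * (w y * Real.exp (lam * |u y|))) := by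
          refine Finset.sum_le_sum fun x _ => Finset.sum_le_sum fun y _ => ?_
          have := mul_le_mul_of_nonneg_left (pow_three_mul_exp_le hβ hlam (abs_nonneg (u x))
            (abs_nonneg (u y))) (mul_nonneg (hw x) (hw y))
          simp only [abs_mul, abs_of_pos hβ]
          have h3 := mul_le_mul_of_nonneg_left this (by positivity : 0 ≤ β ^ 3)
          refine (le_of_eq ?_).trans (h3.trans (le_of_eq ?_)) <;> ring_nf
      _ = _ := by
          simp_rw [← Finset.mul_sum, Finset.sum_add_distrib, ← Finset.mul_sum, ← Finset.sum_mul,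
            hw1]
          ring
  refine (mul_le_mul_of_nonneg_left e5 (by norm_num)).trans (le_of_eq ?_)
  field_simp
  ring

end LogSumExp

/-! ### One step of the Lindeberg exchange -/

section OneStep

variable {ι : Type*} [Fintype ι]

/-- A probability law on `ℝ^ι` whose coordinates have exponential moments. -/
structure IsSubexponential (ν : Measure (ι → ℝ)) (lam M : ℝ) : Prop where
  prob : IsProbabilityMeasure ν
  pos : 0 < lam
  integrable : ∀ x, Integrable (fun u : ι → ℝ => Real.exp (lam * |u x|)) ν
  le : ∀ x, ∫ u, Real.exp (lam * |u x|) ∂ν ≤ M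

/-- A centered law with covariance `C`. -/
structure HasCovariance (ν : Measure (ι → ℝ)) (C : ι → ι → ℝ) : Prop where
  mean : ∀ x, ∫ u, u x ∂ν = 0
  cov : ∀ x y, ∫ u, u x * u y ∂ν = C x y

namespace IsSubexponential

variable {ν : Measure (ι → ℝ)} {lam M : ℝ}

omit [Fintype ι] in
lemma integrable_sq (hν : IsSubexponential ν lam M) (x : ι) :
    Integrable (fun u : ι → ℝ => u x ^ 2) ν := by
  have hl := hν.pos
  refine ((hν.integrable x).const_mul (2 / lam ^ 2)).mono'
    ((measurable_pi_apply x).pow_const 2).aestronglyMeasurable (Eventually.of_forall fun u => ?_)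
  have h := Real.pow_div_factorial_le_exp (lam * |u x|) (by positivity) 2
  have h2 : ((2).factorial : ℝ) = 2 := by norm_num [Nat.factorial]
  rw [h2, mul_pow, sq_abs] at h
  rw [Real.norm_eq_abs, abs_of_nonneg (sq_nonneg _), div_mul_eq_mul_div,
    le_div_iff₀ (by positivity)]
  linarith

omit [Fintype ι] in
lemma memLp_apply (hν : IsSubexponential ν lam M) (x : ι) :
    MemLp (fun u : ι → ℝ => u x) 2 ν :=
  (memLp_two_iff_integrable_sq (measurable_pi_apply x).aestronglyMeasurable).2 (hν.integrable_sq x)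

lemma memLp_id (hν : IsSubexponential ν lam M) : MemLp (id : (ι → ℝ) → ι → ℝ) 2 ν :=
  memLp_pi_iff.2 hν.memLp_apply

omit [Fintype ι] in
-- Second moments are bounded through `t²/2 ≤ e^t`, mixed ones through AM–GM. The bound is needed
-- only where the comparison is with a point mass and the covariance does not cancel.
lemma abs_cov_le (hν : IsSubexponential ν lam M) {C : ι → ι → ℝ} (hC : HasCovariance ν C)
    (x y : ι) : |C x y| ≤ 2 * M / lam ^ 2 := by
  have hl := hν.pos
  have hs : ∀ x, ∫ u, u x ^ 2 ∂ν ≤ 2 * M / lam ^ 2 := fun x => by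
    have h : ∫ u, u x ^ 2 ∂ν ≤ ∫ u, 2 / lam ^ 2 * Real.exp (lam * |u x|) ∂ν := by
      refine integral_mono (hν.integrable_sq x) ((hν.integrable x).const_mul _) fun u => ?_
      have h := Real.pow_div_factorial_le_exp (lam * |u x|) (by positivity) 2
      have h2 : ((2).factorial : ℝ) = 2 := by norm_num [Nat.factorial]
      rw [h2, mul_pow, sq_abs] at h
      simp only
      rw [div_mul_eq_mul_div, le_div_iff₀ (by positivity)]
      linarith
    rw [integral_const_mul] at h
    refine h.trans ?_
    rw [div_mul_eq_mul_div]
    have := hν.le x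
    gcongr
  rw [← hC.cov x y]
  calc |∫ u, u x * u y ∂ν| ≤ ∫ u, |u x * u y| ∂ν := abs_integral_le_integral_abs
    _ ≤ ∫ u, (u x ^ 2 + u y ^ 2) / 2 ∂ν := by
        refine integral_mono ((hν.memLp_apply x).integrable_mul (hν.memLp_apply y)).abs
          (((hν.integrable_sq x).add (hν.integrable_sq y)).div_const 2) fun u => ?_
        simp only [abs_mul]
        nlinarith [sq_nonneg (|u x| - |u y|), sq_abs (u x), sq_abs (u y)]
    _ = (∫ u, u x ^ 2 ∂ν + ∫ u, u y ^ 2 ∂ν) / 2 := by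
        rw [integral_div, integral_add (hν.integrable_sq x) (hν.integrable_sq y)]
    _ ≤ _ := by linarith [hs x, hs y]

end IsSubexponential

variable [Nonempty ι]

lemma continuous_logSumExp (β : ℝ) : Continuous (logSumExp β : (ι → ℝ) → ℝ) := by
  unfold logSumExp
  refine continuous_const.mul (Continuous.log (by fun_prop) fun h => (sum_exp_pos _).ne')

lemma integrable_logSumExp_add {β : ℝ} (hβ : 0 < β) {ν : Measure (ι → ℝ)}
    [IsProbabilityMeasure ν] (hν : MemLp (id : (ι → ℝ) → ι → ℝ) 2 ν) (h : ι → ℝ) :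
    Integrable (fun u => logSumExp β (h + u)) ν := by
  have h1 : Integrable (fun u : ι → ℝ => |logSumExp β h| + ‖u‖) ν :=
    (integrable_const _).add (hν.integrable one_le_two).norm
  refine h1.mono' ?_ (Eventually.of_forall fun u => ?_)
  · exact ((continuous_logSumExp β).comp (continuous_const.add continuous_id)).aestronglyMeasurable
  · have := abs_logSumExp_add_sub_le hβ h u
    rw [Real.norm_eq_abs]
    calc _ = |logSumExp β h + (logSumExp β (h + u) - logSumExp β h)| := by congr 1; ring
      _ ≤ _ := (abs_add_le _ _).trans (by linarith)

/-- The effect of adding a small centered random field to the smooth maximum is, to leading order,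
a function of its covariance. -/
lemma IsSubexponential.abs_integral_logSumExp_sub_le {ν : Measure (ι → ℝ)} {β lam M : ℝ}
    (hν : IsSubexponential ν lam M) {C : ι → ι → ℝ} (hC : HasCovariance ν C) (hβ : 0 < β)
    (hlam : 3 * β ≤ lam) (h : ι → ℝ) :
    |∫ u, logSumExp β (h + u) ∂ν - logSumExp β h
        - β / 2 * (∑ x, gibbsWeight β h x * C x x
          - ∑ x, ∑ y, gibbsWeight β h x * gibbsWeight β h y * C x y)|
      ≤ 2592 * M * β ^ 2 / lam ^ 3 := by
  have hl := hν.pos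
  have := hν.prob
  have hw := gibbsWeight_nonneg β h
  have hw1 := sum_gibbsWeight β h
  set w := gibbsWeight β h
  have i0 : Integrable (fun u => logSumExp β (h + u)) ν := integrable_logSumExp_add hβ hν.memLp_id h
  have i0' : Integrable (fun u => logSumExp β (h + u) - logSumExp β h) ν :=
    i0.sub (integrable_const _)
  have i1 : Integrable (fun u : ι → ℝ => ∑ x, w x * u x) ν :=
    integrable_finsetSum _ fun x _ => ((hν.memLp_apply x).integrable one_le_two).const_mul _
  have ixy : ∀ x y, Integrable (fun u : ι → ℝ => u x * u y) ν := fun x y =>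
    (hν.memLp_apply x).integrable_mul (hν.memLp_apply y)
  have i2 : Integrable (fun u : ι → ℝ => ∑ x, w x * (u x * u x)) ν :=
    integrable_finsetSum _ fun x _ => (ixy x x).const_mul _
  have i3 : Integrable (fun u : ι → ℝ => ∑ x, ∑ y, w x * w y * (u x * u y)) ν :=
    integrable_finsetSum _ fun x _ => integrable_finsetSum _ fun y _ => (ixy x y).const_mul _
  have i4 : Integrable (fun u : ι → ℝ => ∑ x, w x * Real.exp (lam * |u x|)) ν :=
    integrable_finsetSum _ fun x _ => (hν.integrable x).const_mul _
  have i01 : Integrable (fun u => logSumExp β (h + u) - logSumExp β h - ∑ x, w x * u x) ν :=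
    i0'.sub i1
  have i23 : Integrable (fun u : ι → ℝ => β / 2 * (∑ x, w x * (u x * u x)
      - ∑ x, ∑ y, w x * w y * (u x * u y))) ν := (i2.sub i3).const_mul _
  have v1 : ∫ u, ∑ x, w x * u x ∂ν = 0 := by
    rw [integral_finsetSum _ fun x _ => ((hν.memLp_apply x).integrable one_le_two).const_mul _]
    simp [integral_const_mul, hC.mean]
  have v2 : ∫ u, ∑ x, w x * (u x * u x) ∂ν = ∑ x, w x * C x x := by
    rw [integral_finsetSum _ fun x _ => (ixy x x).const_mul _]
    simp [integral_const_mul, hC.cov]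
  have v3 : ∫ u, ∑ x, ∑ y, w x * w y * (u x * u y) ∂ν = ∑ x, ∑ y, w x * w y * C x y := by
    rw [integral_finsetSum _ fun x _ => integrable_finsetSum _ fun y _ => (ixy x y).const_mul _]
    refine Finset.sum_congr rfl fun x _ => ?_
    rw [integral_finsetSum _ fun y _ => (ixy x y).const_mul _]
    simp [integral_const_mul, hC.cov]
  have v4 : ∫ u, ∑ x, w x * Real.exp (lam * |u x|) ∂ν ≤ M := by
    rw [integral_finsetSum _ fun x _ => (hν.integrable x).const_mul _]
    simp only [integral_const_mul]
    calc _ ≤ ∑ x, w x * M :=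
          Finset.sum_le_sum fun x _ => mul_le_mul_of_nonneg_left (hν.le x) (hw x)
      _ = M := by rw [← Finset.sum_mul, hw1, one_mul]
  -- The linear term integrates to zero by centering and the quadratic terms integrate to the
  -- covariance, so the left side is the integral of the pointwise remainder.
  have heq : ∫ u, logSumExp β (h + u) ∂ν - logSumExp β h
        - β / 2 * (∑ x, w x * C x x - ∑ x, ∑ y, w x * w y * C x y)
      = ∫ u, (logSumExp β (h + u) - logSumExp β h - ∑ x, w x * u x
        - β / 2 * (∑ x, w x * (u x * u x) - ∑ x, ∑ y, w x * w y * (u x * u y))) ∂ν := by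
    rw [integral_sub i01 i23, integral_sub i0' i1,
      integral_sub i0 (integrable_const _), integral_const_mul, integral_sub i2 i3, v1, v2, v3]
    simp
  rw [heq]
  calc _ ≤ ∫ u, |logSumExp β (h + u) - logSumExp β h - ∑ x, w x * u x
        - β / 2 * (∑ x, w x * (u x * u x) - ∑ x, ∑ y, w x * w y * (u x * u y))| ∂ν :=
        abs_integral_le_integral_abs
    _ ≤ ∫ u, 2592 * β ^ 2 / lam ^ 3 * ∑ x, w x * Real.exp (lam * |u x|) ∂ν := by
        refine integral_mono (i01.sub i23).abs (i4.const_mul _)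
          fun u => abs_logSumExp_expansion_le hβ hlam h u
    _ ≤ 2592 * β ^ 2 / lam ^ 3 * M := by
        rw [integral_const_mul]
        exact mul_le_mul_of_nonneg_left v4 (by positivity)
    _ = _ := by ring

end OneStep

/-! ### Sums of independent random fields -/

section Convolution

variable {ι : Type*} [Fintype ι]

lemma memLp_id_conv {ν ρ : Measure (ι → ℝ)} [IsProbabilityMeasure ν] [IsProbabilityMeasure ρ]
    (hν : MemLp (id : (ι → ℝ) → ι → ℝ) 2 ν) (hρ : MemLp (id : (ι → ℝ) → ι → ℝ) 2 ρ) :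
    MemLp (id : (ι → ℝ) → ι → ℝ) 2 (ν ∗ ρ) := by
  unfold Measure.conv
  rw [memLp_map_measure_iff aestronglyMeasurable_id (by fun_prop)]
  exact (hν.comp_fst ρ).add (hρ.comp_snd ν)

/-- Laws on `ℝ^ι` for which every `1`-Lipschitz function has variance at most `v`. -/
structure HasLipschitzVariance (ν : Measure (ι → ℝ)) (v : ℝ) : Prop where
  prob : IsProbabilityMeasure ν
  memLp : MemLp (id : (ι → ℝ) → ι → ℝ) 2 ν
  le : ∀ g : (ι → ℝ) → ℝ, LipschitzWith 1 g → Var[g; ν] ≤ v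

lemma memLp_of_lipschitz {ν : Measure (ι → ℝ)} [IsProbabilityMeasure ν]
    (hν : MemLp (id : (ι → ℝ) → ι → ℝ) 2 ν) {g : (ι → ℝ) → ℝ} (hg : LipschitzWith 1 g) :
    MemLp g 2 ν := by
  have h' : MemLp (fun u : ι → ℝ => ‖u‖) 2 ν := hν.norm
  have h : MemLp (fun u : ι → ℝ => ‖g 0‖ + ‖u‖) 2 ν := (memLp_const ‖g 0‖).add h'
  refine h.mono hg.continuous.aestronglyMeasurable (Eventually.of_forall fun u => ?_)
  have := hg.norm_sub_le u 0
  simp only [NNReal.coe_one, one_mul, sub_zero] at this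
  rw [Real.norm_of_nonneg (by positivity : 0 ≤ ‖g 0‖ + ‖u‖)]
  calc ‖g u‖ = ‖g 0 + (g u - g 0)‖ := by congr 1; ring
    _ ≤ _ := (norm_add_le _ _).trans (by linarith)

/-- The variance is at most the second moment about the constant `g 0`, and `|g u - g 0| ≤ ‖u‖`. -/
lemma hasLipschitzVariance_of_memLp {ν : Measure (ι → ℝ)} [IsProbabilityMeasure ν]
    (hν : MemLp (id : (ι → ℝ) → ι → ℝ) 2 ν) {v : ℝ} (hv : ∫ u, ‖u‖ ^ 2 ∂ν ≤ v) :
    HasLipschitzVariance ν v where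
  prob := inferInstance
  memLp := hν
  le g hg := by
    have hm := memLp_of_lipschitz hν hg
    have h0 : MemLp (fun u => g u - g 0) 2 ν := hm.sub (memLp_const _)
    rw [← variance_sub_const hm.1 (g 0)]
    refine (variance_le_expectation_sq h0.1).trans (le_trans ?_ hv)
    refine integral_mono h0.integrable_sq hν.norm.integrable_sq fun u => ?_
    have := hg.norm_sub_le u 0
    simp only [NNReal.coe_one, one_mul, sub_zero] at this
    simp only [Pi.pow_apply]
    rw [← sq_abs]
    exact pow_le_pow_left₀ (abs_nonneg _) this 2

lemma hasLipschitzVariance_dirac : HasLipschitzVariance (Measure.dirac (0 : ι → ℝ)) 0 := by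
  refine hasLipschitzVariance_of_memLp ?_ (by simp)
  exact (memLp_const (0 : ι → ℝ)).ae_eq (by rw [EventuallyEq, ae_dirac_iff]
                                            · rfl
                                            · exact measurableSet_eq_fun (by fun_prop) (by fun_prop))

/-- The Efron–Stein inequality for Lipschitz functions of a sum of two independent vectors. -/
lemma HasLipschitzVariance.conv {ν ρ : Measure (ι → ℝ)} {v w : ℝ}
    (hν : HasLipschitzVariance ν v) (hρ : HasLipschitzVariance ρ w) :
    HasLipschitzVariance (ν ∗ ρ) (v + w) := by
  have := hν.prob
  have := hρ.prob
  have hc := memLp_id_conv hν.memLp hρ.memLp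
  refine ⟨inferInstance, hc, fun g hg => ?_⟩
  have hg2 := memLp_of_lipschitz hc hg
  have hshift : ∀ x, LipschitzWith 1 (fun y => g (x + y)) := fun x => by
    refine LipschitzWith.of_dist_le_mul fun y z => ?_
    simpa using hg.dist_le_mul (x + y) (x + z)
  have hshift' : ∀ y, LipschitzWith 1 (fun x => g (x + y)) := fun y => by
    refine LipschitzWith.of_dist_le_mul fun x z => ?_
    simpa using hg.dist_le_mul (x + y) (z + y)
  have hin : ∀ x, MemLp (fun y => g (x + y)) 2 ρ := fun x =>
    memLp_of_lipschitz hρ.memLp (hshift x)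
  -- Averaging out one summand preserves the Lipschitz constant, so the bound for `ν` applies to the
  -- conditional mean.
  have hG : LipschitzWith 1 (fun x => ∫ y, g (x + y) ∂ρ) := by
    refine LipschitzWith.of_dist_le_mul fun x z => ?_
    rw [dist_eq_norm, ← integral_sub ((hin x).integrable one_le_two)
      ((hin z).integrable one_le_two), NNReal.coe_one, one_mul]
    have h := norm_integral_le_of_norm_le_const (μ := ρ) (C := dist x z)
      (f := fun y => g (x + y) - g (z + y)) (Eventually.of_forall fun y => by
        simpa using (hshift' y).norm_sub_le x z |>.trans_eq (by rw [dist_eq_norm]; simp))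
    simpa using h
  have hGm := memLp_of_lipschitz hν.memLp hG
  have isq : Integrable (fun u => g u ^ 2) (ν ∗ ρ) := hg2.integrable_sq
  have isq' : Integrable (fun x => ∫ y, g (x + y) ^ 2 ∂ρ) ν := by
    have h := (integrable_map_measure isq.1 (by fun_prop)).1 isq
    exact h.integral_prod_left
  -- Law of total variance: the conditional variance given the first summand is at most `w`, and the
  -- variance of the conditional mean is at most `v`.
  have hvar : ∀ x, ∫ y, g (x + y) ^ 2 ∂ρ ≤ w + (∫ y, g (x + y) ∂ρ) ^ 2 := fun x => by
    have h := hρ.le _ (hshift x)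
    rw [variance_eq_sub (hin x)] at h
    simp only [Pi.pow_apply] at h
    linarith
  have hGv := hν.le _ hG
  rw [variance_eq_sub hGm] at hGv
  rw [variance_eq_sub hg2]
  simp only [Pi.pow_apply] at hGv ⊢
  rw [integral_conv isq, integral_conv (hg2.integrable one_le_two)]
  have h := integral_mono isq' ((integrable_const w).add hGm.integrable_sq) hvar
  simp only [Pi.add_apply] at h
  rw [integral_add (integrable_const w) hGm.integrable_sq] at h
  simp only [integral_const, probReal_univ, smul_eq_mul, one_mul] at h
  linarith

section Sums

variable {Ω : Type*} [MeasurableSpace Ω] {P : Measure Ω} [IsProbabilityMeasure P]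

omit [Fintype ι] in
lemma map_sum_insert {κ : Type*} [DecidableEq κ] {Y : κ → Ω → ι → ℝ}
    (hY : ∀ i, AEMeasurable (Y i) P) (hind : iIndepFun Y P) {s : Finset κ} {i : κ} (hi : i ∉ s) :
    P.map (∑ j ∈ insert i s, Y j) = P.map (∑ j ∈ s, Y j) ∗ P.map (Y i) := by
  rw [Finset.sum_insert hi, add_comm]
  exact (hind.indepFun_finsetSum_of_notMem₀ hY hi).map_add_eq_map_conv_map₀
    (Finset.aemeasurable_sum _ fun j _ => hY j) (hY i)

omit [Fintype ι] in
lemma map_zero_fun : P.map (0 : Ω → ι → ℝ) = Measure.dirac 0 := by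
  have : (0 : Ω → ι → ℝ) = fun _ => 0 := rfl
  rw [this, Measure.map_const, measure_univ, one_smul]

/-- Variance bounds add over independent summands. Applied to `O(n)` constraints, this makes a
maximum of order `n` fluctuate only by order `√n`. -/
lemma hasLipschitzVariance_sum {κ : Type*} {Y : κ → Ω → ι → ℝ}
    (hY : ∀ i, AEMeasurable (Y i) P) (hind : iIndepFun Y P) {v : κ → ℝ}
    (h : ∀ i, HasLipschitzVariance (P.map (Y i)) (v i)) (s : Finset κ) :
    HasLipschitzVariance (P.map (∑ i ∈ s, Y i)) (∑ i ∈ s, v i) := by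
  classical
  induction s using Finset.induction_on with
  | empty =>
    rw [Finset.sum_empty, Finset.sum_empty, map_zero_fun]
    exact hasLipschitzVariance_dirac
  | insert i s hi ih =>
    rw [map_sum_insert hY hind hi, Finset.sum_insert hi, add_comm]
    exact ih.conv (h i)

end Sums

/-- Two laws with square-integrable norm whose convolutions with any point mass give nearly the
same expected smooth maximum. -/
structure IsClose (β : ℝ) (ν ρ : Measure (ι → ℝ)) (ε : ℝ) : Prop where
  prob_left : IsProbabilityMeasure ν
  prob_right : IsProbabilityMeasure ρ
  memLp_left : MemLp (id : (ι → ℝ) → ι → ℝ) 2 ν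
  memLp_right : MemLp (id : (ι → ℝ) → ι → ℝ) 2 ρ
  le : ∀ h, |∫ u, logSumExp β (h + u) ∂ν - ∫ u, logSumExp β (h + u) ∂ρ| ≤ ε

lemma IsClose.mono {β : ℝ} {ν ρ : Measure (ι → ℝ)} {ε ε' : ℝ} (h : IsClose β ν ρ ε)
    (hε : ε ≤ ε') : IsClose β ν ρ ε' :=
  ⟨h.1, h.2, h.3, h.4, fun x => (h.5 x).trans hε⟩

lemma isClose_refl {β : ℝ} {ν : Measure (ι → ℝ)} [IsProbabilityMeasure ν]
    (hν : MemLp (id : (ι → ℝ) → ι → ℝ) 2 ν) : IsClose β ν ν 0 :=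
  ⟨inferInstance, inferInstance, hν, hν, fun _ => by simp⟩

variable [Nonempty ι]

/-- The bound in `IsClose` holds for every shift `h`, so the summand that is not being replaced can
be frozen and absorbed into the shift. This is the Lindeberg exchange of one summand at a time. -/
lemma IsClose.conv {β : ℝ} (hβ : 0 < β) {ν₁ ρ₁ ν₂ ρ₂ : Measure (ι → ℝ)} {ε₁ ε₂ : ℝ}
    (h₁ : IsClose β ν₁ ρ₁ ε₁) (h₂ : IsClose β ν₂ ρ₂ ε₂) :
    IsClose β (ν₁ ∗ ν₂) (ρ₁ ∗ ρ₂) (ε₁ + ε₂) := by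
  have := h₁.prob_left
  have := h₁.prob_right
  have := h₂.prob_left
  have := h₂.prob_right
  refine ⟨inferInstance, inferInstance, memLp_id_conv h₁.memLp_left h₂.memLp_left,
    memLp_id_conv h₁.memLp_right h₂.memLp_right, fun h => ?_⟩
  have int : ∀ {ν ρ : Measure (ι → ℝ)} [IsProbabilityMeasure ν] [IsProbabilityMeasure ρ],
      MemLp (id : (ι → ℝ) → ι → ℝ) 2 ν → MemLp (id : (ι → ℝ) → ι → ℝ) 2 ρ →
      Integrable (fun p : (ι → ℝ) × (ι → ℝ) => logSumExp β (h + (p.1 + p.2))) (ν.prod ρ) := by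
    intro ν ρ _ _ hν hρ
    have i := integrable_logSumExp_add hβ (memLp_id_conv hν hρ) h
    exact (integrable_map_measure i.1 (by fun_prop)).1 i
  have i11 := int h₁.memLp_left h₂.memLp_left
  have i12 := int h₁.memLp_left h₂.memLp_right
  have i22 := int h₁.memLp_right h₂.memLp_right
  rw [integral_conv (integrable_logSumExp_add hβ (memLp_id_conv h₁.memLp_left h₂.memLp_left) h),
    integral_conv (integrable_logSumExp_add hβ (memLp_id_conv h₁.memLp_right h₂.memLp_right) h)]
  have a : |∫ x, ∫ y, logSumExp β (h + (x + y)) ∂ν₂ ∂ν₁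
      - ∫ x, ∫ y, logSumExp β (h + (x + y)) ∂ρ₂ ∂ν₁| ≤ ε₂ := by
    rw [← integral_sub i11.integral_prod_left i12.integral_prod_left]
    have := norm_integral_le_of_norm_le_const (μ := ν₁) (C := ε₂)
      (f := fun x => ∫ y, logSumExp β (h + (x + y)) ∂ν₂ - ∫ y, logSumExp β (h + (x + y)) ∂ρ₂)
      (Eventually.of_forall fun x => by
        simp only [← add_assoc]
        exact h₂.le (h + x))
    simpa using this
  -- Swapping the integrals makes the first factor innermost; `y` then joins the shift.
  have b : |∫ x, ∫ y, logSumExp β (h + (x + y)) ∂ρ₂ ∂ν₁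
      - ∫ x, ∫ y, logSumExp β (h + (x + y)) ∂ρ₂ ∂ρ₁| ≤ ε₁ := by
    rw [integral_integral_swap (f := fun x y => logSumExp β (h + (x + y))) i12,
      integral_integral_swap (f := fun x y => logSumExp β (h + (x + y))) i22,
      ← integral_sub i12.integral_prod_right i22.integral_prod_right]
    have := norm_integral_le_of_norm_le_const (μ := ρ₂) (C := ε₁)
      (f := fun y => ∫ x, logSumExp β (h + (x + y)) ∂ν₁ - ∫ x, logSumExp β (h + (x + y)) ∂ρ₁)
      (Eventually.of_forall fun y => by
        simp only [add_comm _ y, ← add_assoc]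
        exact h₁.le (y + h))
    simpa using this
  calc _ = |(∫ x, ∫ y, logSumExp β (h + (x + y)) ∂ν₂ ∂ν₁
      - ∫ x, ∫ y, logSumExp β (h + (x + y)) ∂ρ₂ ∂ν₁) +
      (∫ x, ∫ y, logSumExp β (h + (x + y)) ∂ρ₂ ∂ν₁
      - ∫ x, ∫ y, logSumExp β (h + (x + y)) ∂ρ₂ ∂ρ₁)| := by congr 1; ring
    _ ≤ _ := (abs_add_le _ _).trans (by linarith)

/-- Centered laws with the same covariance are close. -/
lemma isClose_of_hasCovariance {β lam M : ℝ} (hβ : 0 < β) (hlam : 3 * β ≤ lam)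
    {ν ρ : Measure (ι → ℝ)} {C : ι → ι → ℝ} (hν : IsSubexponential ν lam M)
    (hρ : IsSubexponential ρ lam M) (hνC : HasCovariance ν C) (hρC : HasCovariance ρ C) :
    IsClose β ν ρ (5184 * M * β ^ 2 / lam ^ 3) := by
  refine ⟨hν.prob, hρ.prob, hν.memLp_id, hρ.memLp_id, fun h => ?_⟩
  have a := abs_le.1 (hν.abs_integral_logSumExp_sub_le hνC hβ hlam h)
  have b := abs_le.1 (hρ.abs_integral_logSumExp_sub_le hρC hβ hlam h)
  have e : 5184 * M * β ^ 2 / lam ^ 3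
      = 2592 * M * β ^ 2 / lam ^ 3 + 2592 * M * β ^ 2 / lam ^ 3 := by ring
  rw [e]
  exact abs_le.2 ⟨by linarith, by linarith⟩

/-- A small centered law is close to the point mass at `0`. -/
lemma IsSubexponential.isClose_dirac {β lam M : ℝ} (hβ : 0 < β) (hlam : 3 * β ≤ lam)
    {ν : Measure (ι → ℝ)} {C : ι → ι → ℝ} (hν : IsSubexponential ν lam M)
    (hC : HasCovariance ν C) :
    IsClose β (Measure.dirac 0) ν (2592 * M * β ^ 2 / lam ^ 3 + 2 * M * β / lam ^ 2) := by
  refine ⟨inferInstance, hν.prob, hasLipschitzVariance_dirac.memLp, hν.memLp_id, fun h => ?_⟩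
  have hw := gibbsWeight_nonneg β h
  have hw1 := sum_gibbsWeight β h
  have a := hν.abs_integral_logSumExp_sub_le hC hβ hlam h
  rw [integral_dirac, add_zero]
  set w := gibbsWeight β h
  have b1 : |∑ x, w x * C x x| ≤ 2 * M / lam ^ 2 := by
    calc _ ≤ ∑ x, |w x * C x x| := Finset.abs_sum_le_sum_abs _ _
      _ ≤ ∑ x, w x * (2 * M / lam ^ 2) := Finset.sum_le_sum fun x _ => by
          rw [abs_mul, abs_of_nonneg (hw x)]
          exact mul_le_mul_of_nonneg_left (hν.abs_cov_le hC x x) (hw x)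
      _ = _ := by rw [← Finset.sum_mul, hw1, one_mul]
  have b2 : |∑ x, ∑ y, w x * w y * C x y| ≤ 2 * M / lam ^ 2 := by
    calc _ ≤ ∑ x, ∑ y, |w x * w y * C x y| :=
          (Finset.abs_sum_le_sum_abs _ _).trans
            (Finset.sum_le_sum fun x _ => Finset.abs_sum_le_sum_abs _ _)
      _ ≤ ∑ x, ∑ y, w x * w y * (2 * M / lam ^ 2) :=
          Finset.sum_le_sum fun x _ => Finset.sum_le_sum fun y _ => by
            rw [abs_mul, abs_of_nonneg (mul_nonneg (hw x) (hw y))]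
            exact mul_le_mul_of_nonneg_left (hν.abs_cov_le hC x y) (mul_nonneg (hw x) (hw y))
      _ = _ := by simp_rw [← Finset.sum_mul, ← Finset.mul_sum, hw1, mul_one, hw1, one_mul]
  have b3 : |β / 2 * (∑ x, w x * C x x - ∑ x, ∑ y, w x * w y * C x y)| ≤ 2 * M * β / lam ^ 2 := by
    rw [abs_mul, abs_of_pos (by positivity : 0 < β / 2)]
    calc _ ≤ β / 2 * (2 * M / lam ^ 2 + 2 * M / lam ^ 2) :=
          mul_le_mul_of_nonneg_left ((abs_sub _ _).trans (add_le_add b1 b2)) (by positivity)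
      _ = _ := by ring
  rw [abs_sub_comm]
  rw [abs_le] at a b3 ⊢
  constructor <;> linarith

section Sums

variable {Ω : Type*} [MeasurableSpace Ω] {P : Measure Ω} [IsProbabilityMeasure P]

lemma isClose_sum {Ω' : Type*} [MeasurableSpace Ω'] {P' : Measure Ω'} [IsProbabilityMeasure P']
    {β : ℝ} (hβ : 0 < β) {κ : Type*} {Y : κ → Ω → ι → ℝ} {Z : κ → Ω' → ι → ℝ}
    (hY : ∀ i, AEMeasurable (Y i) P) (hind : iIndepFun Y P)
    (hZ : ∀ i, AEMeasurable (Z i) P') (hind' : iIndepFun Z P') {ε : κ → ℝ}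
    (h : ∀ i, IsClose β (P.map (Y i)) (P'.map (Z i)) (ε i)) (s : Finset κ) :
    IsClose β (P.map (∑ i ∈ s, Y i)) (P'.map (∑ i ∈ s, Z i)) (∑ i ∈ s, ε i) := by
  classical
  induction s using Finset.induction_on with
  | empty =>
    rw [Finset.sum_empty, Finset.sum_empty, Finset.sum_empty, map_zero_fun, map_zero_fun]
    exact isClose_refl hasLipschitzVariance_dirac.memLp
  | insert i s hi ih =>
    rw [map_sum_insert hY hind hi, map_sum_insert hZ hind' hi, Finset.sum_insert hi, add_comm]
    exact ih.conv hβ (h i)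

/-- Comparison of a sum of independent vectors with a convolution semigroup. -/
lemma isClose_sum_semigroup {β : ℝ} (hβ : 0 < β) {κ : Type*} {Y : κ → Ω → ι → ℝ}
    (hY : ∀ i, AEMeasurable (Y i) P) (hind : iIndepFun Y P) {ρ : ℕ → Measure (ι → ℝ)}
    (hρ0 : ρ 0 = Measure.dirac 0) (hρ : ∀ m, ρ (m + 1) = ρ m ∗ ρ 1) {ε : ℝ}
    (h : ∀ i, IsClose β (P.map (Y i)) (ρ 1) ε) (s : Finset κ) :
    IsClose β (P.map (∑ i ∈ s, Y i)) (ρ s.card) (s.card * ε) := by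
  classical
  induction s using Finset.induction_on with
  | empty =>
    rw [Finset.sum_empty, map_zero_fun, Finset.card_empty, hρ0, Nat.cast_zero, zero_mul]
    exact isClose_refl hasLipschitzVariance_dirac.memLp
  | insert i s hi ih =>
    rw [map_sum_insert hY hind hi, Finset.card_insert_of_notMem hi, hρ]
    exact (ih.conv hβ (h i)).mono (le_of_eq (by push_cast; ring))

end Sums

end Convolution

/-! ### Fourier analysis -/

section Fourier

variable {k : ℕ}

lemma spin_mul (u v : ℤˣ) : spin (u * v) = spin u * spin v := by simp [spin]

lemma spin_mul_self (u : ℤˣ) : spin u * spin u = 1 := by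
  rw [← spin_mul, Int.units_mul_self]; simp [spin]

lemma abs_spin (u : ℤˣ) : |spin u| = 1 := by
  rcases Int.units_eq_one_or u with rfl | rfl <;> simp [spin]

/-- The sum is the expansion of `∏ (1 + σ_i τ_i)`. A factor is `2` where the signs agree and `0`
where they differ. -/
lemma sum_prod_spin_mul (σ τ : Cube k) :
    ∑ T : Finset (Fin k), (∏ i ∈ T, spin (σ i)) * ∏ i ∈ T, spin (τ i)
      = if σ = τ then 2 ^ k else 0 := by
  have h : ∑ T : Finset (Fin k), (∏ i ∈ T, spin (σ i)) * ∏ i ∈ T, spin (τ i)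
      = ∏ i, (1 + spin (σ i) * spin (τ i)) := by
    rw [Finset.prod_one_add, Finset.powerset_univ]
    simp_rw [Finset.prod_mul_distrib]
  rw [h]
  split_ifs with hστ
  · subst hστ
    simp_rw [spin_mul_self]
    norm_num
  · obtain ⟨i, hi⟩ := Function.ne_iff.1 hστ
    refine Finset.prod_eq_zero (Finset.mem_univ i) ?_
    rcases Int.units_eq_one_or (σ i) with h1 | h1 <;> rcases Int.units_eq_one_or (τ i) with h2 | h2
    · exact absurd (h1.trans h2.symm) hi
    · simp [h1, h2, spin]
    · simp [h1, h2, spin]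
    · exact absurd (h1.trans h2.symm) hi

/-- Plancherel's identity. -/
lemma sum_fourierCoefficient_mul (f g : Predicate k) :
    ∑ T, fourierCoefficient f T * fourierCoefficient g T = (∑ σ, f σ * g σ) / 2 ^ k := by
  have h : ∀ T : Finset (Fin k), fourierCoefficient f T * fourierCoefficient g T
      = (∑ σ, ∑ τ, f σ * g τ * ((∏ i ∈ T, spin (σ i)) * ∏ i ∈ T, spin (τ i))) / 2 ^ k / 2 ^ k := by
    intro T
    unfold fourierCoefficient
    rw [div_mul_div_comm, div_div, Finset.sum_mul_sum]
    congr 1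
    exact Finset.sum_congr rfl fun σ _ => Finset.sum_congr rfl fun τ _ => by ring
  simp_rw [h, ← Finset.sum_div]
  rw [Finset.sum_comm]
  have h2 : ∀ σ : Cube k, ∑ T : Finset (Fin k), ∑ τ, f σ * g τ *
      ((∏ i ∈ T, spin (σ i)) * ∏ i ∈ T, spin (τ i)) = f σ * g σ * 2 ^ k := by
    intro σ
    rw [Finset.sum_comm]
    simp_rw [← Finset.mul_sum, sum_prod_spin_mul]
    simp
  simp_rw [h2, ← Finset.sum_mul]
  field_simp

/-- The substitution `ε ↦ ε σ` permutes the cube, and every sign is its own inverse. -/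
lemma fourierCoefficient_shift (f : Predicate k) (σ : Cube k) (T : Finset (Fin k)) :
    fourierCoefficient (fun ε => f fun a => ε a * σ a) T
      = fourierCoefficient f T * ∏ i ∈ T, spin (σ i) := by
  unfold fourierCoefficient
  rw [div_mul_eq_mul_div, Finset.sum_mul]
  congr 1
  refine Fintype.sum_equiv (Equiv.mulRight σ) _ _ fun ε => ?_
  simp only [Equiv.coe_mulRight, Pi.mul_apply, spin_mul, Finset.prod_mul_distrib]
  have h : (∏ i ∈ T, spin (σ i)) * ∏ i ∈ T, spin (σ i) = 1 := by
    rw [← Finset.prod_mul_distrib]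
    exact Finset.prod_eq_one fun i _ => spin_mul_self _
  rw [mul_assoc, mul_assoc, h, mul_one]
  rfl

lemma fourierCoefficient_empty (f : Predicate k) :
    fourierCoefficient f ∅ = (∑ σ, f σ) / 2 ^ k := by
  simp [fourierCoefficient]

lemma sum_signs_value (f : Predicate k) (σ : Cube k) :
    (∑ ε : Cube k, f fun a => ε a * σ a) / 2 ^ k = fourierCoefficient f ∅ := by
  rw [← fourierCoefficient_empty (fun ε => f fun a => ε a * σ a), fourierCoefficient_shift]
  simp

/-- Plancherel for the two shifted predicates: the average over signs leaves no cross terms between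
different characters. -/
lemma sum_signs_value_mul (f : Predicate k) (σ τ : Cube k) :
    (∑ ε : Cube k, (f fun a => ε a * σ a) * (f fun a => ε a * τ a)) / 2 ^ k
      = ∑ T, fourierCoefficient f T ^ 2 * ∏ i ∈ T, (spin (σ i) * spin (τ i)) := by
  rw [← sum_fourierCoefficient_mul]
  refine Finset.sum_congr rfl fun T _ => ?_
  rw [fourierCoefficient_shift, fourierCoefficient_shift, Finset.prod_mul_distrib]
  ring

lemma abs_fourierCoefficient_le {f : Predicate k} (hf : ∀ σ, f σ ∈ Set.Icc (-1 : ℝ) 1)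
    (T : Finset (Fin k)) : |fourierCoefficient f T| ≤ 1 := by
  unfold fourierCoefficient
  rw [abs_div, abs_of_pos (by positivity : (0 : ℝ) < 2 ^ k), div_le_one (by positivity)]
  refine (Finset.abs_sum_le_sum_abs _ _).trans ?_
  have h : ∀ σ ∈ (Finset.univ : Finset (Cube k)), |f σ * ∏ i ∈ T, spin (σ i)| ≤ 1 := fun σ _ => by
    rw [abs_mul, Finset.abs_prod]
    simp only [abs_spin, Finset.prod_const_one, mul_one]
    exact abs_le.2 (hf σ)
  refine (Finset.sum_le_card_nsmul _ _ _ h).trans (le_of_eq ?_)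
  simp [Fintype.card_units_int]

lemma measurable_fourierCoefficient (T : Finset (Fin k)) :
    Measurable fun f : Predicate k => fourierCoefficient f T := by
  unfold fourierCoefficient
  refine (Finset.measurable_sum _ fun σ _ => ?_).div_const _
  exact (measurable_pi_apply σ).mul_const _

lemma measurable_fourierWeight (j : ℕ) :
    Measurable fun f : Predicate k => fourierWeight f j := by
  unfold fourierWeight
  exact Finset.measurable_sum _ fun T _ => (measurable_fourierCoefficient T).pow_const _

lemma fourierWeight_nonneg (f : Predicate k) (j : ℕ) : 0 ≤ fourierWeight f j :=
  Finset.sum_nonneg fun _ _ => sq_nonneg _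

/-- The sum is grouped by level. Level zero is split off because centering given the predicate
removes exactly that term. -/
lemma sum_fourier_mul_pow (f : Predicate k) (r : ℝ) :
    ∑ T, fourierCoefficient f T ^ 2 * r ^ T.card
      = fourierCoefficient f ∅ ^ 2 + ∑ j ∈ Finset.Icc 1 k, fourierWeight f j * r ^ j := by
  have h : ∑ T : Finset (Fin k), fourierCoefficient f T ^ 2 * r ^ T.card
      = ∑ j ∈ Finset.range (k + 1), fourierWeight f j * r ^ j := by
    rw [← Finset.powerset_univ, Finset.sum_powerset, Finset.card_univ, Fintype.card_fin]
    refine Finset.sum_congr rfl fun j _ => ?_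
    rw [fourierWeight, Finset.sum_mul]
    refine Finset.sum_congr rfl fun T hT => ?_
    rw [(Finset.mem_powersetCard.1 hT).2]
  rw [h, Finset.range_eq_Ico, Finset.sum_eq_sum_Ico_succ_bot (Nat.succ_pos k), pow_zero, mul_one,
    zero_add]
  congr 1
  simp [fourierWeight]

lemma sum_fourierWeight_le {f : Predicate k} (hf : ∀ σ, f σ ∈ Set.Icc (-1 : ℝ) 1) :
    ∑ j ∈ Finset.Icc 1 k, fourierWeight f j ≤ 1 := by
  have h := sum_fourier_mul_pow f 1
  have h2 := sum_fourierCoefficient_mul f f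
  simp only [one_pow, mul_one] at h
  simp only [← sq] at h2
  rw [h2] at h
  have h3 : (∑ σ, f σ ^ 2) / 2 ^ k ≤ 1 := by
    rw [div_le_one (by positivity)]
    refine (Finset.sum_le_card_nsmul _ _ 1 fun σ _ => ?_).trans (le_of_eq ?_)
    · have := hf σ
      nlinarith [this.1, this.2]
    · simp [Fintype.card_units_int]
  nlinarith [sq_nonneg (fourierCoefficient f ∅)]

lemma fourierWeight_le {f : Predicate k} (hf : ∀ σ, f σ ∈ Set.Icc (-1 : ℝ) 1) {j : ℕ}
    (hj : j ∈ Finset.Icc 1 k) : fourierWeight f j ≤ 1 :=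
  (Finset.single_le_sum (fun j _ => fourierWeight_nonneg f j) hj).trans (sum_fourierWeight_le hf)

variable {Λ : Measure (Predicate k)} [IsProbabilityMeasure Λ]

lemma integrable_fourierWeight (hΛ : ∀ᵐ f ∂Λ, ∀ σ, f σ ∈ Set.Icc (-1 : ℝ) 1) {j : ℕ}
    (hj : j ∈ Finset.Icc 1 k) : Integrable (fun f => fourierWeight f j) Λ := by
  refine (integrable_const (1 : ℝ)).mono' (measurable_fourierWeight j).aestronglyMeasurable ?_
  filter_upwards [hΛ] with f hf
  rw [Real.norm_of_nonneg (fourierWeight_nonneg f j)]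
  exact fourierWeight_le hf hj

lemma integrable_fourierCoefficient (hΛ : ∀ᵐ f ∂Λ, ∀ σ, f σ ∈ Set.Icc (-1 : ℝ) 1)
    (T : Finset (Fin k)) : Integrable (fun f => fourierCoefficient f T) Λ := by
  refine (integrable_const (1 : ℝ)).mono' (measurable_fourierCoefficient T).aestronglyMeasurable ?_
  filter_upwards [hΛ] with f hf
  exact abs_fourierCoefficient_le hf T

omit [IsProbabilityMeasure Λ] in
lemma eval_mixture (r : ℝ) :
    (mixture Λ).eval r = ∑ j ∈ Finset.Icc 1 k, (∫ f, fourierWeight f j ∂Λ) * r ^ j := by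
  simp [mixture, Polynomial.eval_finsetSum]

omit [IsProbabilityMeasure Λ] in
lemma coeff_mixture (p : Fin k) :
    (mixture Λ).coeff (p.val + 1) = ∫ f, fourierWeight f (p.val + 1) ∂Λ := by
  simp only [mixture, Polynomial.finsetSum_coeff, Polynomial.coeff_C_mul_X_pow]
  rw [Finset.sum_ite_eq, if_pos (Finset.mem_Icc.2 ⟨by omega, by omega⟩)]

omit [IsProbabilityMeasure Λ] in
lemma coeff_mixture_nonneg (p : Fin k) : 0 ≤ (mixture Λ).coeff (p.val + 1) := by
  rw [coeff_mixture]
  exact integral_nonneg fun f => fourierWeight_nonneg f _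

omit [IsProbabilityMeasure Λ] in
lemma sum_coeff_mixture (r : ℝ) :
    ∑ p : Fin k, (mixture Λ).coeff (p.val + 1) * r ^ (p.val + 1) = (mixture Λ).eval r := by
  rw [eval_mixture]
  simp_rw [coeff_mixture]
  rw [Fin.sum_univ_eq_sum_range (fun p => (∫ f, fourierWeight f (p + 1) ∂Λ) * r ^ (p + 1)) k,
    Finset.range_eq_Ico,
    Finset.sum_Ico_add' (fun p => (∫ f, fourierWeight f p ∂Λ) * r ^ p) 0 k 1]
  refine Finset.sum_congr ?_ fun _ _ => rfl
  ext j
  simp only [Finset.mem_Ico, Finset.mem_Icc]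
  omega

lemma eval_one_mixture_le (hΛ : ∀ᵐ f ∂Λ, ∀ σ, f σ ∈ Set.Icc (-1 : ℝ) 1) :
    (mixture Λ).eval 1 ≤ 1 := by
  rw [eval_mixture]
  simp only [one_pow, mul_one]
  rw [← integral_finsetSum _ fun j hj => integrable_fourierWeight hΛ hj]
  calc _ ≤ ∫ _, (1 : ℝ) ∂Λ := by
        refine integral_mono_ae (integrable_finsetSum _ fun j hj => integrable_fourierWeight hΛ hj)
          (integrable_const _) ?_
        filter_upwards [hΛ] with f hf
        exact sum_fourierWeight_le hf
    _ = 1 := by simp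

end Fourier

/-! ### Overlaps of two assignments -/

section Clauses

variable {k n : ℕ}

/-- The overlap `(1/n) ∑ σ_j τ_j` of two assignments. -/
def pairOverlap (σ τ : Cube n) : ℝ := (∑ j, spin (σ j) * spin (τ j)) / n

/-- The sum over tuples factors by coordinate: a coordinate in `T` contributes `∑ r`, and each of
the remaining `k - |T|` contributes `n`. -/
lemma sum_tuples_prod (r : Fin n → ℝ) (T : Finset (Fin k)) :
    ∑ i : Fin k → Fin n, ∏ a ∈ T, r (i a) = (∑ j, r j) ^ T.card * (n : ℝ) ^ (k - T.card) := by
  have h := Finset.prod_univ_sum (fun _ : Fin k => (Finset.univ : Finset (Fin n)))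
    (fun a j => if a ∈ T then r j else 1)
  rw [Fintype.piFinset_univ] at h
  have h1 : ∀ i : Fin k → Fin n, ∏ a ∈ T, r (i a) = ∏ a, if a ∈ T then r (i a) else 1 := fun i => by
    rw [Finset.prod_ite_mem, Finset.univ_inter]
  simp_rw [h1]
  rw [← h]
  have h2 : ∀ a : Fin k, (∑ j, if a ∈ T then r j else 1) = if a ∈ T then ∑ j, r j else (n : ℝ) :=
    fun a => by split_ifs <;> simp
  simp_rw [h2]
  rw [Finset.prod_ite, Finset.prod_const, Finset.prod_const]
  congr 2
  · congr 1
    ext; simp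
  · have : (Finset.univ.filter fun a => a ∉ T) = Tᶜ := by ext; simp
    rw [this, Finset.card_compl, Fintype.card_fin]

lemma sum_tuples_prod_div (hn : 0 < n) (σ τ : Cube n) (T : Finset (Fin k)) :
    (∑ i : Fin k → Fin n, ∏ a ∈ T, (spin (σ (i a)) * spin (τ (i a)))) / (n : ℝ) ^ k
      = pairOverlap σ τ ^ T.card := by
  have hn' : (n : ℝ) ≠ 0 := by positivity
  rw [sum_tuples_prod (fun j => spin (σ j) * spin (τ j)) T, pairOverlap, div_pow]
  have hT : T.card ≤ k := by simpa using Finset.card_le_univ T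
  have hk : (n : ℝ) ^ k = (n : ℝ) ^ T.card * (n : ℝ) ^ (k - T.card) := by
    rw [← pow_add, Nat.add_sub_cancel' hT]
  rw [hk]
  field_simp

end Clauses

/-! ### The random field of one constraint -/

section ClauseField

variable {k n : ℕ}

lemma measurable_clause {γ : Type*} [MeasurableSpace γ] {F : Clause k n → γ}
    (hF : ∀ p, Measurable fun f => F (f, p)) : Measurable F :=
  measurable_from_prod_countable_left hF

lemma measurable_clause_value (σ : Cube n) : Measurable fun e : Clause k n => e.value σ :=
  measurable_clause fun p => measurable_pi_apply fun a => p.2 a * σ (p.1 a)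

lemma integral_uniformOn_univ {α : Type*} [Fintype α] [MeasurableSpace α]
    [MeasurableSingletonClass α] (F : α → ℝ) :
    ∫ x, F x ∂(uniformOn (Set.univ : Set α)) = (∑ x, F x) / Fintype.card α := by
  rw [uniformOn, ProbabilityTheory.cond, Measure.restrict_univ, integral_smul_measure,
    integral_count, Measure.count_univ, smul_eq_mul, div_eq_inv_mul]
  congr 1
  simp [ENNReal.toReal_inv]

variable {Λ : Measure (Predicate k)} [IsProbabilityMeasure Λ]

lemma isProbabilityMeasure_clauseLaw (hn : 0 < n) : IsProbabilityMeasure (clauseLaw Λ n) := by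
  have : Nonempty (Fin n) := ⟨⟨0, hn⟩⟩
  have h1 := isProbabilityMeasure_uniformOn (Ω := Fin k → Fin n) Set.finite_univ
    Set.univ_nonempty
  have h2 := isProbabilityMeasure_uniformOn (Ω := Cube k) Set.finite_univ Set.univ_nonempty
  unfold clauseLaw
  infer_instance

omit [IsProbabilityMeasure Λ] in
lemma ae_clauseLaw (hn : 0 < n) (hΛ : ∀ᵐ f ∂Λ, ∀ σ, f σ ∈ Set.Icc (-1 : ℝ) 1) :
    ∀ᵐ e ∂clauseLaw Λ n, ∀ σ, e.1 σ ∈ Set.Icc (-1 : ℝ) 1 := by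
  have : Nonempty (Fin n) := ⟨⟨0, hn⟩⟩
  have h1 := isProbabilityMeasure_uniformOn (Ω := Fin k → Fin n) Set.finite_univ
    Set.univ_nonempty
  have h2 := isProbabilityMeasure_uniformOn (Ω := Cube k) Set.finite_univ Set.univ_nonempty
  exact Measure.quasiMeasurePreserving_fst.ae hΛ

lemma integral_clauseLaw (hn : 0 < n) {F : Clause k n → ℝ}
    (hF : Integrable F (clauseLaw Λ n)) :
    ∫ e, F e ∂clauseLaw Λ n
      = ∫ f, (∑ i, (∑ ε, F (f, i, ε)) / 2 ^ k) / (n : ℝ) ^ k ∂Λ := by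
  have : Nonempty (Fin n) := ⟨⟨0, hn⟩⟩
  have h1 := isProbabilityMeasure_uniformOn (Ω := Fin k → Fin n) Set.finite_univ
    Set.univ_nonempty
  have h2 := isProbabilityMeasure_uniformOn (Ω := Cube k) Set.finite_univ Set.univ_nonempty
  unfold clauseLaw at hF ⊢
  rw [integral_prod _ hF]
  refine integral_congr_ae (Eventually.of_forall fun f => ?_)
  simp only
  rw [integral_prod _ .of_finite, integral_uniformOn_univ]
  simp_rw [integral_uniformOn_univ]
  simp [Fintype.card_units_int]

/-- The value of a constraint, centered given its predicate. -/
def centeredValue (e : Clause k n) (σ : Cube n) : ℝ := e.value σ - fourierCoefficient e.1 ∅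

lemma measurable_centeredValue (σ : Cube n) :
    Measurable fun e : Clause k n => centeredValue e σ :=
  (measurable_clause_value σ).sub ((measurable_fourierCoefficient ∅).comp measurable_fst)

lemma abs_centeredValue_le {e : Clause k n} (he : ∀ σ, e.1 σ ∈ Set.Icc (-1 : ℝ) 1) (σ : Cube n) :
    |centeredValue e σ| ≤ 2 := by
  have h1 : |e.value σ| ≤ 1 := abs_le.2 (he _)
  have h2 := abs_fourierCoefficient_le he ∅
  exact (abs_sub _ _).trans (by linarith)

lemma integrable_of_ae_bound {Ω : Type*} [MeasurableSpace Ω] {P : Measure Ω} [IsFiniteMeasure P]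
    {F : Ω → ℝ} (hF : AEStronglyMeasurable F P) {c : ℝ} (h : ∀ᵐ ω ∂P, |F ω| ≤ c) :
    Integrable F P :=
  (integrable_const c).mono' hF h

lemma integrable_centeredValue (hn : 0 < n) (hΛ : ∀ᵐ f ∂Λ, ∀ σ, f σ ∈ Set.Icc (-1 : ℝ) 1)
    (σ : Cube n) : Integrable (fun e => centeredValue e σ) (clauseLaw Λ n) := by
  have := isProbabilityMeasure_clauseLaw (Λ := Λ) hn
  refine integrable_of_ae_bound (measurable_centeredValue σ).aestronglyMeasurable (c := 2) ?_
  filter_upwards [ae_clauseLaw hn hΛ] with e he using abs_centeredValue_le he σ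

lemma integrable_centeredValue_mul (hn : 0 < n)
    (hΛ : ∀ᵐ f ∂Λ, ∀ σ, f σ ∈ Set.Icc (-1 : ℝ) 1) (σ τ : Cube n) :
    Integrable (fun e => centeredValue e σ * centeredValue e τ) (clauseLaw Λ n) := by
  have := isProbabilityMeasure_clauseLaw (Λ := Λ) hn
  refine integrable_of_ae_bound ((measurable_centeredValue σ).mul
    (measurable_centeredValue τ)).aestronglyMeasurable (c := 2 * 2) ?_
  filter_upwards [ae_clauseLaw hn hΛ] with e he
  rw [abs_mul]
  exact mul_le_mul (abs_centeredValue_le he σ) (abs_centeredValue_le he τ) (abs_nonneg _)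
    (by norm_num)

lemma integral_centeredValue (hn : 0 < n) (hΛ : ∀ᵐ f ∂Λ, ∀ σ, f σ ∈ Set.Icc (-1 : ℝ) 1)
    (σ : Cube n) : ∫ e, centeredValue e σ ∂clauseLaw Λ n = 0 := by
  rw [integral_clauseLaw hn (integrable_centeredValue hn hΛ σ)]
  have h : ∀ (f : Predicate k) (i : Fin k → Fin n),
      (∑ ε, centeredValue (f, i, ε) σ) / 2 ^ k = 0 := fun f i => by
    have := sum_signs_value f fun a => σ (i a)
    simp only [centeredValue, Clause.value, Finset.sum_sub_distrib, sub_div, this]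
    simp [Fintype.card_units_int]
  simp [h]

lemma sum_signs_centeredValue_mul (f : Predicate k) (i : Fin k → Fin n) (σ τ : Cube n) :
    (∑ ε, centeredValue (f, i, ε) σ * centeredValue (f, i, ε) τ) / 2 ^ k
      = ∑ T, fourierCoefficient f T ^ 2 * ∏ a ∈ T, (spin (σ (i a)) * spin (τ (i a)))
        - fourierCoefficient f ∅ ^ 2 := by
  rw [← sum_signs_value_mul f (fun a => σ (i a)) fun a => τ (i a)]
  have h1 := sum_signs_value f fun a => σ (i a)
  have h2 := sum_signs_value f fun a => τ (i a)
  have h3 : ∀ ε : Cube k, centeredValue (f, i, ε) σ * centeredValue (f, i, ε) τ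
      = (f fun a => ε a * σ (i a)) * (f fun a => ε a * τ (i a))
        - fourierCoefficient f ∅ * (f fun a => ε a * σ (i a))
        - fourierCoefficient f ∅ * (f fun a => ε a * τ (i a))
        + fourierCoefficient f ∅ ^ 2 := fun ε => by
    simp only [centeredValue, Clause.value]; ring
  simp_rw [h3, Finset.sum_add_distrib, Finset.sum_sub_distrib, ← Finset.mul_sum, add_div, sub_div,
    mul_div_assoc, h1, h2]
  simp [Fintype.card_units_int]
  ring

/-- The signs diagonalise the covariance in the Fourier basis, the independent uniform indices turn
a character of level `j` into the `j`-th power of the overlap, and centering cancels the empty set.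
This is the origin of the mixture polynomial. -/
lemma integral_centeredValue_mul (hn : 0 < n) (hΛ : ∀ᵐ f ∂Λ, ∀ σ, f σ ∈ Set.Icc (-1 : ℝ) 1)
    (σ τ : Cube n) :
    ∫ e, centeredValue e σ * centeredValue e τ ∂clauseLaw Λ n
      = (mixture Λ).eval (pairOverlap σ τ) := by
  rw [integral_clauseLaw hn (integrable_centeredValue_mul hn hΛ σ τ), eval_mixture]
  have hn' : (n : ℝ) ^ k ≠ 0 := by positivity
  have h : ∀ f : Predicate k,
      (∑ i, (∑ ε, centeredValue (f, i, ε) σ * centeredValue (f, i, ε) τ) / 2 ^ k) / (n : ℝ) ^ k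
      = ∑ j ∈ Finset.Icc 1 k, fourierWeight f j * pairOverlap σ τ ^ j := fun f => by
    simp_rw [sum_signs_centeredValue_mul, Finset.sum_sub_distrib]
    rw [Finset.sum_comm]
    simp_rw [← Finset.mul_sum, sub_div, Finset.sum_div, mul_div_assoc,
      sum_tuples_prod_div hn, sum_fourier_mul_pow]
    simp only [Finset.sum_const, Finset.card_univ, Fintype.card_pi, Fintype.card_fin,
      Finset.prod_const, nsmul_eq_mul, Nat.cast_pow]
    rw [mul_div_cancel₀ _ hn']
    ring
  simp_rw [h]
  rw [integral_finsetSum _ fun j hj => (integrable_fourierWeight hΛ hj).mul_const _]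
  simp_rw [integral_mul_const]

variable {ℓ : ℕ} {ι : Type*}

/-- The contribution `s ∑_i c_i (f_e(x_i) - f̂_e(∅))` of a constraint to a centered grand
Hamiltonian, on a family `X` of configurations. -/
def clauseField (s : ℝ) (c : Fin ℓ → ℝ) (X : ι → Fin ℓ → Cube n) (e : Clause k n) (x : ι) : ℝ :=
  s * ∑ i, c i * centeredValue e (X x i)

lemma measurable_clauseField (s : ℝ) (c : Fin ℓ → ℝ) (X : ι → Fin ℓ → Cube n) :
    Measurable (clauseField s c X : Clause k n → ι → ℝ) :=
  measurable_pi_lambda _ fun _ => (Finset.measurable_sum _ fun _ _ =>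
    (measurable_centeredValue _).const_mul _).const_mul _

lemma abs_clauseField_le {s : ℝ} (hs : 0 ≤ s) {c : Fin ℓ → ℝ} (hc : ∀ i, c i ∈ Set.Icc (0 : ℝ) 1)
    (X : ι → Fin ℓ → Cube n) {e : Clause k n} (he : ∀ σ, e.1 σ ∈ Set.Icc (-1 : ℝ) 1) (x : ι) :
    |clauseField s c X e x| ≤ 2 * ℓ * s := by
  unfold clauseField
  rw [abs_mul, abs_of_nonneg hs]
  have : |∑ i, c i * centeredValue e (X x i)| ≤ ∑ _i : Fin ℓ, (2 : ℝ) := by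
    refine (Finset.abs_sum_le_sum_abs _ _).trans (Finset.sum_le_sum fun i _ => ?_)
    rw [abs_mul, abs_of_nonneg (hc i).1]
    exact (mul_le_of_le_one_left (abs_nonneg _) (hc i).2).trans (abs_centeredValue_le he _)
  have h2 := mul_le_mul_of_nonneg_left this hs
  simp at h2
  linarith

/-- The covariance kernel `s² ∑_{i,i'} c_i c_{i'} ξ(R(x_i, y_{i'}))`. -/
def couplingCovariance (ξ : Polynomial ℝ) (v : ℝ) (c : Fin ℓ → ℝ) (X : ι → Fin ℓ → Cube n)
    (x y : ι) : ℝ :=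
  v * ∑ i, ∑ i', c i * c i' * ξ.eval (pairOverlap (X x i) (X y i'))

variable [Fintype ι]

/-- The field is bounded by `2 ℓ s`, so the exponent is at most `2` when `lam ℓ s ≤ 1`. The
resulting constant `e²` is also used for the Gaussian fields, as a comparison requires a common one.
-/
lemma isSubexponential_clauseField (hn : 0 < n)
    (hΛ : ∀ᵐ f ∂Λ, ∀ σ, f σ ∈ Set.Icc (-1 : ℝ) 1) {s lam : ℝ} (hs : 0 ≤ s) (hlam : 0 < lam)
    (hsl : lam * (ℓ * s) ≤ 1) {c : Fin ℓ → ℝ} (hc : ∀ i, c i ∈ Set.Icc (0 : ℝ) 1)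
    (X : ι → Fin ℓ → Cube n) :
    IsSubexponential ((clauseLaw Λ n).map (clauseField s c X)) lam (Real.exp 2) := by
  have := isProbabilityMeasure_clauseLaw (Λ := Λ) hn
  have hm := measurable_clauseField (k := k) s c X
  have hb : ∀ x, ∀ᵐ e ∂clauseLaw Λ n,
      Real.exp (lam * |clauseField s c X e x|) ≤ Real.exp 2 := fun x => by
    filter_upwards [ae_clauseLaw hn hΛ] with e he
    refine Real.exp_le_exp.2 ?_
    calc _ ≤ lam * (2 * ℓ * s) := mul_le_mul_of_nonneg_left (abs_clauseField_le hs hc X he x) hlam.le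
      _ = 2 * (lam * (ℓ * s)) := by ring
      _ ≤ 2 := by linarith
  have hmx : ∀ x : ι, Measurable fun u : ι → ℝ => Real.exp (lam * |u x|) := fun x =>
    Continuous.measurable (by fun_prop)
  have hi : ∀ x, Integrable (fun e => Real.exp (lam * |clauseField s c X e x|)) (clauseLaw Λ n) :=
    fun x => integrable_of_ae_bound ((hmx x).comp hm).aestronglyMeasurable (by
      filter_upwards [hb x] with e he
      rwa [abs_of_pos (Real.exp_pos _)])
  refine ⟨Measure.isProbabilityMeasure_map hm.aemeasurable, hlam, fun x => ?_, fun x => ?_⟩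
  · exact (integrable_map_measure (hmx x).aestronglyMeasurable hm.aemeasurable).2 (hi x)
  · rw [integral_map hm.aemeasurable (hmx x).aestronglyMeasurable]
    refine (integral_mono_ae (hi x) (integrable_const _) (hb x)).trans ?_
    simp

omit [Fintype ι] in
lemma hasCovariance_clauseField (hn : 0 < n)
    (hΛ : ∀ᵐ f ∂Λ, ∀ σ, f σ ∈ Set.Icc (-1 : ℝ) 1) (s : ℝ) (c : Fin ℓ → ℝ)
    (X : ι → Fin ℓ → Cube n) :
    HasCovariance ((clauseLaw Λ n).map (clauseField s c X))
      (couplingCovariance (mixture Λ) (s ^ 2) c X) := by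
  have hm := measurable_clauseField (k := k) s c X
  refine ⟨fun x => ?_, fun x y => ?_⟩
  · rw [integral_map hm.aemeasurable (measurable_pi_apply x).aestronglyMeasurable]
    simp only [clauseField]
    rw [integral_const_mul,
      integral_finsetSum _ fun i _ => (integrable_centeredValue hn hΛ _).const_mul _]
    simp [integral_const_mul, integral_centeredValue hn hΛ]
  · have hxy : Measurable fun u : ι → ℝ => u x * u y :=
      (measurable_pi_apply x).mul (measurable_pi_apply y)
    rw [integral_map hm.aemeasurable hxy.aestronglyMeasurable]
    have h : ∀ e : Clause k n, clauseField s c X e x * clauseField s c X e y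
        = s ^ 2 * ∑ i, ∑ i', c i * c i' *
          (centeredValue e (X x i) * centeredValue e (X y i')) := fun e => by
      simp only [clauseField]
      rw [mul_mul_mul_comm, ← sq, Finset.sum_mul_sum]
      congr 1
      exact Finset.sum_congr rfl fun i _ => Finset.sum_congr rfl fun i' _ => by ring
    have hi := fun i i' => (integrable_centeredValue_mul hn hΛ (X x i) (X y i')).const_mul
      (c i * c i')
    simp_rw [h]
    rw [integral_const_mul, integral_finsetSum _ fun i _ => integrable_finsetSum _ fun i' _ => hi i i',
      couplingCovariance]
    congr 1
    refine Finset.sum_congr rfl fun i _ => ?_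
    rw [integral_finsetSum _ fun i' _ => hi i i']
    simp_rw [integral_const_mul, integral_centeredValue_mul hn hΛ]

end ClauseField

/-! ### Finite-dimensional Gaussian fields -/

section Gaussian

variable {κ : Type*} [Fintype κ]

/-- The law of independent centered Gaussians of variance `v`. -/
def gaussianPi (κ : Type*) [Fintype κ] (v : NNReal) : Measure (κ → ℝ) :=
  Measure.pi fun _ => gaussianReal 0 v

instance (v : NNReal) : IsProbabilityMeasure (gaussianPi κ v) := by
  unfold gaussianPi; infer_instance

lemma gaussianPi_conv (v w : NNReal) :
    gaussianPi κ v ∗ gaussianPi κ w = gaussianPi κ (v + w) := by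
  have h := (measurePreserving_arrowProdEquivProdArrow ℝ ℝ κ (fun _ => gaussianReal 0 v)
    (fun _ => gaussianReal 0 w)).map_eq
  unfold gaussianPi Measure.conv
  rw [← h, Measure.map_map (by fun_prop) (MeasurableEquiv.measurable _)]
  have h2 : ((fun x : (κ → ℝ) × (κ → ℝ) => x.1 + x.2) ∘
      (MeasurableEquiv.arrowProdEquivProdArrow ℝ ℝ κ))
      = fun (q : κ → ℝ × ℝ) i => (fun p : ℝ × ℝ => p.1 + p.2) (q i) := by
    ext q i
    rfl
  have hm : ∀ _i : κ, AEMeasurable (fun p : ℝ × ℝ => p.1 + p.2)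
    ((gaussianReal 0 v).prod (gaussianReal 0 w)) := fun _ => by fun_prop
  have : ∀ _i : κ, IsProbabilityMeasure (Measure.map (fun p : ℝ × ℝ => p.1 + p.2)
    ((gaussianReal 0 v).prod (gaussianReal 0 w))) := fun i =>
      Measure.isProbabilityMeasure_map (hm i)
  rw [h2, Measure.pi_map_pi hm]
  congr 1
  funext i
  have := gaussianReal_conv_gaussianReal (m₁ := 0) (m₂ := 0) (v₁ := v) (v₂ := w)
  rw [add_zero] at this
  exact this

lemma gaussianPi_map_smul (c : ℝ) :
    (gaussianPi κ 1).map (fun J => c • J) = gaussianPi κ (Real.toNNReal (c ^ 2)) := by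
  unfold gaussianPi
  have hm : ∀ _i : κ, AEMeasurable (fun p : ℝ => c * p) (gaussianReal 0 1) := fun _ => by fun_prop
  have : ∀ _i : κ, IsProbabilityMeasure (Measure.map (fun p : ℝ => c * p) (gaussianReal 0 1)) :=
    fun i => Measure.isProbabilityMeasure_map (hm i)
  have h := Measure.pi_map_pi hm
  refine Eq.trans h ?_
  congr 1
  funext i
  rw [gaussianReal_map_const_mul, mul_zero, mul_one]
  congr 1
  ext
  simp [sq_nonneg]

lemma integral_gaussianPi_apply (v : NNReal) (i : κ) : ∫ J, J i ∂gaussianPi κ v = 0 := by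
  refine (integral_comp_eval (X := fun _ : κ => ℝ) (μ := fun _ => gaussianReal 0 v) (i := i)
    (f := fun x => x) aestronglyMeasurable_id).trans ?_
  rw [integral_id_gaussianReal]

lemma memLp_gaussianPi_apply (v : NNReal) (i : κ) :
    MemLp (fun J : κ → ℝ => J i) 2 (gaussianPi κ v) :=
  MemLp.comp_measurePreserving (memLp_id_gaussianReal 2)
    (measurePreserving_eval (fun _ : κ => gaussianReal 0 v) i)

lemma integral_sq_gaussianReal (v : NNReal) : ∫ x, x ^ 2 ∂gaussianReal 0 v = v := by
  have h := variance_id_gaussianReal (μ := 0) (v := v)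
  rw [variance_eq_sub (memLp_id_gaussianReal 2)] at h
  simp only [id_eq, integral_id_gaussianReal] at h
  simpa using h

lemma integral_gaussianPi_mul [DecidableEq κ] (v : NNReal) (i j : κ) :
    ∫ J, J i * J j ∂gaussianPi κ v = if i = j then (v : ℝ) else 0 := by
  split_ifs with h
  · subst h
    simp_rw [← sq]
    refine (integral_comp_eval (X := fun _ : κ => ℝ) (μ := fun _ => gaussianReal 0 v) (i := i)
      (f := fun x => x ^ 2) (Continuous.aestronglyMeasurable (by fun_prop))).trans ?_
    rw [integral_sq_gaussianReal]
  · have hind : iIndepFun (fun (i : κ) (J : κ → ℝ) => J i) (gaussianPi κ v) :=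
      iIndepFun_pi (X := fun (_ : κ) (x : ℝ) => x) fun _ => aemeasurable_id
    rw [(hind.indepFun h).integral_fun_mul_eq_mul_integral
      (memLp_gaussianPi_apply v i).1 (memLp_gaussianPi_apply v j).1,
      integral_gaussianPi_apply, zero_mul]

lemma integrable_exp_gaussianPi (v : NNReal) (t : κ → ℝ) :
    Integrable (fun J => Real.exp (∑ i, t i * J i)) (gaussianPi κ v) := by
  simp_rw [Real.exp_sum]
  exact Integrable.fintype_prod (f := fun i x => Real.exp (t i * x)) fun i =>
    integrable_exp_mul_gaussianReal (t i)

lemma integral_exp_gaussianPi (v : NNReal) (t : κ → ℝ) :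
    ∫ J, Real.exp (∑ i, t i * J i) ∂gaussianPi κ v = Real.exp (v * (∑ i, t i ^ 2) / 2) := by
  simp_rw [Real.exp_sum]
  unfold gaussianPi
  rw [integral_fintype_prod_eq_prod (fun i x => Real.exp (t i * x)), Finset.mul_sum,
    Finset.sum_div, Real.exp_sum]
  refine Finset.prod_congr rfl fun i _ => ?_
  have h := congrFun (mgf_id_gaussianReal (μ := 0) (v := v)) (t i)
  simpa [mgf] using h

variable {ι : Type*}

/-- The Gaussian field `x ↦ ∑_i B_{x,i} J_i`. -/
def gaussianField (B : ι → κ → ℝ) (J : κ → ℝ) (x : ι) : ℝ := ∑ i, B x i * J i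

lemma measurable_gaussianField (B : ι → κ → ℝ) : Measurable (gaussianField B) :=
  measurable_pi_lambda _ fun x => Continuous.measurable (by unfold gaussianField; fun_prop)

/-- The law of `x ↦ ∑_i B_{x,i} J_i` for independent `J_i` of variance `v`. -/
def gaussianFieldLaw (B : ι → κ → ℝ) (v : NNReal) : Measure (ι → ℝ) :=
  (gaussianPi κ v).map (gaussianField B)

instance (B : ι → κ → ℝ) (v : NNReal) : IsProbabilityMeasure (gaussianFieldLaw B v) :=
  Measure.isProbabilityMeasure_map (measurable_gaussianField B).aemeasurable

/-- The field is linear in the disorder, so its laws form a convolution semigroup in the variance. A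
spin glass can therefore be cut into as many independent pieces as there are constraints. -/
lemma gaussianFieldLaw_conv [Countable ι] (B : ι → κ → ℝ) (v w : NNReal) :
    gaussianFieldLaw B v ∗ gaussianFieldLaw B w = gaussianFieldLaw B (v + w) := by
  let L : (κ → ℝ) →+ (ι → ℝ) :=
    { toFun := gaussianField B
      map_zero' := by ext x; simp [gaussianField]
      map_add' := fun J K => by ext x; simp [gaussianField, mul_add, Finset.sum_add_distrib] }
  have h := Measure.map_conv_addMonoidHom (μ := gaussianPi κ v) (ν := gaussianPi κ w) L
    (measurable_gaussianField B)
  rw [gaussianPi_conv] at h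
  exact h.symm

lemma gaussianFieldLaw_map_smul (B : ι → κ → ℝ) (c : ℝ) :
    (gaussianPi κ 1).map (fun J => c • gaussianField B J)
      = gaussianFieldLaw B (Real.toNNReal (c ^ 2)) := by
  rw [gaussianFieldLaw, ← gaussianPi_map_smul,
    Measure.map_map (measurable_gaussianField B) (by fun_prop)]
  congr 1
  ext J x
  simp only [gaussianField, Function.comp_apply, Pi.smul_apply, smul_eq_mul, Finset.mul_sum]
  exact Finset.sum_congr rfl fun i _ => by ring

lemma gaussianFieldLaw_zero (B : ι → κ → ℝ) : gaussianFieldLaw B 0 = Measure.dirac 0 := by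
  have h := gaussianFieldLaw_map_smul B 0
  simp only [zero_smul, ne_eq, OfNat.ofNat_ne_zero, not_false_eq_true, zero_pow,
    Real.toNNReal_zero] at h
  rw [← h, Measure.map_const, measure_univ, one_smul]

lemma hasCovariance_gaussianFieldLaw (B : ι → κ → ℝ) (v : NNReal) :
    HasCovariance (gaussianFieldLaw B v) (fun x y => v * ∑ i, B x i * B y i) := by
  classical
  have hm := measurable_gaussianField B
  have i1 : ∀ i, Integrable (fun J : κ → ℝ => J i) (gaussianPi κ v) := fun i =>
    (memLp_gaussianPi_apply v i).integrable one_le_two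
  have i2 : ∀ i j, Integrable (fun J : κ → ℝ => J i * J j) (gaussianPi κ v) := fun i j =>
    (memLp_gaussianPi_apply v i).integrable_mul (memLp_gaussianPi_apply v j)
  refine ⟨fun x => ?_, fun x y => ?_⟩
  · rw [gaussianFieldLaw,
      integral_map hm.aemeasurable (measurable_pi_apply x).aestronglyMeasurable]
    simp only [gaussianField]
    rw [integral_finsetSum _ fun i _ => (i1 i).const_mul _]
    simp [integral_const_mul, integral_gaussianPi_apply]
  · have hxy : Measurable fun u : ι → ℝ => u x * u y :=
      (measurable_pi_apply x).mul (measurable_pi_apply y)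
    rw [gaussianFieldLaw, integral_map hm.aemeasurable hxy.aestronglyMeasurable]
    have h : ∀ J : κ → ℝ, gaussianField B J x * gaussianField B J y
        = ∑ i, ∑ j, B x i * B y j * (J i * J j) := fun J => by
      rw [gaussianField, gaussianField, Finset.sum_mul_sum]
      exact Finset.sum_congr rfl fun i _ => Finset.sum_congr rfl fun j _ => by ring
    simp_rw [h]
    rw [integral_finsetSum _ fun i _ => integrable_finsetSum _ fun j _ => (i2 i j).const_mul _,
      Finset.mul_sum]
    refine Finset.sum_congr rfl fun i _ => ?_
    rw [integral_finsetSum _ fun j _ => (i2 i j).const_mul _]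
    simp_rw [integral_const_mul, integral_gaussianPi_mul]
    simp
    ring

variable [Fintype ι]

/-- `e^{lam |t|} ≤ e^{lam t} + e^{-lam t}`, and by hypothesis each of the two Gaussian exponential
moments is at most `e^{1/2}`. -/
lemma isSubexponential_gaussianFieldLaw (B : ι → κ → ℝ) (v : NNReal) {lam : ℝ} (hlam : 0 < lam)
    (hB : ∀ x, lam ^ 2 * (v * ∑ i, B x i ^ 2) ≤ 1) :
    IsSubexponential (gaussianFieldLaw B v) lam (Real.exp 2) := by
  have hm := measurable_gaussianField B
  have hmx : ∀ x : ι, Measurable fun u : ι → ℝ => Real.exp (lam * |u x|) := fun x =>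
    Continuous.measurable (by fun_prop)
  have e : ∀ (s : ℝ) (x : ι) (J : κ → ℝ), s * gaussianField B J x = ∑ i, s * B x i * J i :=
    fun s x J => by
      rw [gaussianField, Finset.mul_sum]
      exact Finset.sum_congr rfl fun i _ => by ring
  have ie : ∀ (s : ℝ) (x : ι), Integrable (fun J => Real.exp (s * gaussianField B J x))
      (gaussianPi κ v) := fun s x => by
    simp_rw [e]
    exact integrable_exp_gaussianPi v _
  have ve : ∀ (s : ℝ), s ^ 2 = lam ^ 2 → ∀ x,
      ∫ J, Real.exp (s * gaussianField B J x) ∂gaussianPi κ v ≤ Real.exp (1 / 2) := fun s hs x => by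
    simp_rw [e]
    rw [integral_exp_gaussianPi]
    refine Real.exp_le_exp.2 ?_
    have := hB x
    simp_rw [mul_pow, hs, ← Finset.mul_sum]
    linarith
  have hle : ∀ (x : ι) (J : κ → ℝ), Real.exp (lam * |gaussianField B J x|)
      ≤ Real.exp (lam * gaussianField B J x) + Real.exp (-lam * gaussianField B J x) :=
    fun x J => by
      rcases abs_cases (gaussianField B J x) with h | h <;> rw [h.1]
      · linarith [Real.exp_pos (-lam * gaussianField B J x)]
      · rw [mul_neg, neg_mul]
        linarith [Real.exp_pos (lam * gaussianField B J x)]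
  have hi : ∀ x, Integrable (fun J => Real.exp (lam * |gaussianField B J x|)) (gaussianPi κ v) :=
    fun x => ((ie lam x).add (ie (-lam) x)).mono' ((hmx x).comp hm).aestronglyMeasurable
      (Eventually.of_forall fun J => by
        rw [Real.norm_of_nonneg (Real.exp_pos _).le]
        exact hle x J)
  refine ⟨inferInstance, hlam, fun x => ?_, fun x => ?_⟩
  · exact (integrable_map_measure (hmx x).aestronglyMeasurable hm.aemeasurable).2 (hi x)
  · rw [gaussianFieldLaw, integral_map hm.aemeasurable (hmx x).aestronglyMeasurable]
    have h := integral_mono (hi x) ((ie lam x).add (ie (-lam) x)) (hle x)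
    simp only [Pi.add_apply] at h
    rw [integral_add (ie lam x) (ie (-lam) x)] at h
    have h1 := ve lam rfl x
    have h2 := ve (-lam) (neg_sq lam) x
    have h3 : Real.exp (1 / 2) + Real.exp (1 / 2) ≤ Real.exp 2 := by
      have h4 : Real.exp 2 = Real.exp (1 / 2) * Real.exp (3 / 2) := by
        rw [← Real.exp_add]; norm_num
      have h5 : (2 : ℝ) ≤ Real.exp (3 / 2) := by
        have := Real.add_one_le_exp (3 / 2 : ℝ)
        linarith
      rw [h4]
      nlinarith [Real.exp_pos (1 / 2 : ℝ)]
    linarith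

/-- The field is a sum of independent fields `x ↦ B x i * J i`, each of sup norm at most `a i * |J
i|`. Efron–Stein thus suffices in place of Gaussian concentration. -/
lemma hasLipschitzVariance_gaussianFieldLaw [Nonempty ι] (B : ι → κ → ℝ) (v : NNReal) {a : κ → ℝ}
    (ha : ∀ x i, |B x i| ≤ a i) :
    HasLipschitzVariance (gaussianFieldLaw B v) (∑ i, v * a i ^ 2) := by
  have ha0 : ∀ i, 0 ≤ a i := fun i => (abs_nonneg _).trans (ha (Classical.arbitrary ι) i)
  have hY : ∀ i, Measurable fun (J : κ → ℝ) (x : ι) => B x i * J i := fun i =>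
    measurable_pi_lambda _ fun x => Continuous.measurable (by fun_prop)
  have hind : iIndepFun (fun (i : κ) (J : κ → ℝ) (x : ι) => B x i * J i) (gaussianPi κ v) :=
    iIndepFun_pi (X := fun (i : κ) (t : ℝ) (x : ι) => B x i * t) fun i =>
      (measurable_pi_lambda _ fun x => Continuous.measurable (by fun_prop)).aemeasurable
  have hsum : gaussianField B = ∑ i, fun (J : κ → ℝ) (x : ι) => B x i * J i := by
    ext J x
    simp [gaussianField, Finset.sum_apply]
  rw [gaussianFieldLaw, hsum]
  refine hasLipschitzVariance_sum (fun i => (hY i).aemeasurable) hind (fun i => ?_) Finset.univ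
  have hmem : MemLp (fun (J : κ → ℝ) (x : ι) => B x i * J i) 2 (gaussianPi κ v) :=
    memLp_pi_iff.2 fun x => (memLp_gaussianPi_apply v i).const_mul _
  have := Measure.isProbabilityMeasure_map (μ := gaussianPi κ v) (hY i).aemeasurable
  refine hasLipschitzVariance_of_memLp ?_ ?_
  · rw [memLp_map_measure_iff aestronglyMeasurable_id (hY i).aemeasurable]
    exact hmem
  · rw [integral_map (hY i).aemeasurable (Continuous.aestronglyMeasurable (by fun_prop))]
    have hsq : Integrable (fun J : κ → ℝ => a i ^ 2 * J i ^ 2) (gaussianPi κ v) :=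
      (memLp_gaussianPi_apply v i).integrable_sq.const_mul _
    have hmn : MemLp (fun J : κ → ℝ => ‖fun x : ι => B x i * J i‖) 2 (gaussianPi κ v) := hmem.norm
    refine (integral_mono hmn.integrable_sq hsq fun J => ?_).trans (le_of_eq ?_)
    · have h : ‖fun x : ι => B x i * J i‖ ≤ a i * |J i| :=
        (pi_norm_le_iff_of_nonneg (mul_nonneg (ha0 i) (abs_nonneg _))).2 fun x => by
          rw [Real.norm_eq_abs, abs_mul]
          exact mul_le_mul_of_nonneg_right (ha x i) (abs_nonneg _)
      have h2 := pow_le_pow_left₀ (norm_nonneg _) h 2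
      rwa [mul_pow, sq_abs] at h2
    · rw [integral_const_mul]
      classical
      have h := integral_gaussianPi_mul v i i
      simp only [← sq, if_true] at h
      rw [h, mul_comm]

end Gaussian

/-! ### Spin glasses as Gaussian fields -/

section SpinGlass

variable {k n ℓ : ℕ} {ι : Type*}

/-- The matrix of the Gaussian field `x ↦ ∑_i c_i G(x_i)`, where `G` is the spin glass with mixture
polynomial `ξ`. -/
def sgMatrix (ξ : Polynomial ℝ) (c : Fin ℓ → ℝ) (X : ι → Fin ℓ → Cube n) (x : ι)
    (q : Σ p : Fin k, Fin (p.val + 1) → Fin n) : ℝ :=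
  √(ξ.coeff (q.1.val + 1)) / (n : ℝ) ^ ((q.1.val : ℝ) / 2) *
    ∑ i, c i * ∏ a, spin (X x i (q.2 a))

lemma gaussianField_sgMatrix (ξ : Polynomial ℝ) (c : Fin ℓ → ℝ) (X : ι → Fin ℓ → Cube n)
    (J : Disorder k n) (x : ι) :
    gaussianField (sgMatrix ξ c X) J x = ∑ i, c i * sgHamiltonian ξ J (X x i) := by
  simp only [gaussianField, sgMatrix, sgHamiltonian, Fintype.sum_sigma, Finset.mul_sum,
    Finset.sum_mul]
  rw [Finset.sum_comm]
  conv_rhs => rw [Finset.sum_comm]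
  rw [Finset.sum_comm]
  refine Finset.sum_congr rfl fun p _ => ?_
  rw [Finset.sum_comm]
  exact Finset.sum_congr rfl fun i _ => Finset.sum_congr rfl fun a _ => by ring

lemma sgHamiltonian_C_mul {b : ℝ} (hb : 0 ≤ b) (ξ : Polynomial ℝ) (J : Disorder k n)
    (σ : Cube n) : sgHamiltonian (Polynomial.C b * ξ) J σ = √b * sgHamiltonian ξ J σ := by
  unfold sgHamiltonian
  rw [Finset.mul_sum]
  refine Finset.sum_congr rfl fun p _ => ?_
  rw [Polynomial.coeff_C_mul, Real.sqrt_mul hb]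
  ring

lemma rpow_half_sq (m p : ℕ) : ((m : ℝ) ^ ((p : ℝ) / 2)) ^ 2 = (m : ℝ) ^ p := by
  rw [← Real.rpow_natCast, ← Real.rpow_mul (Nat.cast_nonneg m)]
  norm_num

variable {Λ : Measure (Predicate k)}

/-- At order `p + 1` the sum over index tuples is `(n R)^(p+1)`, with `R` the overlap, and the
normalisation `n^(-p)` leaves one factor `n`. Up to this factor the kernel is that of a single
unscaled constraint. -/
lemma sum_sgMatrix_mul (hn : 0 < n) (c : Fin ℓ → ℝ) (X : ι → Fin ℓ → Cube n) (x y : ι) :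
    ∑ q, sgMatrix (k := k) (mixture Λ) c X x q * sgMatrix (mixture Λ) c X y q
      = n * ∑ i, ∑ i', c i * c i' * (mixture Λ).eval (pairOverlap (X x i) (X y i')) := by
  have hn' : (n : ℝ) ≠ 0 := by positivity
  have h1 : ∀ (p : Fin k) (i i' : Fin ℓ),
      (mixture Λ).coeff (p.val + 1) / (n : ℝ) ^ p.val *
        ∑ t : Fin (p.val + 1) → Fin n, ∏ a, (spin (X x i (t a)) * spin (X y i' (t a)))
      = n * ((mixture Λ).coeff (p.val + 1) * pairOverlap (X x i) (X y i') ^ (p.val + 1)) := by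
    intro p i i'
    rw [sum_tuples_prod (fun j => spin (X x i j) * spin (X y i' j)) Finset.univ, pairOverlap]
    simp only [Finset.card_univ, Fintype.card_fin, Nat.sub_self, pow_zero, mul_one, div_pow]
    rw [pow_succ (n : ℝ)]
    field_simp
  have h2 : ∀ (p : Fin k) (t : Fin (p.val + 1) → Fin n),
      sgMatrix (k := k) (mixture Λ) c X x ⟨p, t⟩ * sgMatrix (mixture Λ) c X y ⟨p, t⟩
      = ∑ i, ∑ i', c i * c i' * ((mixture Λ).coeff (p.val + 1) / (n : ℝ) ^ p.val *
        ∏ a, (spin (X x i (t a)) * spin (X y i' (t a)))) := by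
    intro p t
    simp only [sgMatrix]
    rw [mul_mul_mul_comm, ← sq, div_pow, Real.sq_sqrt (coeff_mixture_nonneg p), rpow_half_sq,
      Finset.sum_mul_sum, Finset.mul_sum]
    refine Finset.sum_congr rfl fun i _ => ?_
    rw [Finset.mul_sum]
    refine Finset.sum_congr rfl fun i' _ => ?_
    rw [Finset.prod_mul_distrib]
    ring
  rw [Fintype.sum_sigma]
  simp_rw [h2]
  have h3 : ∀ p : Fin k, ∑ t : Fin (p.val + 1) → Fin n, ∑ i, ∑ i', c i * c i' *
      ((mixture Λ).coeff (p.val + 1) / (n : ℝ) ^ p.val *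
        ∏ a, (spin (X x i (t a)) * spin (X y i' (t a))))
      = ∑ i, ∑ i', c i * c i' *
        (n * ((mixture Λ).coeff (p.val + 1) * pairOverlap (X x i) (X y i') ^ (p.val + 1))) := by
    intro p
    rw [Finset.sum_comm]
    refine Finset.sum_congr rfl fun i _ => ?_
    rw [Finset.sum_comm]
    refine Finset.sum_congr rfl fun i' _ => ?_
    rw [← Finset.mul_sum, ← Finset.mul_sum, h1]
  simp_rw [h3]
  rw [Finset.sum_comm, Finset.mul_sum]
  refine Finset.sum_congr rfl fun i _ => ?_
  rw [Finset.sum_comm, Finset.mul_sum]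
  refine Finset.sum_congr rfl fun i' _ => ?_
  rw [← Finset.mul_sum, ← Finset.mul_sum, sum_coeff_mixture]
  ring

/-- A uniform bound on the entries of `sgMatrix`. -/
def sgBound (ξ : Polynomial ℝ) (ℓ : ℕ) (q : Σ p : Fin k, Fin (p.val + 1) → Fin n) : ℝ :=
  √(ξ.coeff (q.1.val + 1)) / (n : ℝ) ^ ((q.1.val : ℝ) / 2) * ℓ

lemma abs_sgMatrix_le (ξ : Polynomial ℝ) {c : Fin ℓ → ℝ} (hc : ∀ i, c i ∈ Set.Icc (0 : ℝ) 1)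
    (X : ι → Fin ℓ → Cube n) (x : ι) (q : Σ p : Fin k, Fin (p.val + 1) → Fin n) :
    |sgMatrix ξ c X x q| ≤ sgBound ξ ℓ q := by
  unfold sgMatrix sgBound
  rw [abs_mul, abs_of_nonneg (by positivity :
    0 ≤ √(ξ.coeff (q.1.val + 1)) / (n : ℝ) ^ ((q.1.val : ℝ) / 2))]
  refine mul_le_mul_of_nonneg_left ?_ (by positivity)
  refine (Finset.abs_sum_le_sum_abs _ _).trans ?_
  have h : ∀ i ∈ (Finset.univ : Finset (Fin ℓ)),
      |c i * ∏ a, spin (X x i (q.2 a))| ≤ 1 := fun i _ => by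
    rw [abs_mul, Finset.abs_prod]
    simp only [abs_spin, Finset.prod_const_one, mul_one]
    rw [abs_of_nonneg (hc i).1]
    exact (hc i).2
  exact (Finset.sum_le_card_nsmul _ _ _ h).trans (by simp)

/-- The `n^(p+1)` entries of order `p + 1` each carry `n^(-p)`, so the sum is `ℓ² n ξ(1)`, and `ξ(1)
≤ 1` by Plancherel for predicates bounded by one. -/
lemma sum_sgBound_sq_le [IsProbabilityMeasure Λ] (hΛ : ∀ᵐ f ∂Λ, ∀ σ, f σ ∈ Set.Icc (-1 : ℝ) 1)
    (ℓ : ℕ) :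
    ∑ q : (Σ p : Fin k, Fin (p.val + 1) → Fin n), sgBound (mixture Λ) ℓ q ^ 2 ≤ ℓ ^ 2 * n := by
  rcases Nat.eq_zero_or_pos n with rfl | hn
  · have : IsEmpty (Σ p : Fin k, Fin (p.val + 1) → Fin 0) := ⟨fun q => (q.2 0).elim0⟩
    simp
  have hn' : (n : ℝ) ≠ 0 := by positivity
  -- The idle factor `1 ^ (p + 1)` gives the sum over `p` the form of the mixture polynomial
  -- evaluated at `1`.
  have h : ∀ p : Fin k, ∑ t : Fin (p.val + 1) → Fin n,
      sgBound (k := k) (mixture Λ) ℓ ⟨p, t⟩ ^ 2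
      = ℓ ^ 2 * n * ((mixture Λ).coeff (p.val + 1) * 1 ^ (p.val + 1)) := by
    intro p
    simp only [sgBound, mul_pow, div_pow, Real.sq_sqrt (coeff_mixture_nonneg p), rpow_half_sq]
    simp only [Finset.sum_const, Finset.card_univ, Fintype.card_pi, Fintype.card_fin,
      Finset.prod_const, nsmul_eq_mul, Nat.cast_pow]
    rw [pow_succ (n : ℝ)]
    field_simp
    simp
  rw [Fintype.sum_sigma]
  simp_rw [h]
  rw [← Finset.mul_sum, sum_coeff_mixture]
  exact mul_le_of_le_one_right (by positivity) (eval_one_mixture_le hΛ)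

lemma sum_sgMatrix_sq_le [IsProbabilityMeasure Λ]
    (hΛ : ∀ᵐ f ∂Λ, ∀ σ, f σ ∈ Set.Icc (-1 : ℝ) 1) {c : Fin ℓ → ℝ}
    (hc : ∀ i, c i ∈ Set.Icc (0 : ℝ) 1) (X : ι → Fin ℓ → Cube n) (x : ι) :
    ∑ q, sgMatrix (k := k) (mixture Λ) c X x q ^ 2 ≤ ℓ ^ 2 * n := by
  refine (Finset.sum_le_sum fun q _ => ?_).trans (sum_sgBound_sq_le hΛ ℓ)
  rw [← sq_abs]
  exact pow_le_pow_left₀ (abs_nonneg _) (abs_sgMatrix_le _ hc X x q) 2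

end SpinGlass

/-! ### Comparison of a random instance with a spin glass -/

section Instance

variable {k n ℓ : ℕ} {ι : Type*} [Fintype ι] {Λ : Measure (Predicate k)} [IsProbabilityMeasure Λ]

/-- The sum of the centered fields of the constraints of an instance. -/
def instanceField {a : ℝ} (s : ℝ) (c : Fin ℓ → ℝ) (X : ι → Fin ℓ → Cube n)
    (I : CSPInstance k a n) : ι → ℝ := ∑ e, clauseField s c X (I e)

omit [Fintype ι] in
lemma measurable_instanceField {a : ℝ} (s : ℝ) (c : Fin ℓ → ℝ) (X : ι → Fin ℓ → Cube n) :
    Measurable (instanceField s c X : CSPInstance k a n → ι → ℝ) :=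
  Finset.measurable_sum _ fun e _ => (measurable_clauseField s c X).comp (measurable_pi_apply e)

/-- The cost of replacing one constraint by a Gaussian field. -/
def clauseCost (β lam : ℝ) : ℝ := 5184 * Real.exp 2 * β ^ 2 / lam ^ 3

/-- The cost of rounding the number of constraints. -/
def roundingCost (β lam : ℝ) : ℝ :=
  2592 * Real.exp 2 * β ^ 2 / lam ^ 3 + 2 * Real.exp 2 * β / lam ^ 2

variable [Nonempty ι]

/-- The variance `1/(n α²)` makes the covariances equal. The scale `lam = α/ℓ` suits both sides: the
constraint's field is bounded by `2ℓ/α` and the Gaussian one has variance at most `(ℓ/α)²`. -/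
lemma isClose_clauseField (hn : 0 < n) (hΛ : ∀ᵐ f ∂Λ, ∀ σ, f σ ∈ Set.Icc (-1 : ℝ) 1)
    (hℓ : 0 < ℓ) {α β : ℝ} (hα : 0 < α) (hβ : 0 < β) (hβα : 3 * β ≤ α / ℓ) {c : Fin ℓ → ℝ}
    (hc : ∀ i, c i ∈ Set.Icc (0 : ℝ) 1) (X : ι → Fin ℓ → Cube n) {v : NNReal}
    (hv : (v : ℝ) = 1 / (n * α ^ 2)) :
    IsClose β ((clauseLaw Λ n).map (clauseField (1 / α) c X))
      (gaussianFieldLaw (sgMatrix (k := k) (mixture Λ) c X) v) (clauseCost β (α / ℓ)) := by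
  have hn' : (n : ℝ) ≠ 0 := by positivity
  have hℓ' : (ℓ : ℝ) ≠ 0 := by positivity
  refine isClose_of_hasCovariance hβ hβα (isSubexponential_clauseField hn hΛ (by positivity)
    (by positivity) (le_of_eq (by field_simp)) hc X)
    (isSubexponential_gaussianFieldLaw _ v (by positivity) fun x => ?_)
    (hasCovariance_clauseField hn hΛ (1 / α) c X) ?_
  · calc _ ≤ (α / ℓ) ^ 2 * (v * (ℓ ^ 2 * n)) :=
          mul_le_mul_of_nonneg_left (mul_le_mul_of_nonneg_left (sum_sgMatrix_sq_le hΛ hc X x)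
            v.2) (by positivity)
      _ = 1 := by rw [hv]; field_simp
  · have h := hasCovariance_gaussianFieldLaw (sgMatrix (k := k) (mixture Λ) c X) v
    refine ⟨h.mean, fun x y => (h.cov x y).trans ?_⟩
    rw [sum_sgMatrix_mul hn, couplingCovariance, hv]
    field_simp

/-- The `⌊b α n⌋` Gaussian pieces of variance `1/(n α²)` fall short of `b/α` by a fraction of one
piece. The missing piece is compared with a point mass at zero, at the price of `roundingCost`. -/
lemma isClose_instanceField (hn : 0 < n) (hΛ : ∀ᵐ f ∂Λ, ∀ σ, f σ ∈ Set.Icc (-1 : ℝ) 1)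
    (hℓ : 0 < ℓ) {α β b : ℝ} (hα : 0 < α) (hβ : 0 < β) (hβα : 3 * β ≤ α / ℓ) (hb : 0 ≤ b)
    {c : Fin ℓ → ℝ} (hc : ∀ i, c i ∈ Set.Icc (0 : ℝ) 1) (X : ι → Fin ℓ → Cube n) :
    IsClose β ((cspLaw Λ (b * α) n).map (instanceField (1 / α) c X))
      (gaussianFieldLaw (sgMatrix (k := k) (mixture Λ) c X) (Real.toNNReal (b / α)))
      (numClauses (b * α) n * clauseCost β (α / ℓ) + roundingCost β (α / ℓ)) := by
  have hn0 : (0 : ℝ) < n := by exact_mod_cast hn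
  have hℓ0 : (0 : ℝ) < ℓ := by exact_mod_cast hℓ
  have := isProbabilityMeasure_clauseLaw (Λ := Λ) hn
  set B := sgMatrix (k := k) (mixture Λ) c X
  set N := numClauses (b * α) n with hN
  have hN1 : (N : ℝ) ≤ b * α * n := Nat.floor_le (by positivity)
  have hN2 : b * α * n < N + 1 := Nat.lt_floor_add_one _
  set v : NNReal := Real.toNNReal (1 / (n * α ^ 2)) with hv
  have hv' : (v : ℝ) = 1 / (n * α ^ 2) := Real.coe_toNNReal _ (by positivity)
  set w : NNReal := Real.toNNReal ((b * α * n - N) / (n * α ^ 2)) with hw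
  have hw' : (w : ℝ) = (b * α * n - N) / (n * α ^ 2) :=
    Real.coe_toNNReal _ (div_nonneg (by linarith) (by positivity))
  have hsum : (N : NNReal) * v + w = Real.toNNReal (b / α) := by
    rw [← NNReal.coe_inj]
    push_cast
    rw [hv', hw', Real.coe_toNNReal _ (by positivity)]
    field_simp
    ring
  have hind : iIndepFun (fun (e : Fin N) (I : CSPInstance k (b * α) n) =>
      clauseField (1 / α) c X (I e)) (cspLaw Λ (b * α) n) :=
    iIndepFun_pi (X := fun _ => clauseField (1 / α) c X) fun _ =>
      (measurable_clauseField _ c X).aemeasurable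
  have : IsProbabilityMeasure (cspLaw Λ (b * α) n) := by unfold cspLaw; infer_instance
  have hlaw : ∀ e : Fin N, (cspLaw Λ (b * α) n).map (fun I => clauseField (1 / α) c X (I e))
      = (clauseLaw Λ n).map (clauseField (1 / α) c X) := fun e => by
    have h := (measurePreserving_eval (fun _ : Fin N => clauseLaw Λ n) e).map_eq
    rw [← h, Measure.map_map (measurable_clauseField _ c X) (measurable_pi_apply e)]
    rfl
  have hmain := isClose_sum_semigroup hβ
    (Y := fun (e : Fin N) (I : CSPInstance k (b * α) n) => clauseField (1 / α) c X (I e))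
    (fun e => ((measurable_clauseField _ c X).comp (measurable_pi_apply e)).aemeasurable) hind
    (ρ := fun m => gaussianFieldLaw B (m * v)) (ε := clauseCost β (α / ℓ))
    (by simp [gaussianFieldLaw_zero])
    (fun m => by
      rw [gaussianFieldLaw_conv]
      congr 1
      push_cast
      ring)
    (fun e => by
      rw [hlaw]
      simpa using isClose_clauseField hn hΛ hℓ hα hβ hβα hc X hv') Finset.univ
  have hround : IsClose β (Measure.dirac 0) (gaussianFieldLaw B w) (roundingCost β (α / ℓ)) := by
    refine (isSubexponential_gaussianFieldLaw _ w (by positivity) fun x => ?_).isClose_dirac hβ hβα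
      (hasCovariance_gaussianFieldLaw B w)
    calc _ ≤ (α / ℓ) ^ 2 * (w * (ℓ ^ 2 * n)) :=
          mul_le_mul_of_nonneg_left (mul_le_mul_of_nonneg_left (sum_sgMatrix_sq_le hΛ hc X x)
            w.2) (by positivity)
      _ = b * α * n - N := by rw [hw']; field_simp
      _ ≤ 1 := by linarith
  -- On the left, the point mass changes nothing; on the right, the extra piece completes the
  -- variance to `b/α`.
  have h := hmain.conv hβ hround
  have := hmain.prob_left
  rw [Measure.conv_dirac_zero, gaussianFieldLaw_conv, Finset.card_univ, Fintype.card_fin, hsum] at h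
  refine Eq.mp ?_ h
  congr 2
  ext I x
  simp only [instanceField, Finset.sum_apply]
  rfl

/-- `isClose_instanceField` with a bound that vanishes for a zero column `c`. -/
lemma isClose_instanceField' (hn : 0 < n) (hΛ : ∀ᵐ f ∂Λ, ∀ σ, f σ ∈ Set.Icc (-1 : ℝ) 1)
    (hℓ : 0 < ℓ) {α β b : ℝ} (hα : 0 < α) (hβ : 0 < β) (hβα : 3 * β ≤ α / ℓ) (hb : 0 ≤ b)
    {c : Fin ℓ → ℝ} (hc : ∀ i, c i = 0 ∨ c i = 1) (X : ι → Fin ℓ → Cube n) :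
    IsClose β ((cspLaw Λ (b * α) n).map (instanceField (1 / α) c X))
      (gaussianFieldLaw (sgMatrix (k := k) (mixture Λ) c X) (Real.toNNReal (b / α)))
      ((∑ i, c i) * (b * α * n * clauseCost β (α / ℓ) + roundingCost β (α / ℓ))) := by
  have hℓ0 : (0 : ℝ) < ℓ := by exact_mod_cast hℓ
  have hc0 : ∀ i, 0 ≤ c i := fun i => by rcases hc i with h | h <;> rw [h]; norm_num
  have hc1 : ∀ i, c i ∈ Set.Icc (0 : ℝ) 1 := fun i => by
    rcases hc i with h | h <;> rw [h] <;> norm_num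
  -- For a zero column of `A` the density `b` is unconstrained, so the cost has to vanish there. For
  -- a nonzero 0-1 column the sum is at least one, and weighting by it only enlarges the bound.
  by_cases hz : ∀ i, c i = 0
  · obtain rfl : c = 0 := funext hz
    have := isProbabilityMeasure_clauseLaw (Λ := Λ) hn
    have : IsProbabilityMeasure (cspLaw Λ (b * α) n) := by unfold cspLaw; infer_instance
    have h1 : (instanceField (1 / α) 0 X : CSPInstance k (b * α) n → ι → ℝ) = 0 := by
      ext I x
      simp [instanceField, clauseField]
    have h2 : gaussianField (sgMatrix (k := k) (mixture Λ) 0 X) = 0 := by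
      ext J x
      simp [gaussianField, sgMatrix]
    rw [gaussianFieldLaw, h1, h2, map_zero_fun, map_zero_fun]
    simpa using isClose_refl hasLipschitzVariance_dirac.memLp
  · push Not at hz
    obtain ⟨i, hi⟩ := hz
    have hi1 : c i = 1 := (hc i).resolve_left hi
    have hs : 1 ≤ ∑ i, c i := by
      rw [← hi1]
      exact Finset.single_le_sum (fun i _ => hc0 i) (Finset.mem_univ i)
    refine (isClose_instanceField hn hΛ hℓ hα hβ hβα hb hc1 X).mono ?_
    have hN1 : (numClauses (b * α) n : ℝ) ≤ b * α * n := Nat.floor_le (by positivity)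
    have e1 : 0 ≤ clauseCost β (α / ℓ) := by unfold clauseCost; positivity
    have e2 : 0 ≤ roundingCost β (α / ℓ) := by unfold roundingCost; positivity
    calc _ ≤ b * α * n * clauseCost β (α / ℓ) + roundingCost β (α / ℓ) := by gcongr
      _ ≤ _ := le_mul_of_one_le_left (by positivity) hs

/-- The uncentered field of a constraint. -/
def rawClauseField (s : ℝ) (c : Fin ℓ → ℝ) (X : ι → Fin ℓ → Cube n) (e : Clause k n) (x : ι) : ℝ :=
  s * ∑ i, c i * e.value (X x i)

omit [Fintype ι] [Nonempty ι] in
lemma measurable_rawClauseField (s : ℝ) (c : Fin ℓ → ℝ) (X : ι → Fin ℓ → Cube n) :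
    Measurable (rawClauseField s c X : Clause k n → ι → ℝ) :=
  measurable_pi_lambda _ fun _ => (Finset.measurable_sum _ fun _ _ =>
    (measurable_clause_value _).const_mul _).const_mul _

/-- The sum of the uncentered fields of the constraints of an instance. -/
def rawInstanceField {a : ℝ} (s : ℝ) (c : Fin ℓ → ℝ) (X : ι → Fin ℓ → Cube n)
    (I : CSPInstance k a n) : ι → ℝ := ∑ e, rawClauseField s c X (I e)

omit [Fintype ι] [Nonempty ι] in
lemma measurable_rawInstanceField {a : ℝ} (s : ℝ) (c : Fin ℓ → ℝ) (X : ι → Fin ℓ → Cube n) :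
    Measurable (rawInstanceField s c X : CSPInstance k a n → ι → ℝ) :=
  Finset.measurable_sum _ fun e _ => (measurable_rawClauseField s c X).comp (measurable_pi_apply e)

omit [Nonempty ι] in
-- Each constraint contributes an independent field of sup norm at most `s ℓ`. The uncentered field
-- is used, so that the fluctuations of the constants `f̂(∅)` are covered too.
lemma hasLipschitzVariance_rawInstanceField (hn : 0 < n)
    (hΛ : ∀ᵐ f ∂Λ, ∀ σ, f σ ∈ Set.Icc (-1 : ℝ) 1) {s : ℝ} (hs : 0 ≤ s) {c : Fin ℓ → ℝ}
    (hc : ∀ i, c i ∈ Set.Icc (0 : ℝ) 1) (X : ι → Fin ℓ → Cube n) (a : ℝ) :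
    HasLipschitzVariance ((cspLaw Λ a n).map (rawInstanceField s c X))
      (numClauses a n * (s * ℓ) ^ 2) := by
  have := isProbabilityMeasure_clauseLaw (Λ := Λ) hn
  have : IsProbabilityMeasure (cspLaw Λ a n) := by unfold cspLaw; infer_instance
  have hm := measurable_rawClauseField (k := k) s c X
  have hb : ∀ᵐ e ∂clauseLaw Λ n, ‖rawClauseField s c X e‖ ≤ s * ℓ := by
    filter_upwards [ae_clauseLaw hn hΛ] with e he
    refine (pi_norm_le_iff_of_nonneg (by positivity)).2 fun x => ?_
    rw [rawClauseField, Real.norm_eq_abs, abs_mul, abs_of_nonneg hs]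
    refine mul_le_mul_of_nonneg_left ?_ hs
    refine (Finset.abs_sum_le_sum_abs _ _).trans ?_
    have h : ∀ i ∈ (Finset.univ : Finset (Fin ℓ)), |c i * e.value (X x i)| ≤ 1 := fun i _ => by
      rw [abs_mul, abs_of_nonneg (hc i).1]
      exact mul_le_one₀ (hc i).2 (abs_nonneg _) (abs_le.2 (he _))
    exact (Finset.sum_le_card_nsmul _ _ _ h).trans (by simp)
  have hmem : MemLp (rawClauseField s c X) 2 (clauseLaw Λ n) :=
    MemLp.of_bound hm.aestronglyMeasurable _ hb
  have hone : HasLipschitzVariance ((clauseLaw Λ n).map (rawClauseField s c X)) ((s * ℓ) ^ 2) := by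
    have := Measure.isProbabilityMeasure_map (μ := clauseLaw Λ n) hm.aemeasurable
    refine hasLipschitzVariance_of_memLp ?_ ?_
    · rw [memLp_map_measure_iff aestronglyMeasurable_id hm.aemeasurable]
      exact hmem
    · rw [integral_map hm.aemeasurable (Continuous.aestronglyMeasurable (by fun_prop))]
      have hmn : MemLp (fun e => ‖rawClauseField s c X e‖) 2 (clauseLaw Λ n) := hmem.norm
      refine (integral_mono_ae hmn.integrable_sq (integrable_const ((s * ℓ) ^ 2)) ?_).trans
        (by simp)
      filter_upwards [hb] with e he
      exact pow_le_pow_left₀ (norm_nonneg _) he 2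
  have hind : iIndepFun (fun (e : Fin (numClauses a n)) (I : CSPInstance k a n) =>
      rawClauseField s c X (I e)) (cspLaw Λ a n) :=
    iIndepFun_pi (X := fun _ => rawClauseField s c X) fun _ => hm.aemeasurable
  have h := hasLipschitzVariance_sum
    (Y := fun (e : Fin (numClauses a n)) (I : CSPInstance k a n) => rawClauseField s c X (I e))
    (fun e => (hm.comp (measurable_pi_apply e)).aemeasurable) hind
    (v := fun _ => (s * ℓ) ^ 2) (fun e => by
      have h := (measurePreserving_eval (fun _ : Fin (numClauses a n) => clauseLaw Λ n) e).map_eq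
      rw [← h, Measure.map_map hm (measurable_pi_apply e)] at hone
      exact hone) Finset.univ
  rw [Finset.sum_const, Finset.card_univ, Fintype.card_fin, nsmul_eq_mul] at h
  refine Eq.mp ?_ h
  congr 2
  ext I x
  simp [rawInstanceField]

end Instance

/-! ### Maxima of random fields -/

section Maximum

variable {ι : Type*} [Fintype ι] [Nonempty ι]

lemma lipschitzWith_iSup : LipschitzWith 1 fun h : ι → ℝ => ⨆ x, h x := by
  refine LipschitzWith.of_le_add fun g h => ?_
  refine ciSup_le fun x => ?_
  have h1 : h x ≤ ⨆ x, h x := le_ciSup (Set.finite_range h).bddAbove x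
  have h2 := (le_abs_self _).trans (abs_apply_le_norm (g - h) x)
  rw [dist_eq_norm]
  simp only [Pi.sub_apply] at h2
  linarith

lemma iSup_add_const (h : ι → ℝ) (w : ℝ) : ⨆ x, (h x + w) = (⨆ x, h x) + w :=
  ((OrderIso.addRight w).map_ciSup (Set.finite_range h).bddAbove).symm

variable {Ω : Type*} [MeasurableSpace Ω] {P : Measure Ω} [IsProbabilityMeasure P]

omit [IsProbabilityMeasure P] in
lemma memLp_iSup {Y : Ω → ι → ℝ} (hY : AEMeasurable Y P) {v : ℝ}
    (h : HasLipschitzVariance (P.map Y) v) : MemLp (fun ω => ⨆ x, Y ω x) 2 P := by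
  have := h.prob
  have h1 := memLp_of_lipschitz h.memLp (lipschitzWith_iSup (ι := ι))
  exact (memLp_map_measure_iff h1.1 hY).1 h1

omit [IsProbabilityMeasure P] in
lemma variance_iSup_le {Y : Ω → ι → ℝ} (hY : AEMeasurable Y P) {v : ℝ}
    (h : HasLipschitzVariance (P.map Y) v) : Var[fun ω => ⨆ x, Y ω x; P] ≤ v := by
  have h1 := h.le _ (lipschitzWith_iSup (ι := ι))
  rwa [variance_map lipschitzWith_iSup.continuous.aemeasurable hY] at h1

/-- Closeness of smooth maxima implies closeness of expected maxima. -/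
lemma IsClose.abs_integral_iSup_sub_le {β : ℝ} (hβ : 0 < β) {Y Z : Ω → ι → ℝ}
    (hY : AEMeasurable Y P) (hZ : AEMeasurable Z P) {ε : ℝ}
    (h : IsClose β (P.map Y) (P.map Z) ε) :
    |∫ ω, ⨆ x, Y ω x ∂P - ∫ ω, ⨆ x, Z ω x ∂P| ≤ Real.log (Fintype.card ι) / β + ε := by
  have := h.prob_left
  have := h.prob_right
  have key : ∀ {U : Ω → ι → ℝ}, AEMeasurable U P → ∀ [IsProbabilityMeasure (P.map U)],
      MemLp (id : (ι → ℝ) → ι → ℝ) 2 (P.map U) →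
      ∫ ω, ⨆ x, U ω x ∂P ≤ ∫ u, logSumExp β (0 + u) ∂(P.map U) ∧
      ∫ u, logSumExp β (0 + u) ∂(P.map U) ≤
        ∫ ω, ⨆ x, U ω x ∂P + Real.log (Fintype.card ι) / β := by
    intro U hU _ hm
    have i1 : Integrable (fun ω => ⨆ x, U ω x) P :=
      ((memLp_map_measure_iff (memLp_of_lipschitz hm lipschitzWith_iSup).1 hU).1
        (memLp_of_lipschitz hm lipschitzWith_iSup)).integrable one_le_two
    have i2 := integrable_logSumExp_add hβ hm 0
    have i3 : Integrable (fun ω => logSumExp β (0 + U ω)) P :=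
      (integrable_map_measure i2.1 hU).1 i2
    rw [integral_map hU i2.1]
    constructor
    · refine integral_mono i1 i3 fun ω => ?_
      simp only [zero_add]
      exact iSup_le_logSumExp hβ _
    · have h := integral_mono i3 (i1.add (integrable_const (Real.log (Fintype.card ι) / β)))
        fun ω => by
          simp only [zero_add, Pi.add_apply]
          exact logSumExp_le_iSup_add hβ (U ω)
      simp only [Pi.add_apply] at h
      rw [integral_add i1 (integrable_const _)] at h
      simpa using h
  have a := key hY h.memLp_left
  have b := key hZ h.memLp_right
  have c := abs_le.1 (h.le 0)
  exact abs_le.2 ⟨by linarith [a.1, a.2, b.1, b.2], by linarith [a.1, a.2, b.1, b.2]⟩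

end Maximum

/-! ### Coupled models -/

section Coupled

variable {k ℓ ℓ' n : ℕ} {ι : Type*} {A : Matrix (Fin ℓ) (Fin ℓ') ℝ} {b : Fin ℓ' → ℝ}

lemma IsCoupling.mem_Icc (h : IsCoupling A b) (i : Fin ℓ) (j : Fin ℓ') :
    A i j ∈ Set.Icc (0 : ℝ) 1 := by
  rcases h.zero_one i j with h | h <;> rw [h] <;> norm_num

/-- The number of observed models that use the `j`-th hidden model. -/
def colSum (A : Matrix (Fin ℓ) (Fin ℓ') ℝ) (j : Fin ℓ') : ℝ := ∑ i, A i j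

lemma IsCoupling.colSum_nonneg (h : IsCoupling A b) (j : Fin ℓ') : 0 ≤ colSum A j :=
  Finset.sum_nonneg fun i _ => (h.mem_Icc i j).1

/-- Double counting of the row identities `(A b)_i = 1`. This keeps the leading error free of `ℓ'`
and of the individual `b_j`. -/
lemma IsCoupling.sum_colSum_mul (h : IsCoupling A b) : ∑ j, colSum A j * b j = ℓ := by
  simp only [colSum, Finset.sum_mul]
  rw [Finset.sum_comm]
  have h1 : ∀ i, ∑ j, A i j * b j = 1 := fun i => by
    have := h.mulVec_eq_one i
    simpa [Matrix.mulVec, dotProduct] using this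
  simp [h1]

lemma cspGrand_eq (α : ℝ) (A : Matrix (Fin ℓ) (Fin ℓ') ℝ) (b : Fin ℓ' → ℝ)
    (I : (j : Fin ℓ') → CSPInstance k (b j * α) n) (X : ι → Fin ℓ → Cube n) (x : ι) :
    cspGrand α A b I (X x) = ∑ j, rawInstanceField (1 / α) (fun i => A i j) X (I j) x := by
  simp only [cspGrand, grandHamiltonian, Matrix.mulVec, dotProduct, cspHamiltonian,
    rawInstanceField, rawClauseField, Finset.sum_apply]
  rw [Finset.sum_comm]
  refine Finset.sum_congr rfl fun j _ => ?_
  rw [← Finset.mul_sum, Finset.sum_comm, Finset.mul_sum]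
  refine Finset.sum_congr rfl fun i _ => ?_
  rw [Finset.mul_sum, Finset.mul_sum, Finset.mul_sum]
  refine Finset.sum_congr rfl fun e _ => ?_
  ring

/-- The part of an instance that does not depend on the assignment. -/
def instanceConst {a : ℝ} (s : ℝ) (I : CSPInstance k a n) : ℝ :=
  s * ∑ e, fourierCoefficient (I e).1 ∅

lemma rawInstanceField_eq {a : ℝ} (s : ℝ) (c : Fin ℓ → ℝ) (X : ι → Fin ℓ → Cube n)
    (I : CSPInstance k a n) (x : ι) :
    rawInstanceField s c X I x
      = instanceField s c X I x + (∑ i, c i) * instanceConst s I := by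
  simp only [rawInstanceField, instanceField, instanceConst, rawClauseField, clauseField,
    centeredValue, Finset.sum_apply]
  rw [mul_left_comm, Finset.mul_sum (s := Finset.univ) (a := ∑ i, c i), Finset.mul_sum,
    ← Finset.sum_add_distrib]
  refine Finset.sum_congr rfl fun e _ => ?_
  simp only [mul_sub, Finset.sum_sub_distrib, ← Finset.sum_mul]
  ring

lemma sgGrand_eq {ξ : Polynomial ℝ} {α : ℝ} (hb : ∀ j, 0 ≤ b j)
    (J : Fin ℓ' → Disorder k n) (X : ι → Fin ℓ → Cube n) (x : ι) :
    1 / √α * sgGrand ξ A b J (X x)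
      = ∑ j, √(b j / α) * gaussianField (sgMatrix ξ (fun i => A i j) X) (J j) x := by
  simp only [sgGrand, grandHamiltonian, Matrix.mulVec, dotProduct, gaussianField_sgMatrix]
  rw [Finset.sum_comm, Finset.mul_sum]
  refine Finset.sum_congr rfl fun j _ => ?_
  rw [Finset.mul_sum, Finset.mul_sum]
  refine Finset.sum_congr rfl fun i _ => ?_
  rw [sgHamiltonian_C_mul (hb j), Real.sqrt_div (hb j)]
  ring

variable {Λ : Measure (Predicate k)} [IsProbabilityMeasure Λ] {α : ℝ}
  {Ω : Type*} [MeasurableSpace Ω] {P : Measure Ω} [IsProbabilityMeasure P]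
  {I : (j : Fin ℓ') → Ω → CSPInstance k (b j * α) n} {J : Fin ℓ' → Ω → Disorder k n}

omit [IsProbabilityMeasure Λ] [IsProbabilityMeasure P] in
lemma IsHiddenCSP.map_comp (hI : IsHiddenCSP Λ α b P I) {E : Type*} [MeasurableSpace E]
    {g : (j : Fin ℓ') → CSPInstance k (b j * α) n → E} (hg : ∀ j, Measurable (g j)) (j : Fin ℓ') :
    P.map (fun ω => g j (I j ω)) = (cspLaw Λ (b j * α) n).map (g j) := by
  rw [← (hI.law j).map_eq, AEMeasurable.map_map_of_aemeasurable (hg j).aemeasurable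
    (hI.law j).aemeasurable]
  rfl

omit [IsProbabilityMeasure Λ] [IsProbabilityMeasure P] in
lemma IsHiddenCSP.aemeasurable_comp (hI : IsHiddenCSP Λ α b P I) {E : Type*} [MeasurableSpace E]
    {g : (j : Fin ℓ') → CSPInstance k (b j * α) n → E} (hg : ∀ j, Measurable (g j)) (j : Fin ℓ') :
    AEMeasurable (fun ω => g j (I j ω)) P :=
  (hg j).comp_aemeasurable (hI.law j).aemeasurable

omit [IsProbabilityMeasure P] in
lemma IsHiddenDisorder.map_smul_gaussianField (hJ : IsHiddenDisorder P J)
    (B : Fin ℓ' → ι → (Σ p : Fin k, Fin (p.val + 1) → Fin n) → ℝ) (c : Fin ℓ' → ℝ)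
    (j : Fin ℓ') :
    P.map (fun ω => c j • gaussianField (B j) (J j ω))
      = gaussianFieldLaw (B j) (Real.toNNReal (c j ^ 2)) := by
  have hm : Measurable fun K : Disorder k n => c j • gaussianField (B j) K :=
    (measurable_gaussianField (B j)).const_smul (c j)
  rw [← gaussianFieldLaw_map_smul]
  change _ = (disorderLaw k n).map _
  rw [← (hJ.law j).map_eq, AEMeasurable.map_map_of_aemeasurable hm.aemeasurable
    (hJ.law j).aemeasurable]
  rfl

omit [IsProbabilityMeasure P] in
lemma IsHiddenDisorder.aemeasurable_smul_gaussianField (hJ : IsHiddenDisorder P J)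
    (B : Fin ℓ' → ι → (Σ p : Fin k, Fin (p.val + 1) → Fin n) → ℝ) (c : Fin ℓ' → ℝ)
    (j : Fin ℓ') : AEMeasurable (fun ω => c j • gaussianField (B j) (J j ω)) P :=
  ((measurable_gaussianField (B j)).const_smul (c j)).comp_aemeasurable (hJ.law j).aemeasurable

omit [IsProbabilityMeasure P] in
lemma IsHiddenDisorder.iIndepFun_smul_gaussianField (hJ : IsHiddenDisorder P J)
    (B : Fin ℓ' → ι → (Σ p : Fin k, Fin (p.val + 1) → Fin n) → ℝ) (c : Fin ℓ' → ℝ) :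
    iIndepFun (fun j ω => c j • gaussianField (B j) (J j ω)) P :=
  hJ.indep.comp (fun j K => c j • gaussianField (B j) K)
    fun j => (measurable_gaussianField (B j)).const_smul (c j)

lemma integral_instanceConst (hn : 0 < n) (hΛ : ∀ᵐ f ∂Λ, ∀ σ, f σ ∈ Set.Icc (-1 : ℝ) 1)
    (s a : ℝ) :
    Integrable (instanceConst s) (cspLaw Λ a n) ∧
      ∫ I, instanceConst s I ∂cspLaw Λ a n = s * (numClauses a n * meanValue Λ) := by
  have := isProbabilityMeasure_clauseLaw (Λ := Λ) hn
  have hint : Integrable (fun e : Clause k n => fourierCoefficient e.1 ∅) (clauseLaw Λ n) := by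
    refine integrable_of_ae_bound
      ((measurable_fourierCoefficient ∅).comp measurable_fst).aestronglyMeasurable (c := 1) ?_
    filter_upwards [ae_clauseLaw hn hΛ] with e he using abs_fourierCoefficient_le he ∅
  have hval : ∫ e : Clause k n, fourierCoefficient e.1 ∅ ∂clauseLaw Λ n = meanValue Λ := by
    have : Nonempty (Fin n) := ⟨⟨0, hn⟩⟩
    have h1 := isProbabilityMeasure_uniformOn (Ω := Fin k → Fin n) Set.finite_univ
      Set.univ_nonempty
    have h2 := isProbabilityMeasure_uniformOn (Ω := Cube k) Set.finite_univ Set.univ_nonempty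
    unfold clauseLaw
    rw [integral_fun_fst (fun f : Predicate k => fourierCoefficient f ∅)]
    simp [meanValue]
  have hi : ∀ e : Fin (numClauses a n),
      Integrable (fun I : CSPInstance k a n => fourierCoefficient (I e).1 ∅) (cspLaw Λ a n) :=
    fun e => integrable_comp_eval (X := fun _ => Clause k n) (μ := fun _ => clauseLaw Λ n)
      (i := e) hint
  have hv : ∀ e : Fin (numClauses a n),
      ∫ I : CSPInstance k a n, fourierCoefficient (I e).1 ∅ ∂cspLaw Λ a n = meanValue Λ :=
    fun e => (integral_comp_eval (X := fun _ => Clause k n) (μ := fun _ => clauseLaw Λ n)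
      (i := e) hint.1).trans hval
  refine ⟨(integrable_finsetSum _ fun e _ => hi e).const_mul s, ?_⟩
  unfold instanceConst
  rw [integral_const_mul, integral_finsetSum _ fun e _ => hi e]
  simp [hv]

lemma measurable_instanceConst (s a : ℝ) :
    Measurable (instanceConst s : CSPInstance k a n → ℝ) :=
  (Finset.measurable_sum _ fun e _ => (measurable_fourierCoefficient ∅).comp
    (measurable_fst.comp (measurable_pi_apply e))).const_mul s

variable [Fintype ι]

omit [Fintype ι] [IsProbabilityMeasure Λ] [IsProbabilityMeasure P] in
lemma IsHiddenCSP.aemeasurable_rawInstanceField (hI : IsHiddenCSP Λ α b P I)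
    (X : ι → Fin ℓ → Cube n) :
    AEMeasurable (∑ j, fun ω => rawInstanceField (1 / α) (fun i => A i j) X (I j ω)) P :=
  Finset.aemeasurable_sum _ fun j _ =>
    hI.aemeasurable_comp (fun _ => measurable_rawInstanceField _ _ _) j

lemma IsHiddenCSP.hasLipschitzVariance (hI : IsHiddenCSP Λ α b P I) (hn : 0 < n)
    (hΛ : ∀ᵐ f ∂Λ, ∀ σ, f σ ∈ Set.Icc (-1 : ℝ) 1) (hα : 0 < α) (hA : IsCoupling A b)
    (X : ι → Fin ℓ → Cube n) :
    HasLipschitzVariance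
      (P.map (∑ j, fun ω => rawInstanceField (1 / α) (fun i => A i j) X (I j ω)))
      (∑ j, numClauses (b j * α) n * (1 / α * ℓ) ^ 2) := by
  have hm : ∀ j, Measurable (rawInstanceField (1 / α) (fun i => A i j) X :
      CSPInstance k (b j * α) n → ι → ℝ) := fun j => measurable_rawInstanceField _ _ _
  refine hasLipschitzVariance_sum (hI.aemeasurable_comp hm) (hI.indep.comp _ hm) (fun j => ?_) _
  rw [hI.map_comp hm]
  exact hasLipschitzVariance_rawInstanceField hn hΛ (by positivity) (fun i => hA.mem_Icc i j) X _

lemma IsHiddenDisorder.hasLipschitzVariance [Nonempty ι] (hJ : IsHiddenDisorder P J)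
    (hΛ : ∀ᵐ f ∂Λ, ∀ σ, f σ ∈ Set.Icc (-1 : ℝ) 1) (hα : 0 < α) (hA : IsCoupling A b)
    (X : ι → Fin ℓ → Cube n) :
    HasLipschitzVariance
      (P.map (∑ j, fun ω => √(b j / α) •
        gaussianField (sgMatrix (mixture Λ) (fun i => A i j) X) (J j ω)))
      (∑ j, b j / α * (ℓ ^ 2 * n)) := by
  have hb : ∀ j, 0 ≤ b j / α := fun j => div_nonneg (hA.nonneg j) hα.le
  refine hasLipschitzVariance_sum (hJ.aemeasurable_smul_gaussianField _ fun j => √(b j / α))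
    (hJ.iIndepFun_smul_gaussianField _ fun j => √(b j / α)) (fun j => ?_) _
  rw [hJ.map_smul_gaussianField (fun j => sgMatrix (mixture Λ) (fun i => A i j) X)
    fun j => √(b j / α)]
  have h := hasLipschitzVariance_gaussianFieldLaw
    (sgMatrix (k := k) (mixture Λ) (fun i => A i j) X) (Real.toNNReal (√(b j / α) ^ 2))
    (abs_sgMatrix_le _ (fun i => hA.mem_Icc i j) X)
  refine ⟨h.prob, h.memLp, fun g hg => (h.le g hg).trans ?_⟩
  rw [← Finset.mul_sum, Real.sq_sqrt (hb j), Real.coe_toNNReal _ (hb j)]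
  exact mul_le_mul_of_nonneg_left (sum_sgBound_sq_le hΛ ℓ) (hb j)

/-- The centered grand Hamiltonians of the two coupled models are close. -/
lemma isClose_coupled [Nonempty ι] (hI : IsHiddenCSP Λ α b P I) (hJ : IsHiddenDisorder P J)
    (hn : 0 < n) (hΛ : ∀ᵐ f ∂Λ, ∀ σ, f σ ∈ Set.Icc (-1 : ℝ) 1) (hℓ : 0 < ℓ) {β : ℝ} (hα : 0 < α)
    (hβ : 0 < β) (hβα : 3 * β ≤ α / ℓ) (hA : IsCoupling A b) (X : ι → Fin ℓ → Cube n) :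
    IsClose β (P.map (∑ j, fun ω => instanceField (1 / α) (fun i => A i j) X (I j ω)))
      (P.map (∑ j, fun ω => √(b j / α) •
        gaussianField (sgMatrix (mixture Λ) (fun i => A i j) X) (J j ω)))
      (ℓ * (α * n * clauseCost β (α / ℓ)) + (∑ j, colSum A j) * roundingCost β (α / ℓ)) := by
  have hb : ∀ j, 0 ≤ b j / α := fun j => div_nonneg (hA.nonneg j) hα.le
  have hm : ∀ j, Measurable (instanceField (1 / α) (fun i => A i j) X :
      CSPInstance k (b j * α) n → ι → ℝ) := fun j => measurable_instanceField _ _ _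
  have h := isClose_sum hβ (hI.aemeasurable_comp hm) (hI.indep.comp _ hm)
    (hJ.aemeasurable_smul_gaussianField (fun j => sgMatrix (mixture Λ) (fun i => A i j) X)
      fun j => √(b j / α))
    (hJ.iIndepFun_smul_gaussianField (fun j => sgMatrix (mixture Λ) (fun i => A i j) X)
      fun j => √(b j / α))
    (ε := fun j => colSum A j *
      (b j * α * n * clauseCost β (α / ℓ) + roundingCost β (α / ℓ))) (fun j => by
      rw [hI.map_comp hm, hJ.map_smul_gaussianField
        (fun j => sgMatrix (mixture Λ) (fun i => A i j) X) fun j => √(b j / α),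
        Real.sq_sqrt (hb j)]
      exact isClose_instanceField' hn hΛ hℓ hα hβ hβα (hA.nonneg j)
        (fun i => hA.zero_one i j) X) Finset.univ
  refine h.mono (le_of_eq ?_)
  rw [← hA.sum_colSum_mul, Finset.sum_mul, Finset.sum_mul, ← Finset.sum_add_distrib]
  exact Finset.sum_congr rfl fun j _ => by ring

omit [IsProbabilityMeasure P] in
/-- The total contribution of the parts of the instances that do not depend on the assignment. -/
lemma abs_integral_const_sub_le (hI : IsHiddenCSP Λ α b P I) (hn : 0 < n)
    (hΛ : ∀ᵐ f ∂Λ, ∀ σ, f σ ∈ Set.Icc (-1 : ℝ) 1) (hα : 0 < α) (hA : IsCoupling A b) :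
    Integrable (fun ω => ∑ j, colSum A j * instanceConst (1 / α) (I j ω)) P ∧
      |∫ ω, ∑ j, colSum A j * instanceConst (1 / α) (I j ω) ∂P - ℓ * n * meanValue Λ|
        ≤ (∑ j, colSum A j) / α := by
  have hm : ∀ j, Measurable (instanceConst (1 / α) : CSPInstance k (b j * α) n → ℝ) :=
    fun j => measurable_instanceConst _ _
  have hi : ∀ j, Integrable (fun ω => instanceConst (1 / α) (I j ω)) P := fun j => by
    have h := (integral_instanceConst (k := k) hn hΛ (1 / α) (b j * α)).1
    rw [← (hI.law j).map_eq] at h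
    exact (integrable_map_measure h.1 (hI.law j).aemeasurable).1 h
  have hv : ∀ j, ∫ ω, instanceConst (1 / α) (I j ω) ∂P
      = 1 / α * (numClauses (b j * α) n * meanValue Λ) := fun j => by
    rw [← (integral_instanceConst (k := k) hn hΛ (1 / α) (b j * α)).2, ← (hI.law j).map_eq,
      integral_map (hI.law j).aemeasurable (hm j).aestronglyMeasurable]
  refine ⟨integrable_finsetSum _ fun j _ => (hi j).const_mul _, ?_⟩
  rw [integral_finsetSum _ fun j _ => (hi j).const_mul _]
  simp_rw [integral_const_mul, hv]
  have hmean : |meanValue Λ| ≤ 1 := by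
    unfold meanValue
    refine (abs_integral_le_integral_abs).trans ?_
    refine (integral_mono_ae (integrable_fourierCoefficient hΛ ∅).abs (integrable_const 1) ?_).trans
      (by simp)
    filter_upwards [hΛ] with f hf using abs_fourierCoefficient_le hf ∅
  have e : ∑ j, colSum A j * (1 / α * (numClauses (b j * α) n * meanValue Λ))
      - ℓ * n * meanValue Λ
      = ∑ j, colSum A j / α * ((numClauses (b j * α) n - b j * α * n) * meanValue Λ) := by
    rw [← hA.sum_colSum_mul, Finset.sum_mul, Finset.sum_mul, ← Finset.sum_sub_distrib]
    refine Finset.sum_congr rfl fun j _ => ?_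
    field_simp
  rw [e, Finset.sum_div]
  refine (Finset.abs_sum_le_sum_abs _ _).trans (Finset.sum_le_sum fun j _ => ?_)
  have hb := hA.nonneg j
  have hN1 : (numClauses (b j * α) n : ℝ) ≤ b j * α * n := Nat.floor_le (by positivity)
  have hN2 : b j * α * n < numClauses (b j * α) n + 1 := Nat.lt_floor_add_one _
  have hc : 0 ≤ colSum A j / α := div_nonneg (hA.colSum_nonneg j) hα.le
  rw [abs_mul, abs_of_nonneg hc, abs_mul]
  refine mul_le_of_le_one_right hc (mul_le_one₀ ?_ (abs_nonneg _) hmean)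
  exact abs_le.2 ⟨by linarith, by linarith⟩

end Coupled

/-! ### Comparison of the normalized maxima -/

section Comparison

variable {k ℓ ℓ' n : ℕ} {A : Matrix (Fin ℓ) (Fin ℓ') ℝ} {b : Fin ℓ' → ℝ}

lemma normalizedMax_eq (S : Set (overlapPolytope ℓ)) (H : (Fin ℓ → Cube n) → ℝ) :
    normalizedMax S H = (⨆ x : overlapPreimage S n, H x) / (ℓ * n) := by
  unfold normalizedMax
  simp_rw [div_eq_mul_inv]
  rw [Real.iSup_mul_of_nonneg (by positivity)]

lemma normalizedMax_dim_zero (S : Set (overlapPolytope ℓ)) (H : (Fin ℓ → Cube 0) → ℝ) :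
    normalizedMax S H = 0 := by
  simp [normalizedMax_eq]

lemma normalizedMax_of_empty {S : Set (overlapPolytope ℓ)} (hS : ¬(overlapPreimage S n).Nonempty)
    (H : (Fin ℓ → Cube n) → ℝ) : normalizedMax S H = 0 := by
  have : IsEmpty (overlapPreimage S n) :=
    Set.isEmpty_coe_sort.2 (Set.not_nonempty_iff_eq_empty.1 hS)
  simp [normalizedMax]

/-- There are at most `2^(ℓ n)` configurations, and `log 2 < 1`. -/
lemma log_card_le (S : Set (overlapPolytope ℓ)) [Fintype (overlapPreimage S n)]
    [Nonempty (overlapPreimage S n)] :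
    Real.log (Fintype.card (overlapPreimage S n)) ≤ ℓ * n := by
  have h1 : Fintype.card (overlapPreimage S n) ≤ 2 ^ (n * ℓ) := by
    refine (Fintype.card_subtype_le (· ∈ overlapPreimage S n) |>.trans_eq' ?_).trans_eq ?_
    · exact Fintype.card_congr (Equiv.refl _)
    · simp [Fintype.card_units_int, ← pow_mul]
  have h2 : (0 : ℝ) < Fintype.card (overlapPreimage S n) := by exact_mod_cast Fintype.card_pos
  calc Real.log (Fintype.card (overlapPreimage S n)) ≤ Real.log (2 ^ (n * ℓ)) :=
        Real.log_le_log h2 (by exact_mod_cast h1)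
    _ = (n * ℓ : ℕ) * Real.log 2 := by rw [Real.log_pow]
    _ ≤ (n * ℓ : ℕ) * 1 := by
        refine mul_le_mul_of_nonneg_left ?_ (Nat.cast_nonneg _)
        linarith [Real.log_two_lt_d9]
    _ = ℓ * n := by push_cast; ring

/-- The constant of the term of order `α^{-2/3}`. -/
def errorConst (ℓ : ℕ) : ℝ := 1 + 5184 * Real.exp 2 * ℓ ^ 3

lemma le_errorConst (ℓ : ℕ) : 1 ≤ errorConst ℓ ∧ 27 * (ℓ : ℝ) ^ 3 ≤ errorConst ℓ := by
  have h : (1 : ℝ) ≤ Real.exp 2 := Real.one_le_exp (by norm_num)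
  have h3 : (0 : ℝ) ≤ (ℓ : ℝ) ^ 3 := by positivity
  unfold errorConst
  constructor <;> nlinarith [mul_le_mul_of_nonneg_right h h3]

/-- For `β = α^(2/3)` and `lam = α/ℓ`, the condition `3β ≤ lam` of the expansion says `27 ℓ³ ≤ α`,
which the lower bound on `α` guarantees. -/
lemma three_mul_rpow_le {α : ℝ} (hℓ : 0 < ℓ) (hα : errorConst ℓ ≤ α) :
    3 * α ^ (2 / 3 : ℝ) ≤ α / ℓ := by
  have hℓ0 : (0 : ℝ) < ℓ := by exact_mod_cast hℓ
  have h1 := le_errorConst ℓ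
  have hα0 : 0 < α := by linarith
  have h2 : 3 * (ℓ : ℝ) ≤ α ^ (1 / 3 : ℝ) := by
    refine le_of_pow_le_pow_left₀ (n := 3) (by norm_num) (by positivity) ?_
    rw [← Real.rpow_natCast (α ^ (1 / 3 : ℝ)), ← Real.rpow_mul hα0.le]
    norm_num
    nlinarith
  have h3 : α ^ (1 / 3 : ℝ) * α ^ (2 / 3 : ℝ) = α := by
    rw [← Real.rpow_add hα0]; norm_num
  rw [le_div_iff₀ hℓ0]
  calc 3 * α ^ (2 / 3 : ℝ) * ℓ = 3 * ℓ * α ^ (2 / 3 : ℝ) := by ring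
    _ ≤ α ^ (1 / 3 : ℝ) * α ^ (2 / 3 : ℝ) := by gcongr
    _ = α := h3

/-- Per unit of `ℓ n`, the smoothing error is `1/β` and the exchange error is a multiple of `ℓ³
β²/α²`; at `β = α^(2/3)` both have order `α^(-2/3)`. -/
lemma error_terms_eq {α : ℝ} (hℓ : 0 < ℓ) (hα : 0 < α) :
    1 / α ^ (2 / 3 : ℝ) + α * clauseCost (α ^ (2 / 3 : ℝ)) (α / ℓ)
      = errorConst ℓ * α ^ (-(2 / 3) : ℝ) := by
  have hℓ0 : (ℓ : ℝ) ≠ 0 := by positivity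
  have hβ : 0 < α ^ (2 / 3 : ℝ) := by positivity
  have h3 : (α ^ (2 / 3 : ℝ)) ^ 3 = α ^ 2 := by
    rw [← Real.rpow_natCast, ← Real.rpow_mul hα.le, ← Real.rpow_natCast]; norm_num
  rw [Real.rpow_neg hα.le, clauseCost, errorConst]
  field_simp
  rw [h3]
  ring

variable {Λ : Measure (Predicate k)} [IsProbabilityMeasure Λ] {α : ℝ}
  {Ω : Type*} [MeasurableSpace Ω] {P : Measure Ω} [IsProbabilityMeasure P]
  {I : (j : Fin ℓ') → Ω → CSPInstance k (b j * α) n} {J : Fin ℓ' → Ω → Disorder k n}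

/-- The constant of the term of order `1/n`. -/
def roundingConst (A : Matrix (Fin ℓ) (Fin ℓ') ℝ) (α : ℝ) : ℝ :=
  ((∑ j, colSum A j) * roundingCost (α ^ (2 / 3 : ℝ)) (α / ℓ) + (∑ j, colSum A j) / α) / ℓ

/-- The unnormalised maximum is a Lipschitz function of a sum of at most `∑_j b_j α n` independent
fields of size `ℓ/α`; dividing by `ℓ n` leaves a variance of order `1/n`. -/
lemma IsHiddenCSP.normalizedMax_memLp_variance (hI : IsHiddenCSP Λ α b P I) (hn : 0 < n)
    (hΛ : ∀ᵐ f ∂Λ, ∀ σ, f σ ∈ Set.Icc (-1 : ℝ) 1) (hℓ : 0 < ℓ) (hα : 0 < α)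
    (hA : IsCoupling A b) {S : Set (overlapPolytope ℓ)} (hS : (overlapPreimage S n).Nonempty) :
    MemLp (fun ω => normalizedMax S (cspGrand α A b fun j => I j ω)) 2 P ∧
      Var[fun ω => normalizedMax S (cspGrand α A b fun j => I j ω); P]
        ≤ (∑ j, b j / α) / n := by
  have : Nonempty (overlapPreimage S n) := hS.to_subtype
  have : Fintype (overlapPreimage S n) := Fintype.ofFinite _
  have hℓ0 : (ℓ : ℝ) ≠ 0 := by positivity
  have hn0 : (n : ℝ) ≠ 0 := by positivity
  let X : overlapPreimage S n → Fin ℓ → Cube n := Subtype.val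
  have hv := hI.hasLipschitzVariance hn hΛ hα hA X
  have hm := hI.aemeasurable_rawInstanceField (A := A) X
  have he : (fun ω => normalizedMax S (cspGrand α A b fun j => I j ω)) = fun ω =>
      (ℓ * n : ℝ)⁻¹ * ⨆ x, (∑ j, fun ω => rawInstanceField (1 / α) (fun i => A i j) X (I j ω)) ω x
      := by
    funext ω
    rw [normalizedMax_eq, div_eq_inv_mul]
    congr 2
    funext x
    rw [Finset.sum_apply, Finset.sum_apply]
    exact cspGrand_eq α A b (fun j => I j ω) X x
  rw [he]
  refine ⟨(memLp_iSup hm hv).const_mul _, ?_⟩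
  rw [variance_const_mul]
  have h1 := variance_iSup_le hm hv
  calc _ ≤ ((ℓ * n : ℝ)⁻¹) ^ 2 * ∑ j, numClauses (b j * α) n * (1 / α * ℓ) ^ 2 := by gcongr
    _ ≤ ((ℓ * n : ℝ)⁻¹) ^ 2 * ∑ j, b j * α * n * (1 / α * ℓ) ^ 2 := by
        have hN : ∀ j, (numClauses (b j * α) n : ℝ) ≤ b j * α * n := fun j => by
          have := hA.nonneg j
          exact Nat.floor_le (by positivity)
        gcongr with j
        exact hN j
    _ = _ := by
        rw [Finset.mul_sum, Finset.sum_div]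
        refine Finset.sum_congr rfl fun j _ => ?_
        field_simp

omit [IsProbabilityMeasure Λ] [MeasurableSpace Ω] in
lemma inv_sqrt_mul_normalizedMax_sgGrand (hA : IsCoupling A b) (S : Set (overlapPolytope ℓ))
    (ω : Ω) :
    1 / √α * normalizedMax S (sgGrand (mixture Λ) A b fun j => J j ω) = (ℓ * n : ℝ)⁻¹ *
      ⨆ x : overlapPreimage S n, (∑ j, fun ω => √(b j / α) •
        gaussianField (sgMatrix (mixture Λ) (fun i => A i j) Subtype.val) (J j ω)) ω x := by
  rw [normalizedMax_eq, div_eq_inv_mul (⨆ x : overlapPreimage S n, _), mul_left_comm, Real.mul_iSup_of_nonneg (by positivity)]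
  congr 2
  funext x
  rw [Finset.sum_apply, Finset.sum_apply]
  exact sgGrand_eq hA.nonneg (fun j => J j ω) Subtype.val x

omit [IsProbabilityMeasure Λ] [IsProbabilityMeasure P] in
lemma IsHiddenDisorder.aemeasurable_sum (hJ : IsHiddenDisorder P J) {ι : Type*}
    (X : ι → Fin ℓ → Cube n) :
    AEMeasurable (∑ j, fun ω => √(b j / α) •
        gaussianField (sgMatrix (mixture Λ) (fun i => A i j) X) (J j ω)) P :=
  Finset.aemeasurable_sum _ fun j _ => hJ.aemeasurable_smul_gaussianField
    (fun j => sgMatrix (mixture Λ) (fun i => A i j) X) (fun j => √(b j / α)) j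

lemma IsHiddenDisorder.normalizedMax_memLp_variance (hJ : IsHiddenDisorder P J) (hn : 0 < n)
    (hΛ : ∀ᵐ f ∂Λ, ∀ σ, f σ ∈ Set.Icc (-1 : ℝ) 1) (hℓ : 0 < ℓ) (hα : 0 < α)
    (hA : IsCoupling A b) {S : Set (overlapPolytope ℓ)} (hS : (overlapPreimage S n).Nonempty) :
    MemLp (fun ω => 1 / √α * normalizedMax S (sgGrand (mixture Λ) A b fun j => J j ω)) 2 P ∧
      Var[fun ω => 1 / √α * normalizedMax S (sgGrand (mixture Λ) A b fun j => J j ω); P]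
        ≤ (∑ j, b j / α) / n := by
  have : Nonempty (overlapPreimage S n) := hS.to_subtype
  have : Fintype (overlapPreimage S n) := Fintype.ofFinite _
  have hℓ0 : (ℓ : ℝ) ≠ 0 := by positivity
  have hn0 : (n : ℝ) ≠ 0 := by positivity
  have hv := hJ.hasLipschitzVariance hΛ hα hA (Subtype.val : overlapPreimage S n → _)
  have hm := hJ.aemeasurable_sum (A := A) (b := b) (Λ := Λ) (α := α)
    (Subtype.val : overlapPreimage S n → _)
  simp_rw [inv_sqrt_mul_normalizedMax_sgGrand hA S]
  refine ⟨(memLp_iSup hm hv).const_mul _, ?_⟩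
  rw [variance_const_mul]
  have h1 := variance_iSup_le hm hv
  calc _ ≤ ((ℓ * n : ℝ)⁻¹) ^ 2 * ∑ j, b j / α * (ℓ ^ 2 * n) := by gcongr
    _ = _ := by
        rw [← Finset.sum_mul]
        field_simp

/-- The expected normalized maxima of the two coupled models agree up to `O(α^{-2/3}) + O(1/n)`. -/
lemma abs_integral_normalizedMax_sub_le (hI : IsHiddenCSP Λ α b P I) (hJ : IsHiddenDisorder P J)
    (hn : 0 < n) (hΛ : ∀ᵐ f ∂Λ, ∀ σ, f σ ∈ Set.Icc (-1 : ℝ) 1) (hℓ : 0 < ℓ)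
    (hα : errorConst ℓ ≤ α) (hA : IsCoupling A b) {S : Set (overlapPolytope ℓ)}
    (hS : (overlapPreimage S n).Nonempty) :
    |∫ ω, normalizedMax S (cspGrand α A b fun j => I j ω) ∂P - meanValue Λ
        - ∫ ω, 1 / √α * normalizedMax S (sgGrand (mixture Λ) A b fun j => J j ω) ∂P|
      ≤ errorConst ℓ * α ^ (-(2 / 3) : ℝ) + roundingConst A α / n := by
  have : Nonempty (overlapPreimage S n) := hS.to_subtype
  have : Fintype (overlapPreimage S n) := Fintype.ofFinite _
  have hℓ0 : (0 : ℝ) < ℓ := by exact_mod_cast hℓ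
  have hn0 : (0 : ℝ) < n := by exact_mod_cast hn
  have hα0 : 0 < α := by linarith [(le_errorConst ℓ).1]
  have hβ0 : 0 < α ^ (2 / 3 : ℝ) := by positivity
  let X : overlapPreimage S n → Fin ℓ → Cube n := Subtype.val
  have hm : ∀ j, Measurable (instanceField (1 / α) (fun i => A i j) X :
      CSPInstance k (b j * α) n → _ → ℝ) := fun j => measurable_instanceField _ _ _
  have hclose := isClose_coupled hI hJ hn hΛ hℓ hα0 hβ0 (three_mul_rpow_le hℓ hα) hA X
  have hY : AEMeasurable (∑ j, fun ω => instanceField (1 / α) (fun i => A i j) X (I j ω)) P :=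
    Finset.aemeasurable_sum _ fun j _ => hI.aemeasurable_comp hm j
  have hZ := hJ.aemeasurable_sum (A := A) (b := b) (Λ := Λ) (α := α) X
  have hdiff := hclose.abs_integral_iSup_sub_le hβ0 hY hZ
  obtain ⟨hWi, hW⟩ := abs_integral_const_sub_le hI hn hΛ hα0 hA
  have := hclose.prob_left
  have hYi : Integrable (fun ω => ⨆ x, (∑ j, fun ω =>
      instanceField (1 / α) (fun i => A i j) X (I j ω)) ω x) P := by
    have h := memLp_of_lipschitz hclose.memLp_left
      (lipschitzWith_iSup (ι := overlapPreimage S n))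
    exact ((memLp_map_measure_iff h.1 hY).1 h).integrable one_le_two
  -- The parts that do not depend on the assignment shift all configurations equally, so they come
  -- out of the maximum and only the centered fields need to be exchanged.
  have heH : ∀ ω, normalizedMax S (cspGrand α A b fun j => I j ω) = (ℓ * n : ℝ)⁻¹ *
      ((⨆ x, (∑ j, fun ω => instanceField (1 / α) (fun i => A i j) X (I j ω)) ω x)
        + ∑ j, colSum A j * instanceConst (1 / α) (I j ω)) := by
    intro ω
    rw [normalizedMax_eq, div_eq_inv_mul, ← iSup_add_const]
    congr 2
    funext x
    rw [Finset.sum_apply, Finset.sum_apply, ← Finset.sum_add_distrib]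
    refine (cspGrand_eq α A b (fun j => I j ω) X x).trans (Finset.sum_congr rfl fun j _ => ?_)
    rw [rawInstanceField_eq, colSum]
  simp_rw [heH, inv_sqrt_mul_normalizedMax_sgGrand hA S]
  rw [integral_const_mul, integral_const_mul, integral_add hYi hWi]
  set EY := ∫ ω, ⨆ x, (∑ j, fun ω => instanceField (1 / α) (fun i => A i j) X (I j ω)) ω x ∂P
  set EZ := ∫ ω, ⨆ x, (∑ j, fun ω => √(b j / α) •
    gaussianField (sgMatrix (mixture Λ) (fun i => A i j) X) (J j ω)) ω x ∂P with hEZ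
  set EW := ∫ ω, ∑ j, colSum A j * instanceConst (1 / α) (I j ω) ∂P
  have hlog := log_card_le (n := n) S
  have e1 : (ℓ * n : ℝ)⁻¹ * (EY + EW) - meanValue Λ - (ℓ * n : ℝ)⁻¹ * EZ
      = (ℓ * n : ℝ)⁻¹ * ((EY - EZ) + (EW - ℓ * n * meanValue Λ)) := by
    field_simp
    ring
  rw [← error_terms_eq hℓ hα0]
  calc _ = |(ℓ * n : ℝ)⁻¹ * ((EY - EZ) + (EW - ℓ * n * meanValue Λ))| := by rw [← e1]
    _ = (ℓ * n : ℝ)⁻¹ * |(EY - EZ) + (EW - ℓ * n * meanValue Λ)| := by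
        rw [abs_mul, abs_of_pos (by positivity : (0 : ℝ) < (ℓ * n : ℝ)⁻¹)]
    -- In order: the smoothing, exchange and rounding errors of the centered fields, then the error
    -- of the floor in the mean of the constants.
    _ ≤ (ℓ * n : ℝ)⁻¹ * ((ℓ * n / α ^ (2 / 3 : ℝ)
          + (ℓ * (α * n * clauseCost (α ^ (2 / 3 : ℝ)) (α / ℓ))
          + (∑ j, colSum A j) * roundingCost (α ^ (2 / 3 : ℝ)) (α / ℓ)))
          + (∑ j, colSum A j) / α) := by
        refine mul_le_mul_of_nonneg_left ((abs_add_le _ _).trans (add_le_add ?_ hW)) (by positivity)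
        refine hdiff.trans (by gcongr)
    _ = _ := by
        rw [roundingConst]
        field_simp
        ring

end Comparison

/-! ### Splitting the error, and concentration -/

/-- Clamping splits a quantity bounded by `B + κ` into a part bounded by `B` and a remainder bounded
by `κ`. This separates the `O(α^(-2/3))` term from the vanishing one. -/
lemma abs_sub_clamp_le {D B κ : ℝ} (hκ : 0 ≤ κ) (hB : 0 ≤ B) (h : |D| ≤ B + κ) :
    |D - max (-B) (min D B)| ≤ κ := by
  have h' := abs_le.1 h
  rw [abs_le]
  rcases le_total D B with h1 | h1
  · rw [min_eq_left h1]
    rcases le_total (-B) D with h2 | h2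
    · rw [max_eq_right h2]; constructor <;> linarith
    · rw [max_eq_left h2]; constructor <;> linarith
  · rw [min_eq_right h1, max_eq_right (by linarith)]
    constructor <;> linarith

lemma abs_clamp_le {D B : ℝ} (hB : 0 ≤ B) : |max (-B) (min D B)| ≤ B :=
  abs_le.2 ⟨le_max_left _ _, max_le (by linarith) (min_le_right _ _)⟩

/-- Chebyshev's inequality at scale `n^{-1/4}`. -/
lemma meas_abs_sub_integral_ge_le {Ω : Type*} [MeasurableSpace Ω] {P : Measure Ω}
    [IsProbabilityMeasure P] {F : Ω → ℝ} (hF : MemLp F 2 P) {n : ℕ} (hn : 0 < n) {V : ℝ}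
    (hV : Var[F; P] ≤ V / n) :
    P {ω | (n : ℝ) ^ (-(1 / 4) : ℝ) ≤ |F ω - ∫ ω, F ω ∂P|}
      ≤ ENNReal.ofReal (V * (n : ℝ) ^ (-(1 / 2) : ℝ)) := by
  have hn0 : (0 : ℝ) < n := by exact_mod_cast hn
  refine (meas_ge_le_variance_div_sq hF (by positivity)).trans (ENNReal.ofReal_le_ofReal ?_)
  have h1 : ((n : ℝ) ^ (-(1 / 4) : ℝ)) ^ 2 = (n : ℝ) ^ (-(1 / 2) : ℝ) := by
    rw [← Real.rpow_natCast, ← Real.rpow_mul hn0.le]; norm_num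
  have h2 : (n : ℝ) ^ (-(1 / 2) : ℝ) * (n : ℝ) ^ (-(1 / 2) : ℝ) = 1 / n := by
    rw [← Real.rpow_add hn0]; norm_num [Real.rpow_neg_one]
  rw [h1, div_le_iff₀ (by positivity), mul_assoc, h2]
  exact hV.trans (le_of_eq (by ring))

lemma tendsto_natCast_rpow_neg {s : ℝ} (hs : 0 < s) :
    Tendsto (fun n : ℕ => (n : ℝ) ^ (-s)) atTop (𝓝 0) :=
  (tendsto_rpow_neg_atTop hs).comp tendsto_natCast_atTop_atTop

end MaxCSP

end

/-! ### The comparison theorem -/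

open MaxCSP in
theorem corollary4p1 (ℓ : ℕ) (hℓ : 0 < ℓ) :
    -- the constant `C` depends on `ℓ` only
    ∃ C : ℝ, 0 < C ∧
      ∀ (k ℓ' : ℕ) (Λ : Measure (MaxCSP.Predicate k)) (_ : IsProbabilityMeasure Λ)
        (_ : ∀ᵐ f ∂Λ, ∀ σ, f σ ∈ Set.Icc (-1 : ℝ) 1)
        (A : Matrix (Fin ℓ) (Fin ℓ') ℝ) (b : Fin ℓ' → ℝ) (_ : MaxCSP.IsCoupling A b)
        (S : Set (MaxCSP.overlapPolytope ℓ)) (_ : IsOpen S)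
        (α : ℝ) (_ : C ≤ α)
        -- for every `n`, the two coupled models, on a probability space `Ω n`
        (Ω : ℕ → Type*) (_ : ∀ n, MeasurableSpace (Ω n)) (P : (n : ℕ) → Measure (Ω n))
        (_ : ∀ n, IsProbabilityMeasure (P n))
        (I : (n : ℕ) → (j : Fin ℓ') → Ω n → MaxCSP.CSPInstance k (b j * α) n)
        (_ : ∀ n, MaxCSP.IsHiddenCSP Λ α b (P n) (I n))
        (J : (n : ℕ) → Fin ℓ' → Ω n → MaxCSP.Disorder k n)
        (_ : ∀ n, MaxCSP.IsHiddenDisorder (P n) (J n))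
        -- the normalized maxima of the grand Hamiltonians
        (maxH maxG : (n : ℕ) → Ω n → ℝ)
        (_ : ∀ n ω, maxH n ω =
          MaxCSP.normalizedMax S (MaxCSP.cspGrand α A b fun j => I n j ω))
        (_ : ∀ n ω, maxG n ω =
          MaxCSP.normalizedMax S (MaxCSP.sgGrand (MaxCSP.mixture Λ) A b fun j => J n j ω)),
        (∀ n, Integrable (maxH n) (P n)) ∧ (∀ n, Integrable (maxG n) (P n)) ∧
        -- the term `O(α^{-2/3})`
        ∃ e : ℕ → ℝ, (∀ n, |e n| ≤ C * α ^ (-(2 / 3 : ℝ))) ∧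
          -- in expectation, with a deterministic `o_n(1)` term `r`
          (∃ r : ℕ → ℝ, Tendsto r atTop (𝓝 0) ∧
            ∀ n, (MaxCSP.overlapPreimage S n).Nonempty →
              ∫ ω, maxH n ω ∂P n =
                MaxCSP.meanValue Λ + 1 / √α * ∫ ω, maxG n ω ∂P n + e n + r n) ∧
          -- without expectations, with a random term `R` that is `o_n(1)` with high probability
          (∃ (R : (n : ℕ) → Ω n → ℝ) (δ : ℕ → ℝ), Tendsto δ atTop (𝓝 0) ∧
            Tendsto (fun n => P n {ω | δ n < |R n ω|}) atTop (𝓝 0) ∧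
            ∀ n, (MaxCSP.overlapPreimage S n).Nonempty → ∀ ω,
              maxH n ω = MaxCSP.meanValue Λ + 1 / √α * maxG n ω + e n + R n ω) := by
  classical
  refine ⟨errorConst ℓ, by linarith [(le_errorConst ℓ).1], ?_⟩
  intro k ℓ' Λ hΛp hΛ A b hA S _ α hα Ω _ P hP I hI J hJ maxH maxG hH hG
  have hα0 : 0 < α := by linarith [(le_errorConst ℓ).1]
  have hsα : 1 / √α ≠ 0 := by positivity
  set B : ℝ := errorConst ℓ * α ^ (-(2 / 3 : ℝ)) with hB
  have hB0 : 0 ≤ B := mul_nonneg (by linarith [(le_errorConst ℓ).1]) (by positivity)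
  have hH' : ∀ n, maxH n = fun ω => normalizedMax S (cspGrand α A b fun j => I n j ω) :=
    fun n => funext (hH n)
  have hG' : ∀ n, (fun ω => 1 / √α * maxG n ω) = fun ω =>
      1 / √α * normalizedMax S (sgGrand (mixture Λ) A b fun j => J n j ω) :=
    fun n => funext fun ω => by rw [hG]
  have pH : ∀ n, 0 < n → (overlapPreimage S n).Nonempty →
      MemLp (maxH n) 2 (P n) ∧ Var[maxH n; P n] ≤ (∑ j, b j / α) / n := fun n hn hS => by
    rw [hH']
    exact (hI n).normalizedMax_memLp_variance hn hΛ hℓ hα0 hA hS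
  have pG : ∀ n, 0 < n → (overlapPreimage S n).Nonempty →
      MemLp (fun ω => 1 / √α * maxG n ω) 2 (P n) ∧
        Var[fun ω => 1 / √α * maxG n ω; P n] ≤ (∑ j, b j / α) / n := fun n hn hS => by
    rw [hG']
    exact (hJ n).normalizedMax_memLp_variance hn hΛ hℓ hα0 hA hS
  -- A real supremum over the empty type is zero, and for `n = 0` the normalisation divides by zero,
  -- which also gives zero. Integrability therefore holds for all `n`.
  have trivialCase : ∀ n, ¬(0 < n ∧ (overlapPreimage S n).Nonempty) →
      (∀ ω, maxH n ω = 0) ∧ ∀ ω, maxG n ω = 0 := by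
    intro n hn
    rcases Nat.eq_zero_or_pos n with rfl | hpos
    · exact ⟨fun ω => by rw [hH, normalizedMax_dim_zero],
        fun ω => by rw [hG, normalizedMax_dim_zero]⟩
    · have hS : ¬(overlapPreimage S n).Nonempty := fun h => hn ⟨hpos, h⟩
      exact ⟨fun ω => by rw [hH, normalizedMax_of_empty hS],
        fun ω => by rw [hG, normalizedMax_of_empty hS]⟩
  have iH : ∀ n, Integrable (maxH n) (P n) := fun n => by
    by_cases h : 0 < n ∧ (overlapPreimage S n).Nonempty
    · exact (pH n h.1 h.2).1.integrable one_le_two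
    · rw [funext (trivialCase n h).1]
      exact integrable_const _
  have iG : ∀ n, Integrable (maxG n) (P n) := fun n => by
    by_cases h : 0 < n ∧ (overlapPreimage S n).Nonempty
    · have h1 := ((pG n h.1 h.2).1.integrable one_le_two).const_mul (1 / √α)⁻¹
      simpa [← mul_assoc, inv_mul_cancel₀ hsα, mul_inv_cancel₀ (Real.sqrt_pos.2 hα0).ne'] using h1
    · rw [funext (trivialCase n h).2]
      exact integrable_const _
  set D : ℕ → ℝ := fun n =>
    ∫ ω, maxH n ω ∂P n - meanValue Λ - ∫ ω, 1 / √α * maxG n ω ∂P n with hD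
  have hκ : 0 ≤ roundingConst A α := by
    have h1 : 0 ≤ ∑ j, colSum A j := Finset.sum_nonneg fun j _ => hA.colSum_nonneg j
    unfold roundingConst roundingCost
    positivity
  have hDle : ∀ n, 0 < n → (overlapPreimage S n).Nonempty →
      |D n| ≤ B + roundingConst A α / n := fun n hn hS => by
    simp only [hD]
    rw [hH', hG']
    exact abs_integral_normalizedMax_sub_le (hI n) (hJ n) hn hΛ hℓ hα hA hS
  -- The error term is the discrepancy `D n` of the expectations clamped to `[-B, B]`; the excess,
  -- of order `1/n` when the preimage is nonempty, goes into `r`. The same `e` serves the statement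
  -- without expectations.
  set e : ℕ → ℝ := fun n => max (-B) (min (D n) B) with he
  set r : ℕ → ℝ := fun n => if (overlapPreimage S n).Nonempty then D n - e n else 0 with hr
  have hrle : ∀ n, 0 < n → |r n| ≤ roundingConst A α / n := fun n hn => by
    simp only [hr]
    split_ifs with hS
    · exact abs_sub_clamp_le (by positivity) hB0 (hDle n hn hS)
    · rw [abs_zero]; positivity
  have hr0 : Tendsto r atTop (𝓝 0) := by
    refine squeeze_zero_norm' ?_ (tendsto_const_div_atTop_nhds_zero_nat (roundingConst A α))
    filter_upwards [eventually_gt_atTop 0] with n hn using hrle n hn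
  refine ⟨iH, iG, e, fun n => abs_clamp_le hB0, ⟨r, hr0, fun n hS => ?_⟩, ?_⟩
  · simp only [hr, if_pos hS, hD]
    rw [integral_const_mul]
    ring
  -- The identity forces `R` wherever the preimage is nonempty. The threshold allows each maximum a
  -- deviation `n^(-1/4)` from its mean, which with variance `O(1/n)` fails with probability
  -- `O(n^(-1/2))`, and adds the deterministic `|r n|`.
  · refine ⟨fun n ω => if (overlapPreimage S n).Nonempty then
        maxH n ω - meanValue Λ - 1 / √α * maxG n ω - e n else 0,
      fun n => 2 * (n : ℝ) ^ (-(1 / 4) : ℝ) + |r n|, ?_, ?_, ?_⟩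
    · have h1 := (tendsto_natCast_rpow_neg (s := 1 / 4) (by norm_num)).const_mul 2
      have h2 := h1.add hr0.abs
      simpa using h2
    · set V := ∑ j, b j / α
      have hlim : Tendsto (fun n : ℕ => ENNReal.ofReal (V * (n : ℝ) ^ (-(1 / 2) : ℝ))
          + ENNReal.ofReal (V * (n : ℝ) ^ (-(1 / 2) : ℝ))) atTop (𝓝 0) := by
        have h1 := (tendsto_natCast_rpow_neg (s := 1 / 2) (by norm_num)).const_mul V
        have h2 := ENNReal.tendsto_ofReal h1
        simpa using h2.add h2
      refine tendsto_of_tendsto_of_tendsto_of_le_of_le' tendsto_const_nhds hlim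
        (Eventually.of_forall fun _ => zero_le) ?_
      filter_upwards [eventually_gt_atTop 0] with n hn
      by_cases hS : (overlapPreimage S n).Nonempty
      · obtain ⟨mH, vH⟩ := pH n hn hS
        obtain ⟨mG, vG⟩ := pG n hn hS
        refine le_trans ?_ (add_le_add (meas_abs_sub_integral_ge_le mH hn vH)
          (meas_abs_sub_integral_ge_le mG hn vG))
        -- A union bound over the two deviation events, valid for any joint law of the two models.
        refine (measure_mono ?_).trans (measure_union_le _ _)
        intro ω hω
        simp only [Set.mem_ofPred_eq, if_pos hS] at hω
        simp only [Set.mem_union, Set.mem_ofPred_eq]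
        by_contra! hcon
        have hdec : maxH n ω - meanValue Λ - 1 / √α * maxG n ω - e n
            = (maxH n ω - ∫ ω, maxH n ω ∂P n)
              - (1 / √α * maxG n ω - ∫ ω, 1 / √α * maxG n ω ∂P n) + r n := by
          simp only [hr, if_pos hS, hD]
          ring
        rw [hdec] at hω
        have h1 := abs_add_le ((maxH n ω - ∫ ω, maxH n ω ∂P n)
              - (1 / √α * maxG n ω - ∫ ω, 1 / √α * maxG n ω ∂P n)) (r n)
        have h2 := abs_sub (maxH n ω - ∫ ω, maxH n ω ∂P n)
              (1 / √α * maxG n ω - ∫ ω, 1 / √α * maxG n ω ∂P n)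
        linarith [hcon.1, hcon.2]
      · have hempty : {ω | 2 * (n : ℝ) ^ (-(1 / 4) : ℝ) + |r n| < |if (overlapPreimage S n).Nonempty
            then maxH n ω - meanValue Λ - 1 / √α * maxG n ω - e n else 0|} = ∅ := by
          ext ω
          simp only [if_neg hS, abs_zero, Set.mem_ofPred_eq, Set.mem_empty_iff_false, iff_false,
            not_lt]
          positivity
        rw [hempty, measure_empty]
        exact zero_le
    · intro n hS ω
      simp only [if_pos hS]
      ring
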